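/- Let $0<p<1$, $q=1-p$, $C=-2/\ln p$, $D=1/\ln p$, and let $\xi_1,\xi_2,\dots$ be independent random variables on a probability space with $P(\xi_i=1)=p$ and $P(\xi_i=0)=q$. For integers $1\le a,s\le n$ let $W^{(n)}_{a,s}$ be the largest $m$ with $1\le m\le n/\gcd(s,n)$ such that $\xi_a=\xi_{a+s}=\cdots=\xi_{a+(m-1)s}=1$, where the indices are reduced mod $n$ to $\{1,\dots,n\}$ (and $W^{(n)}_{a,s}=0$ if $\xi_a=0$). Let $W^{(n)}=\max_{1\le a,s\le n}W^{(n)}_{a,s}$ be the length of the longest arithmetic progression mod $n$ relative to $\xi_1,\dots,\xi_n$. (1) There is a constant $K$, depending only on $p$, such that for all integers $1<r\le n$, $$\Bigl|P(W^{(n)}<r)-\exp\Bigl(-\frac{q\,n^2p^r}{2}\Bigr)\Bigr|\le K\,\frac{\ln^7 n}{n}.$$ (2) For every real $a$ there is a constant $K_a$, depending only on $p$ and $a$, such that for all $n\ge2$ and all real $x\ge D\ln\ln n+a$ with $C\ln n+x\in\mathbb Z$, $$\Bigl|\exp\Bigl(\frac q2\,p^x\Bigr)P(W^{(n)}<C\ln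 n+x)-1\Bigr|\le K_a\,\frac{\ln^7 n}{n^{1-qp^a/2}}.$$ (3) As $n\to\infty$, $\dfrac{W^{(n)}-C\ln n}{\ln\ln n}\to0$ in probability. (4) Almost surely $$\limsup_{n\to\infty}\frac{W^{(n)}}{C\ln n}=\frac32\qquad\text{and}\qquad\liminf_{n\to\infty}\frac{W^{(n)}-C\ln n}{\ln\ln n}=D.$$ (5) Almost surely $$0=\liminf_{n\to\infty}\frac{W^{(2^n)}-C\ln 2^n}{\ln\ln 2^n}<\limsup_{n\to\infty}\frac{W^{(2^n)}-C\ln 2^n}{\ln\ln 2^n}=-D$$ and $$\lim_{n\to\infty}\frac1{n\ln n}\Bigl(\sum_{k=1}^nW^{(2^k)}+\frac{\ln2}{\ln p}\,n^2\Bigr)=0.$$ -/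

import Mathlib

open MeasureTheory ProbabilityTheory Filter Topology

namespace LongestAP

/-- The representative of `k` modulo `n` in `{1, …, n}`: the usual remainder, except that
multiples of `n` are represented by `n` instead of `0`. -/
def modRep (n k : ℕ) : ℕ := if k % n = 0 then n else k % n

open Classical in
/-- For a sequence `x 1, x 2, …`, the largest `m` with `1 ≤ m ≤ n / gcd(s, n)` such that the `m`
terms of `x` at the positions `a, a + s, …, a + (m - 1) s`, taken mod `n` in `{1, …, n}`, are all
equal to `1`; it is `0` if there is no such `m` (that is, if `x a ≠ 1`). -/
noncomputable def longestModAt (x : ℕ → ℝ) (n a s : ℕ) : ℕ :=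
  ((Finset.Icc 1 (n / Nat.gcd s n)).filter
    (fun m => ∀ j : ℕ, j < m → x (modRep n (a + j * s)) = 1)).sup id

/-- The length of the longest arithmetic progression mod `n` relative to `x 1, …, x n`: the
maximum of `longestModAt x n a s` over all `1 ≤ a, s ≤ n`. -/
noncomputable def longestMod (x : ℕ → ℝ) (n : ℕ) : ℕ :=
  (Finset.Icc 1 n).sup fun a => (Finset.Icc 1 n).sup fun s => longestModAt x n a s

/-- `ξ 1, ξ 2, …` are independent Bernoulli random variables with success probability `p`.
(The value `ξ 0` plays no role.) -/
structure IsBernoulliSequence {Ω : Type*} [MeasurableSpace Ω] (P : Measure Ω) (p : ℝ)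
    (ξ : ℕ → Ω → ℝ) : Prop where
  measurable : ∀ i : ℕ, 1 ≤ i → Measurable (ξ i)
  prob_one : ∀ i : ℕ, 1 ≤ i → P {ω | ξ i ω = 1} = ENNReal.ofReal p
  prob_zero : ∀ i : ℕ, 1 ≤ i → P {ω | ξ i ω = 0} = ENNReal.ofReal (1 - p)
  indep : iIndepFun (fun i : ℕ => ξ (i + 1)) P

/-- The random variable `W⁽ⁿ⁾`, the longest length of arithmetic progressions mod `n` relative to
`ξ 1, …, ξ n`. -/
noncomputable def W {Ω : Type*} (ξ : ℕ → Ω → ℝ) (n : ℕ) (ω : Ω) : ℕ :=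
  longestMod (fun i => ξ i ω) n

/-- `C = -2 / ln p`. -/
noncomputable def C (p : ℝ) : ℝ := -2 / Real.log p

/-- `D = 1 / ln p`. -/
noncomputable def D (p : ℝ) : ℝ := 1 / Real.log p

/-- `(W⁽ⁿ⁾ - C ln n) / ln ln n`. -/
noncomputable def normW {Ω : Type*} (ξ : ℕ → Ω → ℝ) (p : ℝ) (n : ℕ) (ω : Ω) : ℝ :=
  ((W ξ n ω : ℝ) - C p * Real.log n) / Real.log (Real.log n)

end LongestAP

set_option linter.unusedSectionVars false

/-! ### Random bits and functions of finitely many of them -/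

namespace LongestAP

/-! The event `r ≤ W` is the event `HasAP n r` about independent bits (`le_W_iff`). Progressions
that are all `true` come in clumps, because each one contains its own shifts. So the proof counts
patterns `Pat`: a `false` bit followed by `r` `true` bits along a progression mod `n`, with one step
kept from each pair `s`, `n - s`. The expected number of patterns is close to `(1 - p) * n ^ 2 * p ^
r / 2`. A progression without any pattern forces a whole cycle of residues to be `true`
(`HasAP.exists_full`), and this is rare.

The number of patterns is nearly Poisson. For a family of local events with count `X`, the
generating function `φ t = E t ^ X` satisfies `φ' = λ φ` up to `b * (φ + 2 ρ)`, where `λ = E X`, `b`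
collects the dependence terms and `ρ` bounds the mass of a neighbourhood. Integrating over `[0, 1]`
bounds `P (X = 0) = φ 0`. The estimate `IsCoin.abs_prob_none_sub_exp_le` has error `b * (1 + 2 ρ)`,
of order `log n ^ 7 / n`. The one-sided `IsCoin.prob_none_le` moves `b` into the exponent and leaves
the additive error `2 b ρ`, of order `log n ^ 10 / n ^ 2`, which is summable. The dependence terms
are bounded by counting overlaps: few pairs of progressions share two terms, and pairs sharing more
than half of their terms have steps tied by linear congruences with small coefficients
(`mem_relatedPairs_of_overlap`). This yields (1) and, after multiplication by the exponential, (2).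
The union bound for the upper tail and (1) for the lower tail give (3).

For the upper limit in (4), the union bound at level `(3/2 + ε) C log n` is summable. Conversely,
two integer progressions with a common difference `d`, starting at `u` and `v`, interleave to a
single progression mod `2 (v - u) - d` with step `v - u` (`hasAP_of_two_progs`). Among moduli of
order `N` there are about `N ^ 3` choices of `(u, v, d)` up to logarithms, so lengths near `3 log N
/ (-log p)` occur. A second moment argument makes this rigorous, and no independence between moduli
is needed.

For the lower limit in (4), the summable error above gives the bound from below by Borel–Cantelli.
For the other direction, moduli `n ≠ m` in a window `[N, N + √N)` are compared: the events that
neither has a progression of length `r` are almost independent (`IsCoin.prob_not_hasAP_and_le`),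
again because large overlaps force a small linear relation on the step. The second moment method
then finds a modulus with short `W` in the window.

For (5), summable tails give two of the four bounds along `2 ^ k`, and convergence in probability
gives the upper bound on the lower limit. The lower bound on the upper limit uses patterns mod `2 ^
k` that avoid all positions of an earlier modulus. These are independent across sparse exponents
(`IsCoin.prob_forall_not_le_pow`). For the averages, the probability that the normalised length is
at least `ε` in absolute value decays like a negative power of `k`, so exceptional `k` have density
zero almost surely. -/

/-- Independent random bits, each equal to `true` with probability `p`. -/
structure IsCoin {Ω : Type*} [MeasurableSpace Ω] (P : Measure Ω) (p : ℝ)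
    (η : ℕ → Ω → Bool) : Prop where
  measurable : ∀ i, Measurable (η i)
  prob_true : ∀ i, P.real {ω | η i ω = true} = p
  indep : iIndepFun η P

/-- The configuration of bits at an outcome. -/
def bits {Ω : Type*} (η : ℕ → Ω → Bool) (ω : Ω) : ℕ → Bool := fun i => η i ω

/-- The probability of an event described by the bits. -/
noncomputable def prob {Ω : Type*} [MeasurableSpace Ω] (P : Measure Ω) (η : ℕ → Ω → Bool)
    (A : (ℕ → Bool) → Prop) : ℝ := P.real {ω | A (bits η ω)}

/-- The expectation of a function of the bits. -/
noncomputable def expct {Ω : Type*} [MeasurableSpace Ω] (P : Measure Ω) (η : ℕ → Ω → Bool)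
    (g : (ℕ → Bool) → ℝ) : ℝ := ∫ ω, g (bits η ω) ∂P

open Classical in
/-- The indicator function of an event described by the bits. -/
noncomputable def ind (A : (ℕ → Bool) → Prop) (x : ℕ → Bool) : ℝ := if A x then 1 else 0

/-- A function of the bits that depends on finitely many of them only. -/
def FinDep {β : Type*} (g : (ℕ → Bool) → β) : Prop := ∃ S : Finset ℕ, DependsOn g (S : Set ℕ)

section FinDep

variable {β γ δ : Type*} {g : (ℕ → Bool) → β} {h : (ℕ → Bool) → γ}

lemma DependsOn.comp_left (f : β → γ) {S : Set ℕ} (hg : DependsOn g S) :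
    DependsOn (fun x => f (g x)) S := fun _ _ hxy => congrArg f (hg hxy)

lemma DependsOn.comp₂ (f : β → γ → δ) {S T : Set ℕ} (hg : DependsOn g S) (hh : DependsOn h T) :
    DependsOn (fun x => f (g x) (h x)) (S ∪ T) := fun _ _ hxy =>
  congrArg₂ f (hg fun i hi => hxy i (Or.inl hi)) (hh fun i hi => hxy i (Or.inr hi))

lemma FinDep.comp (f : β → γ) (hg : FinDep g) : FinDep (fun x => f (g x)) :=
  let ⟨S, hS⟩ := hg
  ⟨S, DependsOn.comp_left f hS⟩

lemma FinDep.comp₂ (f : β → γ → δ) (hg : FinDep g) (hh : FinDep h) :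
    FinDep (fun x => f (g x) (h x)) := by
  classical
  obtain ⟨S, hS⟩ := hg
  obtain ⟨T, hT⟩ := hh
  exact ⟨S ∪ T, by simpa using DependsOn.comp₂ f hS hT⟩

lemma FinDep.const (b : β) : FinDep (fun _ : ℕ → Bool => b) := ⟨∅, fun _ _ _ => rfl⟩

open Classical in
lemma FinDep.ind {A : (ℕ → Bool) → Prop} (hA : FinDep A) : FinDep (ind A) :=
  hA.comp (fun a : Prop => if a then (1 : ℝ) else 0)

lemma FinDep.sum {ι : Type*} (F : Finset ι) {g : ι → (ℕ → Bool) → ℝ}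
    (hg : ∀ i ∈ F, FinDep (g i)) : FinDep (fun x => ∑ i ∈ F, g i x) := by
  classical
  induction F using Finset.induction_on with
  | empty => simpa using FinDep.const (0 : ℝ)
  | insert a s ha ih =>
    simp only [Finset.sum_insert ha]
    exact FinDep.comp₂ (· + ·) (hg a (by simp)) (ih fun i hi => hg i (by simp [hi]))

lemma FinDep.ball {ι : Type*} (F : Finset ι) {A : ι → (ℕ → Bool) → Prop}
    (hA : ∀ i ∈ F, FinDep (A i)) : FinDep (fun x => ∀ i ∈ F, A i x) := by
  classical
  induction F using Finset.induction_on with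
  | empty => simpa using FinDep.const True
  | insert a s ha ih =>
    simp only [Finset.forall_mem_insert]
    exact FinDep.comp₂ And (hA a (by simp)) (ih fun i hi => hA i (by simp [hi]))

lemma FinDep.bit (i : ℕ) : FinDep (fun x : ℕ → Bool => x i) :=
  ⟨{i}, fun _ _ hxy => hxy i (by simp)⟩

end FinDep

/-! ### Expectations and probabilities of finitely determined events -/

section Expectation

variable {Ω : Type*} [MeasurableSpace Ω] {P : Measure Ω} [IsProbabilityMeasure P] {p : ℝ}
  {η : ℕ → Ω → Bool}

/-- Factoring through the finite discrete type `S → Bool` settles measurability, boundedness and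
independence for every function used below. -/
lemma DependsOn.exists_restrict {β : Type*} [Nonempty β] {g : (ℕ → Bool) → β} {S : Finset ℕ}
    (hg : DependsOn g (S : Set ℕ)) :
    ∃ g' : (S → Bool) → β, ∀ x, g x = g' (fun i : S => x i) := by
  classical
  refine ⟨fun y => g (fun i => if h : i ∈ S then y ⟨i, h⟩ else false), fun x => hg ?_⟩
  intro i hi
  simp [Finset.mem_coe.1 hi]

lemma IsCoin.measurable_comp (hη : IsCoin P p η) {β : Type*} [MeasurableSpace β] [Nonempty β]
    {g : (ℕ → Bool) → β} (hg : FinDep g) : Measurable (fun ω => g (bits η ω)) := by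
  obtain ⟨S, hS⟩ := hg
  obtain ⟨g', hg'⟩ := DependsOn.exists_restrict hS
  have : (fun ω => g (bits η ω)) = g' ∘ (fun ω (i : S) => η i ω) := by
    ext ω; simp [hg', bits]
  rw [this]
  exact (Measurable.of_discrete (f := g')).comp (measurable_pi_lambda _ fun i => hη.measurable i)

lemma IsCoin.measurableSet (hη : IsCoin P p η) {A : (ℕ → Bool) → Prop} (hA : FinDep A) :
    MeasurableSet {ω | A (bits η ω)} := by
  have := hη.measurable_comp hA
  exact measurableSet_setOfPred.2 this

lemma FinDep.exists_bound {g : (ℕ → Bool) → ℝ} (hg : FinDep g) : ∃ B, ∀ x, |g x| ≤ B := by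
  obtain ⟨S, hS⟩ := hg
  obtain ⟨g', hg'⟩ := DependsOn.exists_restrict hS
  obtain ⟨B, hB⟩ := (Set.finite_range fun y => |g' y|).bddAbove
  exact ⟨B, fun x => by rw [hg']; exact hB ⟨_, rfl⟩⟩

lemma IsCoin.integrable (hη : IsCoin P p η) {g : (ℕ → Bool) → ℝ} (hg : FinDep g) :
    Integrable (fun ω => g (bits η ω)) P := by
  obtain ⟨B, hB⟩ := hg.exists_bound
  exact Integrable.of_bound (hη.measurable_comp hg).aestronglyMeasurable B
    (Eventually.of_forall fun ω => hB _)

lemma IsCoin.expct_mul_of_disjoint (hη : IsCoin P p η) {g h : (ℕ → Bool) → ℝ} {S T : Finset ℕ}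
    (hg : DependsOn g (S : Set ℕ)) (hh : DependsOn h (T : Set ℕ)) (hST : Disjoint S T) :
    expct P η (fun x => g x * h x) = expct P η g * expct P η h := by
  obtain ⟨g', hg'⟩ := DependsOn.exists_restrict hg
  obtain ⟨h', hh'⟩ := DependsOn.exists_restrict hh
  have hind := (hη.indep.indepFun_finset S T hST hη.measurable).comp
    (Measurable.of_discrete (f := g')) (Measurable.of_discrete (f := h'))
  have := hind.integral_fun_mul_eq_mul_integral
    (((Measurable.of_discrete (f := g')).comp
      (measurable_pi_lambda _ fun i => hη.measurable i)).aestronglyMeasurable)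
    (((Measurable.of_discrete (f := h')).comp
      (measurable_pi_lambda _ fun i => hη.measurable i)).aestronglyMeasurable)
  simpa [expct, hg', hh', bits, Function.comp_def] using this

lemma IsCoin.expct_ind (hη : IsCoin P p η) {A : (ℕ → Bool) → Prop} (hA : FinDep A) :
    expct P η (ind A) = prob P η A := by
  classical
  rw [prob, ← integral_indicator_one (hη.measurableSet hA), expct]
  congr 1

lemma prob_mono {A B : (ℕ → Bool) → Prop} (h : ∀ x, A x → B x) : prob P η A ≤ prob P η B :=
  measureReal_mono (fun ω hω => h _ hω)

lemma prob_nonneg (A : (ℕ → Bool) → Prop) : 0 ≤ prob P η A := measureReal_nonneg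

lemma prob_le_one (A : (ℕ → Bool) → Prop) : prob P η A ≤ 1 := measureReal_le_one

lemma prob_or_le (A B : (ℕ → Bool) → Prop) :
    prob P η (fun x => A x ∨ B x) ≤ prob P η A + prob P η B :=
  measureReal_union_le {ω | A (bits η ω)} {ω | B (bits η ω)}

lemma prob_exists_le {ι : Type*} (F : Finset ι) (A : ι → (ℕ → Bool) → Prop) :
    prob P η (fun x => ∃ i ∈ F, A i x) ≤ ∑ i ∈ F, prob P η (A i) := by
  have : {ω | ∃ i ∈ F, A i (bits η ω)} = ⋃ i ∈ F, {ω | A i (bits η ω)} := by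
    ext; simp
  rw [prob, this]
  exact measureReal_biUnion_finset_le F _

lemma IsCoin.prob_not (hη : IsCoin P p η) {A : (ℕ → Bool) → Prop} (hA : FinDep A) :
    prob P η (fun x => ¬ A x) = 1 - prob P η A := by
  have := measureReal_compl (μ := P) (hη.measurableSet hA)
  simpa [prob, Set.compl_ofPred] using this

lemma IsCoin.expct_mono (hη : IsCoin P p η) {g h : (ℕ → Bool) → ℝ} (hg : FinDep g)
    (hh : FinDep h) (hgh : ∀ x, g x ≤ h x) : expct P η g ≤ expct P η h :=
  integral_mono (hη.integrable hg) (hη.integrable hh) fun _ => hgh _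

lemma IsCoin.expct_add (hη : IsCoin P p η) {g h : (ℕ → Bool) → ℝ} (hg : FinDep g)
    (hh : FinDep h) : expct P η (fun x => g x + h x) = expct P η g + expct P η h :=
  integral_add (hη.integrable hg) (hη.integrable hh)

lemma IsCoin.expct_sub (hη : IsCoin P p η) {g h : (ℕ → Bool) → ℝ} (hg : FinDep g)
    (hh : FinDep h) : expct P η (fun x => g x - h x) = expct P η g - expct P η h :=
  integral_sub (hη.integrable hg) (hη.integrable hh)

lemma IsCoin.expct_sum (hη : IsCoin P p η) {ι : Type*} (F : Finset ι) {g : ι → (ℕ → Bool) → ℝ}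
    (hg : ∀ i ∈ F, FinDep (g i)) :
    expct P η (fun x => ∑ i ∈ F, g i x) = ∑ i ∈ F, expct P η (g i) :=
  integral_finsetSum F fun i hi => hη.integrable (hg i hi)

lemma expct_mul_const (c : ℝ) (g : (ℕ → Bool) → ℝ) :
    expct P η (fun x => g x * c) = expct P η g * c := integral_mul_const c _

lemma expct_const (c : ℝ) : expct P η (fun _ => c) = c := by simp [expct]

lemma expct_nonneg {g : (ℕ → Bool) → ℝ} (hg : ∀ x, 0 ≤ g x) : 0 ≤ expct P η g :=
  integral_nonneg fun _ => hg _

lemma ind_nonneg (A : (ℕ → Bool) → Prop) (x : ℕ → Bool) : 0 ≤ ind A x := by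
  unfold ind; split_ifs <;> norm_num

lemma ind_of {A : (ℕ → Bool) → Prop} {x : ℕ → Bool} (h : A x) : ind A x = 1 := if_pos h

lemma ind_of_not {A : (ℕ → Bool) → Prop} {x : ℕ → Bool} (h : ¬ A x) : ind A x = 0 := if_neg h

lemma ind_mul (A B : (ℕ → Bool) → Prop) (x : ℕ → Bool) :
    ind A x * ind B x = ind (fun x => A x ∧ B x) x := by
  unfold ind; by_cases hA : A x <;> by_cases hB : B x <;> simp [hA, hB]

lemma IsCoin.prob_forall_true (hη : IsCoin P p η) (T : Finset ℕ) :
    prob P η (fun x => ∀ i ∈ T, x i = true) = p ^ T.card := by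
  have h := hη.indep.measure_inter_preimage_eq_mul T (sets := fun _ => {true})
    (fun i _ => MeasurableSet.singleton _)
  have h1 : {ω | ∀ i ∈ T, bits η ω i = true} = ⋂ i ∈ T, η i ⁻¹' {true} := by
    ext; simp [bits]
  rw [prob, h1, measureReal_def, h, ENNReal.toReal_prod]
  rw [Finset.prod_congr rfl (fun i _ => ?_), Finset.prod_const]
  exact hη.prob_true i

lemma IsCoin.prob_false_forall_true (hη : IsCoin P p η) (T : Finset ℕ) {z : ℕ} (hz : z ∉ T) :
    prob P η (fun x => x z = false ∧ ∀ i ∈ T, x i = true) = (1 - p) * p ^ T.card := by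
  classical
  have hT := hη.prob_forall_true T
  have hzT := hη.prob_forall_true (insert z T)
  rw [Finset.card_insert_of_notMem hz, pow_succ'] at hzT
  have hA : FinDep (fun x : ℕ → Bool => ∀ i ∈ T, x i = true) :=
    FinDep.ball T fun i _ => (FinDep.bit i).comp (· = true)
  have hB : FinDep (fun x : ℕ → Bool => ∀ i ∈ insert z T, x i = true) :=
    FinDep.ball _ fun i _ => (FinDep.bit i).comp (· = true)
  have hC : FinDep (fun x : ℕ → Bool => x z = false ∧ ∀ i ∈ T, x i = true) :=
    ((FinDep.bit z).comp (· = false)).comp₂ And hA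
  rw [← hη.expct_ind hA] at hT
  rw [← hη.expct_ind hB] at hzT
  rw [← hη.expct_ind hC]
  have : ind (fun x : ℕ → Bool => x z = false ∧ ∀ i ∈ T, x i = true)
      = fun x => ind (fun x : ℕ → Bool => ∀ i ∈ T, x i = true) x
        - ind (fun x : ℕ → Bool => ∀ i ∈ insert z T, x i = true) x := by
    ext x
    simp only [Finset.forall_mem_insert]
    by_cases h2 : ∀ i ∈ T, x i = true
    · by_cases h1 : x z = true
      · rw [ind_of_not (by simp [h1]), ind_of h2, ind_of ⟨h1, h2⟩, sub_self]
      · rw [ind_of ⟨by simpa using h1, h2⟩, ind_of h2, ind_of_not (fun h => h1 h.1), sub_zero]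
    · rw [ind_of_not (fun h => h2 h.2), ind_of_not h2, ind_of_not (fun h => h2 h.2), sub_self]
  rw [this, hη.expct_sub hA.ind hB.ind, hT, hzT]
  ring

end Expectation

/-! ### Poisson approximation through the generating function -/

section Poisson

variable {ι : Type*} (R : ι → (ℕ → Bool) → Prop)

open Classical in
/-- The number of events of a finite family that occur. -/
noncomputable def occ (G : Finset ι) (x : ℕ → Bool) : ℕ := (G.filter fun β => R β x).card

variable {R}

lemma occ_eq_sum (G : Finset ι) (x : ℕ → Bool) : (occ R G x : ℝ) = ∑ β ∈ G, ind (R β) x := by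
  classical
  simp [occ, ind]

lemma occ_mono {G H : Finset ι} (h : G ⊆ H) (x : ℕ → Bool) : occ R G x ≤ occ R H x := by
  classical
  exact Finset.card_le_card (Finset.filter_subset_filter _ h)

lemma occ_dependsOn {G : Finset ι} {S : Finset ℕ}
    (hR : ∀ α ∈ G, DependsOn (R α) (S : Set ℕ)) : DependsOn (occ R G) (S : Set ℕ) := by
  classical
  intro x y hxy
  unfold occ
  congr 1
  exact Finset.filter_congr fun β hβ => by rw [hR β hβ hxy]

lemma occ_finDep {G : Finset ι} (hR : ∀ α ∈ G, FinDep (R α)) : FinDep (occ R G) := by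
  classical
  choose! S hS using hR
  refine ⟨G.biUnion S, occ_dependsOn fun α hα => (hS α hα).mono ?_⟩
  exact_mod_cast Finset.subset_biUnion_of_mem S hα

lemma occ_erase_add_one [DecidableEq ι] {G : Finset ι} {α : ι} (hα : α ∈ G) {x : ℕ → Bool}
    (hx : R α x) : occ R (G.erase α) x + 1 = occ R G x := by
  classical
  unfold occ
  rw [Finset.filter_erase, Finset.card_erase_add_one]
  simp [hα, hx]

/-- If no event of `H \ G` occurs, the two counts agree. Otherwise one summand on the right already
equals `t ^ occ R G x`. The power of `t` is kept instead of being bounded by 1, so that later errors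
are proportional to the generating function itself. -/
lemma pow_occ_sub_le [DecidableEq ι] {G H : Finset ι} (h : G ⊆ H) {t : ℝ} (ht0 : 0 ≤ t)
    (x : ℕ → Bool) :
    t ^ occ R G x - t ^ occ R H x ≤ ∑ β ∈ H \ G, ind (R β) x * t ^ occ R G x := by
  classical
  by_cases hex : ∃ β ∈ H \ G, R β x
  · obtain ⟨β, hβ, hRβ⟩ := hex
    have h1 : ind (R β) x * t ^ occ R G x = t ^ occ R G x := by simp [ind, hRβ]
    have h2 := Finset.single_le_sum (f := fun β => ind (R β) x * t ^ occ R G x)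
      (fun β _ => mul_nonneg (ind_nonneg _ _) (pow_nonneg ht0 _)) hβ
    simp only [h1] at h2
    have : 0 ≤ t ^ occ R H x := by positivity
    linarith
  · push Not at hex
    have : occ R H x = occ R G x := by
      unfold occ
      congr 1
      ext β
      simp only [Finset.mem_filter]
      refine ⟨fun hβ => ⟨?_, hβ.2⟩, fun hβ => ⟨h hβ.1, hβ.2⟩⟩
      by_contra hG
      exact hex β (by simp [hβ.1, hG]) hβ.2
    rw [this, sub_self]
    exact Finset.sum_nonneg fun β _ => mul_nonneg (ind_nonneg _ _) (pow_nonneg ht0 _)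

variable {Ω : Type*} [MeasurableSpace Ω] {P : Measure Ω} [IsProbabilityMeasure P] {p : ℝ}
  {η : ℕ → Ω → Bool}

lemma IsCoin.expct_comp_nat (hη : IsCoin P p η) {X : (ℕ → Bool) → ℕ} (hX : FinDep X) {N : ℕ}
    (hN : ∀ x, X x ≤ N) (f : ℕ → ℝ) :
    expct P η (fun x => f (X x)) =
      ∑ k ∈ Finset.range (N + 1), prob P η (fun x => X x = k) * f k := by
  have h1 : ∀ x, f (X x) = ∑ k ∈ Finset.range (N + 1), ind (fun x => X x = k) x * f k := by
    intro x
    rw [Finset.sum_eq_single (X x)]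
    · simp [ind]
    · intro b _ hb
      simp [ind, hb.symm]
    · intro h
      exact absurd (Finset.mem_range.2 (Nat.lt_succ_of_le (hN x))) h
  simp only [h1]
  rw [hη.expct_sum _ fun k _ => (hX.comp (· = k)).ind.comp (· * f k)]
  refine Finset.sum_congr rfl fun k _ => ?_
  rw [expct_mul_const, hη.expct_ind (hX.comp (· = k))]

lemma IsCoin.hasDerivAt_expct_pow (hη : IsCoin P p η) {X : (ℕ → Bool) → ℕ} (hX : FinDep X) {N : ℕ}
    (hN : ∀ x, X x ≤ N) (t : ℝ) :
    HasDerivAt (fun t => expct P η (fun x => t ^ X x))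
      (expct P η (fun x => (X x : ℝ) * t ^ (X x - 1))) t := by
  have h1 := fun t : ℝ => hη.expct_comp_nat hX hN (fun k => t ^ k)
  have h2 := hη.expct_comp_nat hX hN (fun k => (k : ℝ) * t ^ (k - 1))
  simp only [h1, h2]
  exact HasDerivAt.fun_sum fun k _ => (hasDerivAt_pow k t).const_mul _

/-- A family of events, each determined by a finite set of bits. -/
structure IsLocalFamily (R : ι → (ℕ → Bool) → Prop) (supp : ι → Finset ℕ) : Prop where
  dependsOn : ∀ α, DependsOn (R α) (supp α : Set ℕ)

/-- Two indices are adjacent if the corresponding sets of bits meet. -/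
def Adj (supp : ι → Finset ℕ) (α β : ι) : Prop := α = β ∨ ¬ Disjoint (supp α) (supp β)

open Classical in
/-- The first-order dependence term in the Poisson approximation for a family of events. -/
noncomputable def depOne (P : Measure Ω) (η : ℕ → Ω → Bool) (R : ι → (ℕ → Bool) → Prop)
    (supp : ι → Finset ℕ) (F G : Finset ι) : ℝ :=
  ∑ α ∈ F, ∑ β ∈ G.filter (Adj supp α), prob P η (R α) * prob P η (R β)

open Classical in
/-- The second-order dependence term in the Poisson approximation for a family of events. -/
noncomputable def depTwo (P : Measure Ω) (η : ℕ → Ω → Bool) (R : ι → (ℕ → Bool) → Prop)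
    (supp : ι → Finset ℕ) (F G : Finset ι) : ℝ :=
  ∑ α ∈ F, ∑ β ∈ G.filter (fun β => β ≠ α ∧ Adj supp α β), prob P η (fun x => R α x ∧ R β x)

variable {supp : ι → Finset ℕ}

lemma IsLocalFamily.finDep (hR : IsLocalFamily R supp) (α : ι) : FinDep (R α) :=
  ⟨supp α, hR.dependsOn α⟩

lemma IsLocalFamily.finDep_occ (hR : IsLocalFamily R supp) (G : Finset ι) : FinDep (occ R G) :=
  occ_finDep fun α _ => hR.finDep α

lemma IsLocalFamily.finDep_pow (hR : IsLocalFamily R supp) (G : Finset ι) (t : ℝ) :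
    FinDep (fun x => t ^ occ R G x) := (hR.finDep_occ G).comp (t ^ ·)

open Classical in
lemma IsCoin.expct_ind_mul_pow_occ (hη : IsCoin P p η) (hR : IsLocalFamily R supp)
    {A : (ℕ → Bool) → Prop} {S : Finset ℕ} (hA : DependsOn A (S : Set ℕ)) {G : Finset ι}
    (hG : ∀ β ∈ G, Disjoint S (supp β)) (t : ℝ) :
    expct P η (fun x => ind A x * t ^ occ R G x)
      = prob P η A * expct P η (fun x => t ^ occ R G x) := by
  rw [← hη.expct_ind ⟨S, hA⟩]
  refine hη.expct_mul_of_disjoint (S := S) (T := G.biUnion supp)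
    (DependsOn.comp_left (fun a : Prop => if a then (1 : ℝ) else 0) hA) ?_ ?_
  · refine DependsOn.comp_left (t ^ ·) (occ_dependsOn fun α hα => (hR.dependsOn α).mono ?_)
    exact_mod_cast Finset.subset_biUnion_of_mem supp hα
  · rw [Finset.disjoint_biUnion_right]
    exact hG

open Classical in
/-- Removing the neighbours of `α` and `β` changes the generating function by little. -/
lemma IsCoin.expct_pow_occ_nonadj_le (hη : IsCoin P p η) (hR : IsLocalFamily R supp)
    {F : Finset ι} {ρ : ℝ}
    (hρ : ∀ α ∈ F, ∑ β ∈ F.filter (Adj supp α), prob P η (R β) ≤ ρ) {t : ℝ} (ht0 : 0 ≤ t)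
    (ht1 : t ≤ 1) {α β : ι} (hα : α ∈ F) (hβ : β ∈ F) :
    expct P η (fun x => t ^ occ R (F.filter fun γ => ¬ Adj supp α γ ∧ ¬ Adj supp β γ) x)
      ≤ expct P η (fun x => t ^ occ R F x) + 2 * ρ := by
  set G := F.filter fun γ => ¬ Adj supp α γ ∧ ¬ Adj supp β γ with hG
  have h1 : ∀ x, t ^ occ R G x ≤ t ^ occ R F x +
      (∑ γ ∈ F.filter (Adj supp α), ind (R γ) x + ∑ γ ∈ F.filter (Adj supp β), ind (R γ) x) := by
    intro x
    have h2 := pow_occ_sub_le (R := R) (Finset.filter_subset _ _ : G ⊆ F) ht0 x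
    have h3 : ∑ γ ∈ F \ G, ind (R γ) x * t ^ occ R G x ≤
        ∑ γ ∈ F.filter (Adj supp α) ∪ F.filter (Adj supp β), ind (R γ) x := by
      refine (Finset.sum_le_sum fun γ _ => mul_le_of_le_one_right (ind_nonneg _ _)
        (pow_le_one₀ ht0 ht1)).trans
        (Finset.sum_le_sum_of_subset_of_nonneg ?_ fun γ _ _ => ind_nonneg _ _)
      intro γ hγ
      simp only [hG, Finset.mem_sdiff, Finset.mem_filter, Finset.mem_union] at hγ ⊢
      grind
    have h4 := Finset.sum_union_inter (s₁ := F.filter (Adj supp α)) (s₂ := F.filter (Adj supp β))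
      (f := fun γ => ind (R γ) x)
    have h5 : 0 ≤ ∑ γ ∈ F.filter (Adj supp α) ∩ F.filter (Adj supp β), ind (R γ) x :=
      Finset.sum_nonneg fun _ _ => ind_nonneg _ _
    linarith
  have hs : ∀ α, FinDep (fun x => ∑ γ ∈ F.filter (Adj supp α), ind (R γ) x) := fun α =>
    FinDep.sum _ fun γ _ => (hR.finDep γ).ind
  have h6 := hη.expct_mono (hR.finDep_pow G t)
    ((hR.finDep_pow F t).comp₂ (· + ·) ((hs α).comp₂ (· + ·) (hs β))) h1
  rw [hη.expct_add (hR.finDep_pow F t) ((hs α).comp₂ (· + ·) (hs β)),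
    hη.expct_add (hs α) (hs β), hη.expct_sum _ fun γ _ => (hR.finDep γ).ind,
    hη.expct_sum _ fun γ _ => (hR.finDep γ).ind] at h6
  simp only [hη.expct_ind (hR.finDep _)] at h6
  linarith [hρ α hα, hρ β hβ]

open Classical in
/-- The size-bias estimate for a single event of the family. -/
lemma IsCoin.abs_expct_ind_pow_sub_le (hη : IsCoin P p η) (hR : IsLocalFamily R supp)
    {F : Finset ι} {ρ : ℝ}
    (hρ : ∀ α ∈ F, ∑ β ∈ F.filter (Adj supp α), prob P η (R β) ≤ ρ) {t : ℝ} (ht0 : 0 ≤ t)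
    (ht1 : t ≤ 1) {α : ι} (hα : α ∈ F) :
    |expct P η (fun x => ind (R α) x * t ^ (occ R F x - 1))
        - prob P η (R α) * expct P η (fun x => t ^ occ R F x)|
      ≤ (∑ β ∈ F.filter (Adj supp α), prob P η (R α) * prob P η (R β)
          + ∑ β ∈ F.filter (fun β => β ≠ α ∧ Adj supp α β), prob P η (fun x => R α x ∧ R β x))
        * (expct P η (fun x => t ^ occ R F x) + 2 * ρ) := by
  set φ := expct P η (fun x => t ^ occ R F x) with hφ
  set G := F.filter fun γ => ¬ Adj supp α γ with hG
  have hGF : G ⊆ F := Finset.filter_subset _ _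
  have hdisj : ∀ β ∈ G, Disjoint (supp α) (supp β) := by
    intro β hβ
    simp only [hG, Finset.mem_filter, Adj, not_or, not_not] at hβ
    exact hβ.2.2
  have hw : 0 ≤ prob P η (R α) := prob_nonneg _
  -- The intermediate value is `prob P η (R α) * y`, with `y` built from the events not adjacent to
  -- `α`. By independence it equals the expectation of `ind (R α) * t ^ occ R G`. Both sides of the
  -- claim are compared with it: one differs by pairs `R α ∧ R β`, the other by products of
  -- probabilities.
  have hpY := hη.expct_ind_mul_pow_occ hR (hR.dependsOn α) hdisj t
  set y := expct P η (fun x => t ^ occ R G x) with hy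
  have hαG : α ∉ G := by simp [hG, Adj]
  have hGe : G ⊆ F.erase α := fun γ hγ => Finset.mem_erase.2
    ⟨fun h => hαG (h ▸ hγ), hGF hγ⟩
  have hφ0 : 0 ≤ φ := expct_nonneg fun x => pow_nonneg ht0 _
  -- the dependence on `α`
  have hupper : ∀ x, ind (R α) x * t ^ (occ R F x - 1) ≤ ind (R α) x * t ^ occ R G x := by
    intro x
    by_cases hx : R α x
    · have := occ_erase_add_one hα hx
      have h2 := occ_mono (R := R) hGe x
      simp only [ind, hx, if_true, one_mul]
      exact pow_le_pow_of_le_one ht0 ht1 (by omega)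
    · simp [ind, hx]
  -- The count in the exponent is reduced to events adjacent to neither `α` nor `β`, which makes the
  -- power independent of `R α ∧ R β`. Its expectation is then at most `φ + 2 * ρ`.
  have hlower : ∀ x, ind (R α) x * t ^ occ R G x ≤ ind (R α) x * t ^ (occ R F x - 1) +
      ∑ β ∈ F.filter (fun β => β ≠ α ∧ Adj supp α β), ind (fun x => R α x ∧ R β x) x *
        t ^ occ R (F.filter fun γ => ¬ Adj supp α γ ∧ ¬ Adj supp β γ) x := by
    intro x
    by_cases hx : R α x
    · have h1 := occ_erase_add_one hα hx
      have h2 := pow_occ_sub_le (R := R) hGe ht0 x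
      have h3 : F.erase α \ G = F.filter (fun β => β ≠ α ∧ Adj supp α β) := by
        ext γ
        simp only [hG, Finset.mem_sdiff, Finset.mem_erase, Finset.mem_filter]
        grind
      rw [h3] at h2
      have h4 : occ R F x - 1 = occ R (F.erase α) x := by omega
      have h5 : ∑ β ∈ F.filter (fun β => β ≠ α ∧ Adj supp α β), ind (R β) x * t ^ occ R G x ≤
          ∑ β ∈ F.filter (fun β => β ≠ α ∧ Adj supp α β), ind (fun x => R α x ∧ R β x) x *
            t ^ occ R (F.filter fun γ => ¬ Adj supp α γ ∧ ¬ Adj supp β γ) x := by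
        refine Finset.sum_le_sum fun β _ => ?_
        simp only [ind, hx, true_and]
        split_ifs
        · rw [one_mul, one_mul]
          refine pow_le_pow_of_le_one ht0 ht1 (occ_mono ?_ x)
          intro γ hγ
          simp only [hG, Finset.mem_filter] at hγ ⊢
          tauto
        · simp
      rw [h4]
      simp only [ind, hx, if_true, one_mul] at *
      linarith
    · simp [ind, hx]
  have hupper2 : ∀ x, t ^ occ R F x ≤ t ^ occ R G x := fun x =>
    pow_le_pow_of_le_one ht0 ht1 (occ_mono hGF x)
  have hlower2 : ∀ x, t ^ occ R G x ≤ t ^ occ R F x +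
      ∑ β ∈ F.filter (Adj supp α), ind (R β) x *
        t ^ occ R (F.filter fun γ => ¬ Adj supp α γ ∧ ¬ Adj supp β γ) x := by
    intro x
    have h2 := pow_occ_sub_le (R := R) hGF ht0 x
    have h3 : F \ G = F.filter (Adj supp α) := by
      ext γ
      simp only [hG, Finset.mem_sdiff, Finset.mem_filter]
      grind
    rw [h3] at h2
    have h5 : ∑ β ∈ F.filter (Adj supp α), ind (R β) x * t ^ occ R G x ≤
        ∑ β ∈ F.filter (Adj supp α), ind (R β) x *
          t ^ occ R (F.filter fun γ => ¬ Adj supp α γ ∧ ¬ Adj supp β γ) x := by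
      refine Finset.sum_le_sum fun β _ => mul_le_mul_of_nonneg_left
        (pow_le_pow_of_le_one ht0 ht1 (occ_mono ?_ x)) (ind_nonneg _ _)
      intro γ hγ
      simp only [hG, Finset.mem_filter] at hγ ⊢
      tauto
    linarith
  have hαβ : ∀ β, DependsOn (fun x => R α x ∧ R β x) ((supp α ∪ supp β : Finset ℕ) : Set ℕ) := by
    intro β
    rw [Finset.coe_union]
    exact DependsOn.comp₂ And (hR.dependsOn α) (hR.dependsOn β)
  have hnon : ∀ β γ, γ ∈ (F.filter fun γ => ¬ Adj supp α γ ∧ ¬ Adj supp β γ) →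
      Disjoint (supp α ∪ supp β) (supp γ) := by
    intro β γ hγ
    simp only [Finset.mem_filter, Adj, not_or, not_not] at hγ
    rw [Finset.disjoint_union_left]
    exact ⟨hγ.2.1.2, hγ.2.2.2⟩
  have hfd1 : FinDep (fun x => ind (R α) x * t ^ (occ R F x - 1)) :=
    (hR.finDep α).ind.comp₂ (· * ·) ((hR.finDep_occ F).comp fun k => t ^ (k - 1))
  have hfd2 : FinDep (fun x => ind (R α) x * t ^ occ R G x) :=
    (hR.finDep α).ind.comp₂ (· * ·) (hR.finDep_pow G t)
  have hfd3 : ∀ β, FinDep (fun x => ind (fun x => R α x ∧ R β x) x *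
        t ^ occ R (F.filter fun γ => ¬ Adj supp α γ ∧ ¬ Adj supp β γ) x) := fun β =>
    FinDep.comp₂ (· * ·) (FinDep.ind ⟨_, hαβ β⟩) (hR.finDep_pow _ t)
  have hfd4 : ∀ β, FinDep (fun x => ind (R β) x *
        t ^ occ R (F.filter fun γ => ¬ Adj supp α γ ∧ ¬ Adj supp β γ) x) := fun β =>
    FinDep.comp₂ (· * ·) (hR.finDep β).ind (hR.finDep_pow _ t)
  have e1 := hη.expct_mono hfd1 hfd2 hupper
  have e2 := hη.expct_mono hfd2 (hfd1.comp₂ (· + ·) (FinDep.sum _ fun β _ => hfd3 β)) hlower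
  rw [hη.expct_add hfd1 (FinDep.sum _ fun β _ => hfd3 β), hη.expct_sum _ fun β _ => hfd3 β] at e2
  have e3 := hη.expct_mono (hR.finDep_pow F t) (hR.finDep_pow G t) hupper2
  have e4 := hη.expct_mono (hR.finDep_pow G t)
    ((hR.finDep_pow F t).comp₂ (· + ·) (FinDep.sum _ fun β _ => hfd4 β)) hlower2
  rw [hη.expct_add (hR.finDep_pow F t) (FinDep.sum _ fun β _ => hfd4 β),
    hη.expct_sum _ fun β _ => hfd4 β] at e4
  have s1 : ∑ β ∈ F.filter (fun β => β ≠ α ∧ Adj supp α β),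
      expct P η (fun x => ind (fun x => R α x ∧ R β x) x *
        t ^ occ R (F.filter fun γ => ¬ Adj supp α γ ∧ ¬ Adj supp β γ) x) ≤
      (∑ β ∈ F.filter (fun β => β ≠ α ∧ Adj supp α β), prob P η (fun x => R α x ∧ R β x))
        * (φ + 2 * ρ) := by
    rw [Finset.sum_mul]
    refine Finset.sum_le_sum fun β hβ => ?_
    rw [hη.expct_ind_mul_pow_occ hR (hαβ β) (hnon β)]
    exact mul_le_mul_of_nonneg_left (hη.expct_pow_occ_nonadj_le hR hρ ht0 ht1 hα
      (Finset.mem_filter.1 hβ).1) (prob_nonneg _)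
  have s2 : ∑ β ∈ F.filter (Adj supp α), expct P η (fun x => ind (R β) x *
        t ^ occ R (F.filter fun γ => ¬ Adj supp α γ ∧ ¬ Adj supp β γ) x) ≤
      (∑ β ∈ F.filter (Adj supp α), prob P η (R β)) * (φ + 2 * ρ) := by
    rw [Finset.sum_mul]
    refine Finset.sum_le_sum fun β hβ => ?_
    rw [hη.expct_ind_mul_pow_occ hR (hR.dependsOn β) (fun γ hγ =>
      (Finset.disjoint_union_left.1 (hnon β γ hγ)).2)]
    exact mul_le_mul_of_nonneg_left (hη.expct_pow_occ_nonadj_le hR hρ ht0 ht1 hα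
      (Finset.mem_filter.1 hβ).1) (prob_nonneg _)
  have hρ0 : 0 ≤ ρ := (Finset.sum_nonneg fun β _ => prob_nonneg _).trans (hρ α hα)
  rw [← Finset.mul_sum, add_mul, mul_assoc]
  have n1 : 0 ≤ (∑ β ∈ F.filter (fun β => β ≠ α ∧ Adj supp α β),
      prob P η (fun x => R α x ∧ R β x)) * (φ + 2 * ρ) :=
    mul_nonneg (Finset.sum_nonneg fun β _ => prob_nonneg _) (by linarith)
  have n2 : 0 ≤ prob P η (R α) *
      ((∑ β ∈ F.filter (Adj supp α), prob P η (R β)) * (φ + 2 * ρ)) :=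
    mul_nonneg hw (mul_nonneg (Finset.sum_nonneg fun β _ => prob_nonneg _) (by linarith))
  have m1 := mul_le_mul_of_nonneg_left e3 hw
  have m2 := mul_le_mul_of_nonneg_left (e4.trans (add_le_add_right s2 _)) hw
  rw [mul_add] at m2
  rw [abs_le]
  constructor <;> linarith

open Classical in
/-- The differential inequality for the generating function of the number of events. -/
lemma IsCoin.abs_deriv_expct_pow_sub_le (hη : IsCoin P p η) (hR : IsLocalFamily R supp)
    {F : Finset ι} {ρ : ℝ}
    (hρ : ∀ α ∈ F, ∑ β ∈ F.filter (fun β => Adj supp α β), prob P η (R β) ≤ ρ) {t : ℝ} (ht0 : 0 ≤ t)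
    (ht1 : t ≤ 1) :
    |expct P η (fun x => (occ R F x : ℝ) * t ^ (occ R F x - 1))
        - (∑ α ∈ F, prob P η (R α)) * expct P η (fun x => t ^ occ R F x)|
      ≤ (depOne P η R supp F F + depTwo P η R supp F F)
        * (expct P η (fun x => t ^ occ R F x) + 2 * ρ) := by
  classical
  have h1 : (fun x => (occ R F x : ℝ) * t ^ (occ R F x - 1)) =
      fun x => ∑ α ∈ F, ind (R α) x * t ^ (occ R F x - 1) := by
    ext x
    rw [occ_eq_sum, Finset.sum_mul]
  rw [h1, hη.expct_sum F fun α _ =>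
    (hR.finDep α).ind.comp₂ (· * ·) ((hR.finDep_occ F).comp fun k => t ^ (k - 1)),
    Finset.sum_mul, ← Finset.sum_sub_distrib, depOne, depTwo, ← Finset.sum_add_distrib,
    Finset.sum_mul]
  exact (Finset.abs_sum_le_sum_abs _ _).trans (Finset.sum_le_sum fun α hα =>
    hη.abs_expct_ind_pow_sub_le hR hρ ht0 ht1 hα)

lemma occ_eq_zero_iff {F : Finset ι} {x : ℕ → Bool} : occ R F x = 0 ↔ ∀ α ∈ F, ¬ R α x := by
  classical
  simp [occ, Finset.filter_eq_empty_iff]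

lemma IsCoin.expct_zero_pow_occ (hη : IsCoin P p η) (hR : IsLocalFamily R supp) (F : Finset ι) :
    expct P η (fun x => (0 : ℝ) ^ occ R F x) = prob P η (fun x => ∀ α ∈ F, ¬ R α x) := by
  classical
  rw [← hη.expct_ind (FinDep.ball F fun α _ => (hR.finDep α).comp Not)]
  congr 1
  ext x
  rw [zero_pow_eq]
  simp only [ind, occ_eq_zero_iff]
  congr

open Classical in
/-- Poisson approximation for the probability that no event of a family occurs, with an absolute
error. -/
theorem IsCoin.abs_prob_none_sub_exp_le (hη : IsCoin P p η) (hR : IsLocalFamily R supp)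
    {F : Finset ι} {ρ b : ℝ} (hρ0 : 0 ≤ ρ)
    (hρ : ∀ α ∈ F, ∑ β ∈ F.filter (fun β => Adj supp α β), prob P η (R β) ≤ ρ)
    (hb : depOne P η R supp F F + depTwo P η R supp F F ≤ b) (hb0 : 0 ≤ b) :
    |prob P η (fun x => ∀ α ∈ F, ¬ R α x) - Real.exp (-∑ α ∈ F, prob P η (R α))|
      ≤ b * (1 + 2 * ρ) := by
  classical
  set lam := ∑ α ∈ F, prob P η (R α) with hlam
  have hlam0 : 0 ≤ lam := Finset.sum_nonneg fun α _ => prob_nonneg _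
  set φ : ℝ → ℝ := fun t => expct P η (fun x => t ^ occ R F x) with hφ
  set φ' : ℝ → ℝ := fun t => expct P η (fun x => (occ R F x : ℝ) * t ^ (occ R F x - 1)) with hφ'
  have hd : ∀ t, HasDerivAt φ (φ' t) t := fun t =>
    hη.hasDerivAt_expct_pow (hR.finDep_occ F) (N := F.card)
      (fun x => Finset.card_le_card (Finset.filter_subset _ _)) t
  -- The integrating factor turns the approximate equation `φ' = λ φ` into a bound on one
  -- derivative. The mean value inequality between 0 and 1 finishes.
  have hd2 : ∀ t, HasDerivAt (fun t => Real.exp (-(lam * t)) * φ t)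
      (Real.exp (-(lam * t)) * (φ' t - lam * φ t)) t := by
    intro t
    have h1 : HasDerivAt (fun t : ℝ => -(lam * t)) (-lam) t := by
      simpa using (hasDerivAt_id t).const_mul (-lam)
    exact (h1.exp.fun_mul (hd t)).congr_deriv (by ring)
  have hφ1 : ∀ t, 0 ≤ t → t ≤ 1 → φ t ≤ 1 := fun t h0 h1 => by
    calc φ t ≤ expct P η (fun _ => (1 : ℝ)) := hη.expct_mono (hR.finDep_pow F t) (FinDep.const 1)
          fun x => pow_le_one₀ h0 h1
      _ = 1 := expct_const 1
  have hφ0 : ∀ t, 0 ≤ t → 0 ≤ φ t := fun t h0 => expct_nonneg fun x => pow_nonneg h0 _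
  have hbound : ∀ t ∈ Set.Icc (0 : ℝ) 1,
      ‖Real.exp (-(lam * t)) * (φ' t - lam * φ t)‖ ≤ b * (1 + 2 * ρ) := by
    intro t ht
    have h1 := hη.abs_deriv_expct_pow_sub_le hR hρ ht.1 ht.2
    have h2 : Real.exp (-(lam * t)) ≤ 1 := Real.exp_le_one_iff.2 (by nlinarith [ht.1])
    rw [norm_mul, Real.norm_eq_abs, Real.norm_eq_abs, abs_of_pos (Real.exp_pos _)]
    have h3 : |φ' t - lam * φ t| ≤ b * (1 + 2 * ρ) := by
      refine h1.trans (mul_le_mul hb ?_ ?_ hb0)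
      · linarith [hφ1 t ht.1 ht.2]
      · linarith [hφ0 t ht.1]
    exact (mul_le_of_le_one_left (abs_nonneg _) h2).trans h3
  have key := (convex_Icc (0 : ℝ) 1).norm_image_sub_le_of_norm_hasDerivWithin_le
    (fun t _ => (hd2 t).hasDerivWithinAt) hbound (Set.right_mem_Icc.2 zero_le_one)
    (Set.left_mem_Icc.2 zero_le_one)
  -- The convention `0 ^ 0 = 1` makes `φ 0` the probability that nothing occurs.
  have e0 : φ 0 = prob P η (fun x => ∀ α ∈ F, ¬ R α x) := hη.expct_zero_pow_occ hR F
  have e1 : φ 1 = 1 := by simp [hφ, expct_const]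
  simpa [e0, e1] using key

open Classical in
/-- Poisson upper bound for the probability that no event of a family occurs, with an error of
second order. -/
theorem IsCoin.prob_none_le (hη : IsCoin P p η) (hR : IsLocalFamily R supp)
    {F : Finset ι} {ρ b : ℝ} (hρ0 : 0 ≤ ρ)
    (hρ : ∀ α ∈ F, ∑ β ∈ F.filter (fun β => Adj supp α β), prob P η (R β) ≤ ρ)
    (hb : depOne P η R supp F F + depTwo P η R supp F F ≤ b) (hb0 : 0 ≤ b) :
    prob P η (fun x => ∀ α ∈ F, ¬ R α x)
      ≤ Real.exp (b - ∑ α ∈ F, prob P η (R α)) + 2 * b * ρ := by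
  classical
  set lam := ∑ α ∈ F, prob P η (R α) with hlam
  rcases le_or_gt lam b with hlb | hlb
  · have h1 : 1 ≤ Real.exp (b - lam) := Real.one_le_exp (by linarith)
    have h2 : 0 ≤ 2 * b * ρ := by positivity
    linarith [prob_le_one (P := P) (η := η) (fun x => ∀ α ∈ F, ¬ R α x)]
  set φ : ℝ → ℝ := fun t => expct P η (fun x => t ^ occ R F x) with hφ
  set φ' : ℝ → ℝ := fun t => expct P η (fun x => (occ R F x : ℝ) * t ^ (occ R F x - 1)) with hφ'
  have hd : ∀ t, HasDerivAt φ (φ' t) t := fun t =>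
    hη.hasDerivAt_expct_pow (hR.finDep_occ F) (N := F.card)
      (fun x => Finset.card_le_card (Finset.filter_subset _ _)) t
  -- The differential inequality gives `φ' ≥ (λ - b) φ - 2 b ρ`, so the part of the error
  -- proportional to `φ` only lowers the rate. Since `κ > 0` here, the integrating factor stays at
  -- most 1 and the remaining loss is `2 b ρ`.
  set κ := lam - b with hκ
  have hd2 : ∀ t, HasDerivAt (fun t => Real.exp (-(κ * t)) * φ t + 2 * b * ρ * t)
      (Real.exp (-(κ * t)) * (φ' t - κ * φ t) + 2 * b * ρ) t := by
    intro t
    have h1 : HasDerivAt (fun t : ℝ => -(κ * t)) (-κ) t := by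
      simpa using (hasDerivAt_id t).const_mul (-κ)
    have h2 : HasDerivAt (fun t : ℝ => 2 * b * ρ * t) (2 * b * ρ) t := by
      simpa using (hasDerivAt_id t).const_mul (2 * b * ρ)
    exact ((h1.exp.fun_mul (hd t)).fun_add h2).congr_deriv (by ring)
  have hφ0 : ∀ t, 0 ≤ t → 0 ≤ φ t := fun t h0 => expct_nonneg fun x => pow_nonneg h0 _
  have hmono : MonotoneOn (fun t => Real.exp (-(κ * t)) * φ t + 2 * b * ρ * t)
      (Set.Icc (0 : ℝ) 1) := by
    refine monotoneOn_of_deriv_nonneg (convex_Icc 0 1)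
      (fun t _ => (hd2 t).continuousAt.continuousWithinAt)
      (fun t _ => (hd2 t).differentiableAt.differentiableWithinAt) fun t ht => ?_
    rw [(hd2 t).deriv]
    rw [interior_Icc] at ht
    have h1 := (abs_le.1 (hη.abs_deriv_expct_pow_sub_le hR hρ ht.1.le ht.2.le)).1
    change _ ≤ φ' t - lam * φ t at h1
    have h2 : Real.exp (-(κ * t)) ≤ 1 := Real.exp_le_one_iff.2 (by nlinarith [ht.1])
    have h3 : -(2 * b * ρ) ≤ φ' t - κ * φ t := by
      have h4 := mul_le_mul_of_nonneg_right hb (by linarith [hφ0 t ht.1.le] : 0 ≤ φ t + 2 * ρ)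
      change (_ : ℝ) * (φ t + 2 * ρ) ≤ _ at h4
      rw [hκ, sub_mul]
      linarith
    have h5 : 0 ≤ 2 * b * ρ := by positivity
    have h6 := mul_le_mul_of_nonneg_left h3 (Real.exp_pos (-(κ * t))).le
    nlinarith
  have key := hmono (Set.left_mem_Icc.2 zero_le_one) (Set.right_mem_Icc.2 zero_le_one) zero_le_one
  have e0 : φ 0 = prob P η (fun x => ∀ α ∈ F, ¬ R α x) := hη.expct_zero_pow_occ hR F
  have e1 : φ 1 = 1 := by simp [hφ, expct_const]
  have e2 : -κ = b - lam := by rw [hκ]; ring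
  simpa [e0, e1, e2] using key

end Poisson

/-! ### Counting solutions of congruences; consecutive elements of dense sets -/

section Counting

/-- A linear congruence mod `m` with leading coefficient `u` has at most `|u|` solutions in each
period. -/
lemma card_filter_dvd_mul_sub_le {m K q : ℕ} (hm : 0 < m) (hK : K ≤ q * m) {u : ℤ} (hu : u ≠ 0)
    (c : ℤ) : ((Finset.range K).filter fun t : ℕ => (m : ℤ) ∣ u * t - c).card ≤ u.natAbs * q := by
  have key : ∀ (u : ℕ) (c : ℤ), 0 < u →
      ((Finset.range K).filter fun t : ℕ => (m : ℤ) ∣ (u : ℤ) * t - c).card ≤ u * q := by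
    intro u c hu
    -- Multiplication by `u` injects the solutions into the residue class of `c` within `[0, u q
    -- m)`, which has exactly `u q` members.
    have h1 := Int.Ico_filter_modEq_card 0 ((u * q * m : ℕ) : ℤ) (r := (m : ℤ)) (by exact_mod_cast hm) c
    have h2 : ((Finset.Ico 0 ((u * q * m : ℕ) : ℤ)).filter (· ≡ c [ZMOD (m : ℤ)])).card = u * q := by
      have hm' : ((m : ℤ) : ℚ) ≠ 0 := by exact_mod_cast hm.ne'
      have h3 : ((((u * q * m : ℕ) : ℤ) : ℚ) - c) / ((m : ℤ) : ℚ)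
          = (((0 : ℤ) : ℚ) - c) / ((m : ℤ) : ℚ) + ((u * q : ℕ) : ℤ) := by
        field_simp
        push_cast
        ring
      rw [h3, Int.ceil_add_intCast] at h1
      have h4 : (0 : ℤ) ≤ ((u * q : ℕ) : ℤ) := by positivity
      rw [add_sub_cancel_left, max_eq_left h4] at h1
      exact_mod_cast h1
    rw [← h2]
    refine Finset.card_le_card_of_injOn (fun t : ℕ => (u : ℤ) * t) ?_ ?_
    · intro t ht
      simp only [Finset.coe_filter, Finset.mem_range, Set.mem_ofPred_eq, Finset.mem_Ico] at ht ⊢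
      refine ⟨⟨by positivity, ?_⟩, (Int.modEq_iff_dvd.2 ht.2).symm⟩
      have : u * t < u * q * m := by
        rw [mul_assoc]
        exact Nat.mul_lt_mul_of_pos_left (by omega) hu
      exact_mod_cast this
    · intro t _ t' _ h
      simpa [hu.ne'] using h
  rcases Int.natAbs_eq u with h | h
  · have := key u.natAbs c (Int.natAbs_pos.2 hu)
    rwa [← h] at this
  · refine le_trans (Finset.card_le_card ?_) (key u.natAbs (-c) (Int.natAbs_pos.2 hu))
    intro t ht
    simp only [Finset.mem_filter] at ht ⊢
    refine ⟨ht.1, ?_⟩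
    have h2 : (u.natAbs : ℤ) * t - -c = -(u * t - c) := by
      have : (u.natAbs : ℤ) = -u := by omega
      rw [this]; ring
    rw [h2]
    exact (dvd_neg).2 ht.2

/-- Otherwise `I` and its translate by 1 would be disjoint subsets of `{1, …, r + 1}`. -/
lemma exists_mem_and_succ_mem {r : ℕ} {I : Finset ℕ} (hI : I ⊆ Finset.Icc 1 r)
    (hcard : r + 1 < 2 * I.card) : ∃ i ∈ I, i + 1 ∈ I := by
  by_contra! hne
  have hdisj : Disjoint I (I.map (addRightEmbedding 1)) := by
    rw [Finset.disjoint_left]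
    intro i hi h
    obtain ⟨j, hj, rfl⟩ := Finset.mem_map.1 h
    exact hne j hj hi
  have hsub : I ∪ I.map (addRightEmbedding 1) ⊆ Finset.Icc 1 (r + 1) := by
    intro i hi
    rcases Finset.mem_union.1 hi with h | h
    · have := Finset.mem_Icc.1 (hI h)
      exact Finset.mem_Icc.2 ⟨this.1, by omega⟩
    · obtain ⟨j, hj, rfl⟩ := Finset.mem_map.1 h
      have := Finset.mem_Icc.1 (hI hj)
      simp only [addRightEmbedding_apply, Finset.mem_Icc]
      omega
  have := Finset.card_le_card hsub
  rw [Finset.card_union_of_disjoint hdisj, Finset.card_map, Nat.card_Icc] at this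
  omega

end Counting

/-! ### Patterns along progressions and their dependence terms -/

section Pattern

/-- The `j`-th term of the arithmetic progression `(n, a, s)`: it starts at `a`, has step `s`, and is
taken modulo `n`. -/
def pos (α : ℕ × ℕ × ℕ) (j : ℕ) : ℕ := (α.2.1 + j * α.2.2) % α.1

/-- The terms number `1, …, r` of a progression. -/
def ones (r : ℕ) (α : ℕ × ℕ × ℕ) : Finset ℕ := (Finset.Icc 1 r).image (pos α)

/-- The terms number `0, …, r` of a progression. -/
def patSupp (r : ℕ) (α : ℕ × ℕ × ℕ) : Finset ℕ := (Finset.range (r + 1)).image (pos α)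

/-- The bit at the start of the progression is `false`, and the next `r` bits are `true`. -/
def Pat (r : ℕ) (α : ℕ × ℕ × ℕ) (x : ℕ → Bool) : Prop :=
  x (pos α 0) = false ∧ ∀ i ∈ ones r α, x i = true

/-- The progressions mod `n` with `r + 1` distinct terms, one from each pair of opposite steps. -/
def fam (n r : ℕ) : Finset (ℕ × ℕ × ℕ) :=
  ({n} ×ˢ Finset.range n ×ˢ Finset.range n).filter fun α =>
    2 * α.2.2 < n ∧ ∀ k ∈ Finset.Icc 1 r, ¬ n ∣ k * α.2.2

variable {n m r : ℕ} {α β : ℕ × ℕ × ℕ}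

lemma mem_fam {a s : ℕ} : (m, a, s) ∈ fam n r ↔
    m = n ∧ a < n ∧ s < n ∧ 2 * s < n ∧ ∀ k, 1 ≤ k → k ≤ r → ¬ n ∣ k * s := by
  simp only [fam, Finset.mem_filter, Finset.mem_product, Finset.mem_singleton, Finset.mem_range,
    Finset.mem_Icc, and_imp, and_assoc]

lemma fst_of_mem_fam (hα : α ∈ fam n r) : α.1 = n := by
  obtain ⟨m, a, s⟩ := α
  exact (mem_fam.1 hα).1

lemma pos_modEq (α : ℕ × ℕ × ℕ) (j : ℕ) : pos α j ≡ α.2.1 + j * α.2.2 [MOD α.1] :=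
  Nat.mod_modEq _ _

lemma pos_dvd (α : ℕ × ℕ × ℕ) (j : ℕ) :
    (α.1 : ℤ) ∣ ((α.2.1 : ℤ) + j * α.2.2) - pos α j := by
  have := Nat.modEq_iff_dvd.1 (pos_modEq α j)
  push_cast at this
  exact this

lemma pos_lt (hα : 0 < α.1) (j : ℕ) : pos α j < α.1 := Nat.mod_lt _ hα

lemma pos_inj_of_mem_fam (hα : α ∈ fam n r) {i j : ℕ} (hi : i ≤ r) (hj : j ≤ r)
    (h : pos α i = pos α j) : i = j := by
  obtain ⟨m, a, s⟩ := α
  obtain ⟨rfl, ha, hs, h2s, hk⟩ := mem_fam.1 hα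
  wlog hij : i ≤ j generalizing i j
  · exact (this hj hi h.symm (by omega)).symm
  by_contra hne
  have h1 : a + i * s ≡ a + j * s [MOD m] := h
  have h2 := (Nat.ModEq.add_left_cancel' a h1)
  have h3 := (Nat.modEq_iff_dvd' (Nat.mul_le_mul_right s hij)).1 h2
  rw [← Nat.sub_mul] at h3
  exact hk (j - i) (by omega) (by omega) h3

lemma card_ones_of_mem_fam (hα : α ∈ fam n r) : (ones r α).card = r := by
  rw [ones, Finset.card_image_of_injOn, Nat.card_Icc, Nat.add_sub_cancel]
  intro i hi j hj h
  simp only [Finset.coe_Icc, Set.mem_Icc] at hi hj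
  exact pos_inj_of_mem_fam hα hi.2 hj.2 h

lemma pos_zero_notMem_ones (hα : α ∈ fam n r) : pos α 0 ∉ ones r α := by
  intro h
  obtain ⟨j, hj, h⟩ := Finset.mem_image.1 h
  have hj := Finset.mem_Icc.1 hj
  have := pos_inj_of_mem_fam hα hj.2 (Nat.zero_le r) h
  omega

lemma ones_subset_patSupp (r : ℕ) (α : ℕ × ℕ × ℕ) : ones r α ⊆ patSupp r α := by
  refine Finset.image_subset_image fun j hj => ?_
  have hj := Finset.mem_Icc.1 hj
  exact Finset.mem_range.2 (by omega)

lemma card_patSupp_le (r : ℕ) (α : ℕ × ℕ × ℕ) : (patSupp r α).card ≤ r + 1 :=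
  Finset.card_image_le.trans (by simp)

lemma isLocalFamily_pat (r : ℕ) : IsLocalFamily (Pat r) (patSupp r) := by
  refine ⟨fun α x y hxy => ?_⟩
  have h0 : pos α 0 ∈ patSupp r α := Finset.mem_image_of_mem _ (by simp)
  simp only [Pat, hxy _ (Finset.mem_coe.2 h0)]
  congr 1
  refine propext (forall₂_congr fun i hi => ?_)
  rw [hxy i (Finset.mem_coe.2 (ones_subset_patSupp r α hi))]

lemma pair_ext_of_pos_eq {a b s j : ℕ} (ha : a < n) (hb : b < n)
    (h : pos (n, a, s) j = pos (n, b, s) j) : a = b :=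
  Nat.ModEq.eq_of_lt_of_lt (Nat.ModEq.add_right_cancel' (j * s) h) ha hb

lemma fam_eq_of_pos_eq (hα : α ∈ fam n r) (hβ : β ∈ fam n r) {j : ℕ} (hs : α.2.2 = β.2.2)
    (h : pos α j = pos β j) : α = β := by
  obtain ⟨m, a, s⟩ := α
  obtain ⟨m', b, t⟩ := β
  obtain ⟨rfl, ha, -⟩ := mem_fam.1 hα
  obtain ⟨rfl, hb, -⟩ := mem_fam.1 hβ
  obtain rfl : s = t := hs
  rw [pair_ext_of_pos_eq ha hb h]

/-- The number of progressions that meet a given set. -/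
lemma card_filter_touch_le (n r : ℕ) (A : Finset ℕ) :
    ((fam n r).filter fun β => ¬ Disjoint A (patSupp r β)).card ≤ (r + 1) * A.card * n := by
  classical
  have hsub : ((fam n r).filter fun β => ¬ Disjoint A (patSupp r β)) ⊆
      (Finset.range (r + 1) ×ˢ A).biUnion fun jy => (fam n r).filter fun β => pos β jy.1 = jy.2 := by
    intro β hβ
    obtain ⟨hβ, hd⟩ := Finset.mem_filter.1 hβ
    obtain ⟨y, hyA, hy⟩ := Finset.not_disjoint_iff.1 hd
    obtain ⟨j, hj, rfl⟩ := Finset.mem_image.1 hy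
    exact Finset.mem_biUnion.2 ⟨(j, pos β j), Finset.mem_product.2 ⟨hj, hyA⟩,
      Finset.mem_filter.2 ⟨hβ, rfl⟩⟩
  refine (Finset.card_le_card hsub).trans ((Finset.card_biUnion_le_card_mul _ _ n ?_).trans ?_)
  · rintro ⟨j, y⟩ -
    rw [← Finset.card_range n]
    refine Finset.card_le_card_of_injOn (fun β => β.2.2) ?_ ?_
    · rintro ⟨m, b, t⟩ hβ
      simp only [Finset.coe_filter, Set.mem_ofPred_eq] at hβ
      simpa using (mem_fam.1 hβ.1).2.2.1
    · intro β hβ β' hβ' h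
      simp only [Finset.coe_filter, Set.mem_ofPred_eq] at hβ hβ'
      exact fam_eq_of_pos_eq hβ.1 hβ'.1 h (hβ.2.trans hβ'.2.symm)
  · simp

/-- The number of progressions that meet a given set in two places. -/
lemma card_filter_two_le (hn : 0 < n) (r : ℕ) (A : Finset ℕ) :
    ((fam n r).filter fun β => 2 ≤ (A ∩ ones r β).card).card ≤ r ^ 3 * A.card ^ 2 := by
  classical
  set S : (ℕ × ℕ) × ℕ × ℕ → Finset (ℕ × ℕ × ℕ) := fun q => (fam n r).filter fun β =>
    pos β q.1.1 = q.2.1 ∧ pos β q.1.2 = q.2.2 with hS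
  have hsub : ((fam n r).filter fun β => 2 ≤ (A ∩ ones r β).card) ⊆
      (((Finset.Icc 1 r ×ˢ Finset.Icc 1 r).filter fun q => q.1 ≠ q.2) ×ˢ A ×ˢ A).biUnion S := by
    intro β hβ
    obtain ⟨hβ, hd⟩ := Finset.mem_filter.1 hβ
    obtain ⟨y, hy, z, hz, hyz⟩ := Finset.one_lt_card.1 hd
    obtain ⟨hyA, hy⟩ := Finset.mem_inter.1 hy
    obtain ⟨hzA, hz⟩ := Finset.mem_inter.1 hz
    obtain ⟨j, hj, rfl⟩ := Finset.mem_image.1 hy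
    obtain ⟨k, hk, rfl⟩ := Finset.mem_image.1 hz
    refine Finset.mem_biUnion.2 ⟨((j, k), pos β j, pos β k), ?_, Finset.mem_filter.2 ⟨hβ, rfl, rfl⟩⟩
    simp only [Finset.mem_product, Finset.mem_filter]
    exact ⟨⟨⟨hj, hk⟩, fun h => hyz (by rw [show j = k from h])⟩, hyA, hzA⟩
  refine (Finset.card_le_card hsub).trans ((Finset.card_biUnion_le_card_mul _ _ r ?_).trans ?_)
  · rintro ⟨⟨j, k⟩, y, z⟩ hq
    simp only [Finset.mem_product, Finset.mem_filter, Finset.mem_Icc] at hq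
    obtain ⟨⟨⟨hj, hk⟩, hjk⟩, -⟩ := hq
    have hu : ((k : ℤ) - j) ≠ 0 := by
      intro h; exact hjk (show j = k by omega)
    -- Prescribing the terms number `j` and `k` fixes `(k - j)` times the step mod `n`. This leaves
    -- at most `|k - j|` steps, and each step determines the starting point.
    have hc := card_filter_dvd_mul_sub_le (K := n) (q := 1) hn (by simp) hu ((z : ℤ) - y)
    refine le_trans ?_ (hc.trans (by omega))
    refine Finset.card_le_card_of_injOn (fun β => β.2.2) ?_ ?_
    · rintro ⟨m, b, t⟩ hβ
      simp only [hS, Finset.coe_filter, Set.mem_ofPred_eq] at hβ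
      obtain ⟨hβ, rfl, rfl⟩ := hβ
      obtain ⟨rfl, hb, ht, -⟩ := mem_fam.1 hβ
      simp only [Finset.coe_filter, Set.mem_ofPred_eq, Finset.mem_range]
      refine ⟨ht, ?_⟩
      have h1 : (m : ℤ) ∣ ((b : ℤ) + j * t) - pos (m, b, t) j := pos_dvd (m, b, t) j
      have h2 : (m : ℤ) ∣ ((b : ℤ) + k * t) - pos (m, b, t) k := pos_dvd (m, b, t) k
      have h3 : ((k : ℤ) - j) * t - ((pos (m, b, t) k : ℤ) - pos (m, b, t) j)
          = ((b : ℤ) + k * t) - pos (m, b, t) k - (((b : ℤ) + j * t) - pos (m, b, t) j) := by ring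
      rw [h3]
      exact dvd_sub h2 h1
    · intro β hβ β' hβ' h
      simp only [hS, Finset.coe_filter, Set.mem_ofPred_eq] at hβ hβ'
      exact fam_eq_of_pos_eq hβ.1 hβ'.1 h (hβ.2.1.trans hβ'.2.1.symm)
  · rw [Finset.card_product, Finset.card_product]
    have : ((Finset.Icc 1 r ×ˢ Finset.Icc 1 r).filter fun q => q.1 ≠ q.2).card ≤ r * r := by
      refine (Finset.card_filter_le _ _).trans (by simp)
    calc _ ≤ (r * r) * (A.card * A.card) * r := by gcongr
      _ = r ^ 3 * A.card ^ 2 := by ring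

lemma card_fam_le (n r : ℕ) : (fam n r).card ≤ n ^ 2 := by
  refine (Finset.card_filter_le _ _).trans ?_
  simp [sq]

/-- The indices of the terms of `α` that are also terms of `β`. -/
def commonIdx (r : ℕ) (α β : ℕ × ℕ × ℕ) : Finset ℕ :=
  (Finset.Icc 1 r).filter fun i => pos α i ∈ ones r β

lemma card_inter_ones_le (r : ℕ) (α β : ℕ × ℕ × ℕ) :
    (ones r α ∩ ones r β).card ≤ (commonIdx r α β).card := by
  refine (Finset.card_le_card (t := (commonIdx r α β).image (pos α)) ?_).trans
    Finset.card_image_le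
  intro y hy
  obtain ⟨h1, h2⟩ := Finset.mem_inter.1 hy
  obtain ⟨i, hi, rfl⟩ := Finset.mem_image.1 h1
  exact Finset.mem_image_of_mem _ (Finset.mem_filter.2 ⟨hi, h2⟩)

variable {Ω : Type*} [MeasurableSpace Ω] {P : Measure Ω} [IsProbabilityMeasure P] {p : ℝ}
  {η : ℕ → Ω → Bool}

lemma IsCoin.nonneg (hη : IsCoin P p η) : 0 ≤ p := hη.prob_true 0 ▸ measureReal_nonneg

lemma IsCoin.le_one (hη : IsCoin P p η) : p ≤ 1 := hη.prob_true 0 ▸ measureReal_le_one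

lemma IsCoin.prob_pat (hη : IsCoin P p η) (hα : α ∈ fam n r) :
    prob P η (Pat r α) = (1 - p) * p ^ r := by
  have := hη.prob_false_forall_true (ones r α) (pos_zero_notMem_ones hα)
  rwa [card_ones_of_mem_fam hα] at this

lemma IsCoin.prob_pat_le (hη : IsCoin P p η) (hα : α ∈ fam n r) :
    prob P η (Pat r α) ≤ p ^ r := by
  rw [hη.prob_pat hα]
  have := pow_nonneg hη.nonneg r
  nlinarith [hη.nonneg]

/-- The `false` bits are dropped, and only the union of the two sets of `true` bits counts. -/
lemma IsCoin.prob_pat_and_le (hη : IsCoin P p η) (hα : α ∈ fam n r) (hβ : β ∈ fam m r) :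
    prob P η (fun x => Pat r α x ∧ Pat r β x) ≤ p ^ (2 * r - (ones r α ∩ ones r β).card) := by
  classical
  have h1 := Finset.card_union_add_card_inter (ones r α) (ones r β)
  rw [card_ones_of_mem_fam hα, card_ones_of_mem_fam hβ] at h1
  have h2 : 2 * r - (ones r α ∩ ones r β).card = (ones r α ∪ ones r β).card := by omega
  rw [h2, ← hη.prob_forall_true]
  refine prob_mono fun x hx i hi => ?_
  rcases Finset.mem_union.1 hi with h | h
  · exact hx.1.2 i h
  · exact hx.2.2 i h

lemma adj_patSupp_iff :
    Adj (patSupp r) α β ↔ ¬ Disjoint (patSupp r α) (patSupp r β) := by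
  refine ⟨?_, Or.inr⟩
  rintro (rfl | h)
  · rw [disjoint_self]
    exact Finset.Nonempty.ne_empty ⟨pos α 0, Finset.mem_image_of_mem _ (by simp)⟩
  · exact h

open Classical in
lemma card_filter_adj_le {G : Finset (ℕ × ℕ × ℕ)}
    (hG : G ⊆ fam m r) : (G.filter (Adj (patSupp r) α)).card ≤ (r + 1) ^ 2 * m := by
  calc _ ≤ ((fam m r).filter fun β => ¬ Disjoint (patSupp r α) (patSupp r β)).card := by
        refine Finset.card_le_card fun β hβ => ?_
        obtain ⟨h1, h2⟩ := Finset.mem_filter.1 hβ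
        exact Finset.mem_filter.2 ⟨hG h1, adj_patSupp_iff.1 h2⟩
    _ ≤ (r + 1) * (patSupp r α).card * m := card_filter_touch_le m r _
    _ ≤ (r + 1) * (r + 1) * m := by gcongr; exact card_patSupp_le r α
    _ = _ := by ring

open Classical in
lemma IsCoin.sum_adj_prob_le (hη : IsCoin P p η) {G : Finset (ℕ × ℕ × ℕ)} (hG : G ⊆ fam m r) :
    ∑ β ∈ G.filter (fun β => Adj (patSupp r) α β), prob P η (Pat r β)
      ≤ (r + 1) ^ 2 * m * p ^ r := by
  calc _ ≤ ∑ β ∈ G.filter (fun β => Adj (patSupp r) α β), p ^ r :=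
        Finset.sum_le_sum fun β hβ => hη.prob_pat_le (hG (Finset.mem_filter.1 hβ).1)
    _ = ((G.filter (Adj (patSupp r) α)).card : ℝ) * p ^ r := by
        rw [Finset.sum_const, nsmul_eq_mul]
    _ ≤ (((r + 1) ^ 2 * m : ℕ) : ℝ) * p ^ r := by
        refine mul_le_mul_of_nonneg_right ?_ (pow_nonneg hη.nonneg r)
        exact_mod_cast card_filter_adj_le hG
    _ = _ := by push_cast; ring

lemma IsCoin.depOne_le (hη : IsCoin P p η) {F G : Finset (ℕ × ℕ × ℕ)}
    (hF : F ⊆ fam n r) (hG : G ⊆ fam m r) :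
    depOne P η (Pat r) (patSupp r) F G ≤ (n : ℝ) ^ 2 * m * (r + 1) ^ 2 * p ^ (2 * r) := by
  classical
  have hp := pow_nonneg hη.nonneg r
  unfold depOne
  calc _ ≤ ∑ α ∈ F, p ^ r * ((r + 1) ^ 2 * m * p ^ r) := by
        refine Finset.sum_le_sum fun α hα => ?_
        rw [← Finset.mul_sum]
        exact mul_le_mul (hη.prob_pat_le (hF hα)) (hη.sum_adj_prob_le hG)
          (Finset.sum_nonneg fun β _ => prob_nonneg _) hp
    _ = (F.card : ℝ) * (p ^ r * ((r + 1) ^ 2 * m * p ^ r)) := by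
        rw [Finset.sum_const, nsmul_eq_mul]
    _ ≤ (n : ℝ) ^ 2 * (p ^ r * ((r + 1) ^ 2 * m * p ^ r)) := by
        refine mul_le_mul_of_nonneg_right ?_ (by positivity)
        exact_mod_cast (Finset.card_le_card hF).trans (card_fam_le n r)
    _ = _ := by rw [two_mul, pow_add]; ring

/-- The second-order dependence term: pairs of progressions with few common terms are counted, the
remaining pairs are assumed to lie in `T`. -/
lemma IsCoin.depTwo_le (hη : IsCoin P p η) (hm : 0 < m) {F G : Finset (ℕ × ℕ × ℕ)}
    (hF : F ⊆ fam n r) (hG : G ⊆ fam m r) (T : Finset ((ℕ × ℕ × ℕ) × ℕ × ℕ × ℕ))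
    (hT : ∀ α ∈ F, ∀ β ∈ G, β ≠ α → r + 1 < 2 * (ones r α ∩ ones r β).card →
      (∃ x, Pat r α x ∧ Pat r β x) → (α, β) ∈ T) :
    depTwo P η (Pat r) (patSupp r) F G ≤ (n : ℝ) ^ 2 * m * (r + 1) ^ 2 * p ^ (2 * r - 1)
      + (n : ℝ) ^ 2 * r ^ 5 * √p ^ (3 * r - 1) + T.card * p ^ r := by
  classical
  have hp0 := hη.nonneg
  have hp1 := hη.le_one
  have hs0 : 0 ≤ √p := Real.sqrt_nonneg p
  have hs1 : √p ≤ 1 := Real.sqrt_le_one.2 hp1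
  have hsq : √p ^ 2 = p := Real.sq_sqrt hp0
  set A : ℕ × ℕ × ℕ → Finset (ℕ × ℕ × ℕ) := fun α => G.filter (Adj (patSupp r) α) with hA
  set B : ℕ × ℕ × ℕ → Finset (ℕ × ℕ × ℕ) := fun α =>
    G.filter fun β => 2 ≤ (ones r α ∩ ones r β).card with hB
  have hFc : (F.card : ℝ) ≤ (n : ℝ) ^ 2 := by
    exact_mod_cast (Finset.card_le_card hF).trans (card_fam_le n r)
  have hpt : ∀ α ∈ F, ∀ β ∈ G, β ≠ α → Adj (patSupp r) α β →
      prob P η (fun x => Pat r α x ∧ Pat r β x) ≤ (if β ∈ A α then p ^ (2 * r - 1) else 0)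
        + (if β ∈ B α then √p ^ (3 * r - 1) else 0) + (if (α, β) ∈ T then p ^ r else 0) := by
    intro α hα β hβ hne hadj
    have h1 := hη.prob_pat_and_le (hF hα) (hG hβ)
    have hk : (ones r α ∩ ones r β).card ≤ r :=
      (Finset.card_le_card Finset.inter_subset_left).trans (card_ones_of_mem_fam (hF hα)).le
    have e1 : 0 ≤ (if β ∈ A α then p ^ (2 * r - 1) else 0) := by positivity
    have e2 : 0 ≤ (if β ∈ B α then √p ^ (3 * r - 1) else 0) := by positivity
    have e3 : 0 ≤ (if (α, β) ∈ T then p ^ r else 0) := by positivity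
    -- There are three ranges of the overlap. At most one common term is the generic case of
    -- touching progressions. From two to half of the terms, there are only `r ^ 5` partners `β` for
    -- each `α`, and the probability is at most `p ^ (2 r - (r + 1) / 2)`, written with `√p` to
    -- avoid the parity of `r`. Above half, the pair lies in `T` and costs `p ^ r`.
    rcases Nat.lt_or_ge (ones r α ∩ ones r β).card 2 with h2 | h2
    · have hmem : β ∈ A α := Finset.mem_filter.2 ⟨hβ, hadj⟩
      rw [if_pos hmem] at e1 ⊢
      have : p ^ (2 * r - (ones r α ∩ ones r β).card) ≤ p ^ (2 * r - 1) :=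
        pow_le_pow_of_le_one hp0 hp1 (by omega)
      linarith
    · rcases Nat.lt_or_ge (r + 1) (2 * (ones r α ∩ ones r β).card) with h3 | h3
      · by_cases hex : ∃ x, Pat r α x ∧ Pat r β x
        · rw [if_pos (hT α hα β hβ hne h3 hex)] at e3 ⊢
          have : p ^ (2 * r - (ones r α ∩ ones r β).card) ≤ p ^ r :=
            pow_le_pow_of_le_one hp0 hp1 (by omega)
          linarith
        · have : prob P η (fun x => Pat r α x ∧ Pat r β x) = 0 := by
            have hempty : {ω | Pat r α (bits η ω) ∧ Pat r β (bits η ω)} = (∅ : Set Ω) :=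
              Set.eq_empty_of_forall_notMem fun ω hω => hex ⟨_, hω⟩
            rw [prob, hempty, measureReal_empty]
          linarith
      · have hmem : β ∈ B α := Finset.mem_filter.2 ⟨hβ, h2⟩
        rw [if_pos hmem] at e2 ⊢
        have : p ^ (2 * r - (ones r α ∩ ones r β).card) ≤ √p ^ (3 * r - 1) := by
          conv_lhs => rw [← hsq, ← pow_mul]
          exact pow_le_pow_of_le_one hs0 hs1 (by omega)
        linarith
  have hA' : ∀ α ∈ F, ((A α).card : ℝ) ≤ (r + 1) ^ 2 * m := fun α hα => by
    exact_mod_cast card_filter_adj_le hG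
  have hB' : ∀ α ∈ F, ((B α).card : ℝ) ≤ r ^ 5 := fun α hα => by
    have h1 : (B α).card ≤ r ^ 3 * r ^ 2 := by
      have := card_filter_two_le hm r (ones r α)
      rw [card_ones_of_mem_fam (hF hα)] at this
      refine (Finset.card_le_card ?_).trans this
      exact Finset.filter_subset_filter _ hG
    rw [← pow_add] at h1
    exact_mod_cast h1
  have hAG : ∀ α, A α ⊆ G := fun α => Finset.filter_subset _ _
  have hBG : ∀ α, B α ⊆ G := fun α => Finset.filter_subset _ _
  have hs3 : 0 ≤ √p ^ (3 * r - 1) := by positivity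
  unfold depTwo
  calc _ ≤ ∑ α ∈ F, ∑ β ∈ G, ((if β ∈ A α then p ^ (2 * r - 1) else 0)
        + (if β ∈ B α then √p ^ (3 * r - 1) else 0) + (if (α, β) ∈ T then p ^ r else 0)) := by
        refine Finset.sum_le_sum fun α hα => ?_
        rw [Finset.sum_filter]
        refine Finset.sum_le_sum fun β hβ => ?_
        by_cases h : β ≠ α ∧ Adj (patSupp r) α β
        · rw [if_pos h]
          exact hpt α hα β hβ h.1 h.2
        · rw [if_neg h]
          positivity
    _ = ∑ α ∈ F, ((A α).card * p ^ (2 * r - 1) + (B α).card * √p ^ (3 * r - 1))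
        + ((F ×ˢ G).filter (· ∈ T)).card * p ^ r := by
        simp only [Finset.sum_add_distrib]
        congr 1
        · congr 1
          · refine Finset.sum_congr rfl fun α _ => ?_
            rw [← Finset.sum_filter, Finset.filter_mem_eq_inter, Finset.inter_eq_right.2 (hAG α),
              Finset.sum_const, nsmul_eq_mul]
          · refine Finset.sum_congr rfl fun α _ => ?_
            rw [← Finset.sum_filter, Finset.filter_mem_eq_inter, Finset.inter_eq_right.2 (hBG α),
              Finset.sum_const, nsmul_eq_mul]
        · rw [← Finset.sum_product' (f := fun α β => if (α, β) ∈ T then p ^ r else 0),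
            ← Finset.sum_filter, Finset.sum_const, nsmul_eq_mul]
    _ ≤ ∑ α ∈ F, ((r + 1) ^ 2 * m * p ^ (2 * r - 1) + r ^ 5 * √p ^ (3 * r - 1))
        + T.card * p ^ r := by
        refine add_le_add (Finset.sum_le_sum fun α hα => add_le_add ?_ ?_) ?_
        · exact mul_le_mul_of_nonneg_right (hA' α hα) (by positivity)
        · exact mul_le_mul_of_nonneg_right (hB' α hα) (by positivity)
        · refine mul_le_mul_of_nonneg_right ?_ (by positivity)
          exact_mod_cast Finset.card_le_card fun q hq => (Finset.mem_filter.1 hq).2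
    _ = F.card * ((r + 1) ^ 2 * m * p ^ (2 * r - 1) + r ^ 5 * √p ^ (3 * r - 1))
        + T.card * p ^ r := by rw [Finset.sum_const, nsmul_eq_mul]
    _ ≤ (n : ℝ) ^ 2 * ((r + 1) ^ 2 * m * p ^ (2 * r - 1) + r ^ 5 * √p ^ (3 * r - 1))
        + T.card * p ^ r := by
        refine add_le_add (mul_le_mul_of_nonneg_right hFc (by positivity)) le_rfl
    _ = _ := by ring

end Pattern

/-! ### Overlaps of progressions with one modulus -/

section SameModulus

variable {n r : ℕ} {α β : ℕ × ℕ × ℕ}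

/-- If more than half of the terms of two progressions coincide then consecutive terms of the first
one are terms of the second one, which ties the two steps together. -/
lemma exists_step_relation (hover : r + 1 < 2 * (ones r α ∩ ones r β).card) :
    ∃ i ∈ Finset.Icc 1 r, ∃ j ∈ Finset.Icc 1 r, ∃ j' ∈ Finset.Icc 1 r, i + 1 ∈ Finset.Icc 1 r ∧
      pos α i = pos β j ∧ pos α (i + 1) = pos β j' := by
  have hI : commonIdx r α β ⊆ Finset.Icc 1 r := Finset.filter_subset _ _
  obtain ⟨i, hi, hi'⟩ := exists_mem_and_succ_mem hI
    (hover.trans_le (Nat.mul_le_mul_left 2 (card_inter_ones_le r α β)))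
  obtain ⟨hi1, hi2⟩ := Finset.mem_filter.1 hi
  obtain ⟨hi1', hi2'⟩ := Finset.mem_filter.1 hi'
  obtain ⟨j, hj, hj'⟩ := Finset.mem_image.1 hi2
  obtain ⟨k, hk, hk'⟩ := Finset.mem_image.1 hi2'
  exact ⟨i, hi1, j, hj, k, hk, hi1', hj'.symm, hk'.symm⟩

/-- Subtracting the congruences of two coincidences eliminates both starting points and leaves a
relation between the steps. -/
lemma dvd_of_pos_eq_pos_eq (hα : α.1 = n) (hβ : β.1 = n) {i i' j j' : ℕ} (h : pos α i = pos β j)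
    (h' : pos α i' = pos β j') :
    (n : ℤ) ∣ ((i' : ℤ) - i) * α.2.2 - ((j' : ℤ) - j) * β.2.2 := by
  have h1 := pos_dvd α i
  have h2 := pos_dvd α i'
  have h3 := pos_dvd β j
  have h4 := pos_dvd β j'
  rw [hα] at h1 h2
  rw [hβ, ← h] at h3
  rw [hβ, ← h'] at h4
  have e : ((i' : ℤ) - i) * α.2.2 - ((j' : ℤ) - j) * β.2.2 =
      (((α.2.1 : ℤ) + i' * α.2.2) - pos α i') - (((α.2.1 : ℤ) + i * α.2.2) - pos α i)
      - ((((β.2.1 : ℤ) + j' * β.2.2) - pos α i') - (((β.2.1 : ℤ) + j * β.2.2) - pos α i)) := by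
    ring
  rw [e]
  exact dvd_sub (dvd_sub h2 h1) (dvd_sub h4 h3)

/-- The pairs of progressions mod `n` whose steps are small multiples of each other in a
non-trivial way. -/
noncomputable def relatedPairs (n r : ℕ) : Finset ((ℕ × ℕ × ℕ) × ℕ × ℕ × ℕ) :=
  (((Finset.Icc (-((r : ℤ) - 1)) (r - 1) ×ˢ Finset.Icc (-((r : ℤ) - 1)) (r - 1)).filter
      fun q => q.1 * q.2 ≠ 1) ×ˢ Finset.Icc 1 r ×ˢ Finset.Icc 1 r).biUnion fun q =>
    (fam n r ×ˢ fam n r).filter fun w =>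
      (n : ℤ) ∣ (q.1.1 * q.1.2 - 1) * w.1.2.2 ∧ (n : ℤ) ∣ w.2.2.2 - q.1.2 * w.1.2.2 ∧
        pos w.1 q.2.1 = pos w.2 q.2.2

/-- There are at most `4 r ^ 2 * r ^ 2` parameters. For each, there are `n` starting points of the
first progression and at most `|μ ν - 1| ≤ r ^ 2` of its steps. The second step is then `ν` times
the first mod `n`, and the common term fixes the second starting point. -/
lemma card_relatedPairs_le (hn : 0 < n) (r : ℕ) : (relatedPairs n r).card ≤ 4 * r ^ 6 * n := by
  unfold relatedPairs
  refine (Finset.card_biUnion_le_card_mul _ _ (n * r ^ 2) ?_).trans ?_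
  · rintro ⟨⟨μ, ν⟩, i, j⟩ hq
    simp only [Finset.mem_product, Finset.mem_filter, Finset.mem_Icc] at hq
    obtain ⟨⟨⟨hμ, hν⟩, hne⟩, hi, hj⟩ := hq
    have hu : μ * ν - 1 ≠ 0 := sub_ne_zero.2 hne
    have hub : (μ * ν - 1).natAbs ≤ r ^ 2 := by
      have h1 : |μ| ≤ (r : ℤ) - 1 := abs_le.2 hμ
      have h2 : |ν| ≤ (r : ℤ) - 1 := abs_le.2 hν
      have h3 : |μ * ν| ≤ ((r : ℤ) - 1) * (r - 1) := by
        rw [abs_mul]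
        exact mul_le_mul h1 h2 (abs_nonneg _) (by omega)
      have h4 : |μ * ν - 1| ≤ (r : ℤ) ^ 2 := by
        have h5 : |μ * ν - 1| ≤ |μ * ν| + 1 := by simpa using abs_sub (μ * ν) 1
        have h6 : (1 : ℤ) ≤ r := by omega
        nlinarith
      zify
      exact_mod_cast h4
    have hc := card_filter_dvd_mul_sub_le (K := n) (q := 1) hn (by simp) hu 0
    calc _ ≤ (Finset.range n ×ˢ ((Finset.range n).filter fun t : ℕ =>
          (n : ℤ) ∣ (μ * ν - 1) * t - 0)).card := by
          refine Finset.card_le_card_of_injOn (fun w => w.1.2) ?_ ?_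
          · rintro ⟨⟨m, a, s⟩, β⟩ hw
            simp only [Finset.coe_filter, Finset.mem_product, Set.mem_ofPred_eq] at hw
            obtain ⟨⟨hα, hβ⟩, h1, -⟩ := hw
            obtain ⟨rfl, ha, hs, -⟩ := mem_fam.1 hα
            simp only [Finset.coe_product, Set.mem_prod, Finset.coe_range, Set.mem_Iio,
              Finset.coe_filter, Finset.mem_range, Set.mem_ofPred_eq, sub_zero]
            exact ⟨ha, hs, h1⟩
          · rintro ⟨⟨m, a, s⟩, ⟨k, b, t⟩⟩ hw ⟨⟨m', a', s'⟩, ⟨k', b', t'⟩⟩ hw' h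
            simp only [Finset.coe_filter, Finset.mem_product, Set.mem_ofPred_eq] at hw hw'
            obtain ⟨⟨hα, hβ⟩, -, h2, h3⟩ := hw
            obtain ⟨⟨hα', hβ'⟩, -, h2', h3'⟩ := hw'
            obtain ⟨rfl, -⟩ := mem_fam.1 hα
            obtain ⟨rfl, -⟩ := mem_fam.1 hα'
            simp only [Prod.mk.injEq] at h
            obtain ⟨rfl, rfl⟩ := h
            have htt : t = t' := by
              obtain ⟨rfl, -, ht, -⟩ := mem_fam.1 hβ
              obtain ⟨rfl, -, ht', -⟩ := mem_fam.1 hβ'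
              have h4 := dvd_sub h2' h2
              have h5 : ((t' : ℤ) - ν * s) - (t - ν * s) = t' - t := by ring
              rw [h5] at h4
              exact Nat.ModEq.eq_of_lt_of_lt (Nat.modEq_iff_dvd.2 h4) ht ht'
            rw [fam_eq_of_pos_eq hβ hβ' htt (h3.symm.trans h3')]
      _ ≤ n * r ^ 2 := by
          rw [Finset.card_product, Finset.card_range]
          refine Nat.mul_le_mul_left n (hc.trans ?_)
          omega
  · rw [Finset.card_product, Finset.card_product]
    have h1 : ((Finset.Icc (-((r : ℤ) - 1)) (r - 1) ×ˢ Finset.Icc (-((r : ℤ) - 1)) (r - 1)).filter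
      fun q => q.1 * q.2 ≠ 1).card ≤ (2 * r) * (2 * r) := by
      refine (Finset.card_filter_le _ _).trans ?_
      rw [Finset.card_product]
      have : (Finset.Icc (-((r : ℤ) - 1)) (r - 1)).card ≤ 2 * r := by
        rw [Int.card_Icc]; omega
      exact Nat.mul_le_mul this this
    calc _ ≤ (2 * r) * (2 * r) * ((Finset.Icc 1 r).card * (Finset.Icc 1 r).card) * (n * r ^ 2) := by
          gcongr
      _ = 4 * r ^ 6 * n := by rw [Nat.card_Icc, Nat.add_sub_cancel]; ring

/-- The start of `β` is a later term of `α`, so the same bit would have to be `false` and `true`.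
This is the purpose of the leading `false` in `Pat`: shifted copies exclude each other. -/
lemma not_pat_of_shift (hα : α ∈ fam n r) (hβ : β ∈ fam n r) (hs : α.2.2 = β.2.2) {i j : ℕ}
    (hi : i ≤ r) (hj : 1 ≤ j) (hij : j < i) (h : pos α i = pos β j) {x : ℕ → Bool}
    (hxα : Pat r α x) (hxβ : Pat r β x) : False := by
  have h0 : pos α (i - j) = pos β 0 := by
    obtain ⟨m, a, s⟩ := α
    obtain ⟨m', b, t⟩ := β
    obtain ⟨rfl, -⟩ := mem_fam.1 hα
    obtain ⟨rfl, -⟩ := mem_fam.1 hβ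
    obtain rfl : s = t := hs
    have h1 : (a + (i - j) * s) + j * s ≡ (b + 0 * s) + j * s [MOD m'] := by
      have e1 : (a + (i - j) * s) + j * s = a + i * s := by
        rw [add_assoc, ← add_mul, Nat.sub_add_cancel hij.le]
      have e2 : (b + 0 * s) + j * s = b + j * s := by ring
      rw [e1, e2]
      exact h
    exact Nat.ModEq.add_right_cancel' _ h1
  have h1 : pos β 0 ∈ ones r α :=
    h0 ▸ Finset.mem_image_of_mem _ (Finset.mem_Icc.2 ⟨by omega, by omega⟩)
  have h2 := hxα.2 _ h1
  rw [hxβ.1] at h2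
  exact absurd h2 (by decide)

/-- Applying `exists_step_relation` in both directions gives steps with `s ≡ μ t` and `t ≡ ν s`,
hence `(μ ν - 1) s ≡ 0`. If `μ ν = 1`, the steps agree up to sign. The progressions are then equal
or shifts of one another, and shifts cannot both be patterns. -/
lemma mem_relatedPairs_of_overlap (hα : α ∈ fam n r) (hβ : β ∈ fam n r) (hne : β ≠ α)
    (hover : r + 1 < 2 * (ones r α ∩ ones r β).card) (hex : ∃ x, Pat r α x ∧ Pat r β x) :
    (α, β) ∈ relatedPairs n r := by
  obtain ⟨x, hxα, hxβ⟩ := hex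
  obtain ⟨i, hi, j, hj, j', hj', hi', h1, h2⟩ := exists_step_relation hover
  rw [Finset.inter_comm] at hover
  obtain ⟨k, hk, l, hl, l', hl', hk', h3, h4⟩ := exists_step_relation hover
  have d1 := dvd_of_pos_eq_pos_eq (fst_of_mem_fam hα) (fst_of_mem_fam hβ) h1 h2
  have d2 := dvd_of_pos_eq_pos_eq (fst_of_mem_fam hβ) (fst_of_mem_fam hα) h3 h4
  simp only [Finset.mem_Icc] at hi hj hj' hi' hk hl hl' hk'
  push_cast at d1 d2
  rw [add_sub_cancel_left, one_mul] at d1 d2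
  set μ : ℤ := (j' : ℤ) - j with hμ
  set ν : ℤ := (l' : ℤ) - l with hν
  have d3 : (n : ℤ) ∣ (μ * ν - 1) * α.2.2 := by
    have e : (μ * ν - 1) * (α.2.2 : ℤ) = -((α.2.2 : ℤ) - μ * β.2.2) - μ * (β.2.2 - ν * α.2.2) := by
      ring
    rw [e]
    exact dvd_sub (dvd_neg.2 d1) (dvd_mul_of_dvd_right d2 μ)
  by_cases hμν : μ * ν = 1
  · exfalso
    obtain ⟨m, a, s⟩ := α
    obtain ⟨m', b, t⟩ := β
    obtain ⟨rfl, ha, hs, h2s, hks⟩ := mem_fam.1 hα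
    obtain ⟨rfl, hb, ht, h2t, hkt⟩ := mem_fam.1 hβ
    have hr : 1 ≤ r := by omega
    simp only at d1
    -- The sign `-1` would give `n ∣ s + t`, while `2 s, 2 t < n`. Choosing one step from each
    -- opposite pair rules it out.
    have hst : s = t := by
      rcases Int.eq_one_or_neg_one_of_mul_eq_one hμν with h | h
      · rw [h, one_mul] at d1
        exact (Nat.ModEq.eq_of_lt_of_lt (Nat.modEq_iff_dvd.2 d1) ht hs).symm
      · rw [h] at d1
        have d4 : m' ∣ s + t := by
          have : (s : ℤ) - -1 * t = ((s + t : ℕ) : ℤ) := by push_cast; ring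
          rw [this] at d1
          exact_mod_cast d1
        have h5 := Nat.eq_zero_of_dvd_of_lt d4 (by omega)
        exact absurd (by simp [show s = 0 by omega]) (hks 1 le_rfl hr)
    rcases lt_trichotomy j i with hlt | rfl | hlt
    · exact not_pat_of_shift hα hβ hst (by omega) hj.1 hlt h1 hxα hxβ
    · exact hne (fam_eq_of_pos_eq hβ hα hst.symm h1.symm)
    · exact not_pat_of_shift hβ hα hst.symm (by omega) hi.1 hlt h1.symm hxβ hxα
  · refine Finset.mem_biUnion.2 ⟨((μ, ν), i, j), ?_, ?_⟩
    · simp only [Finset.mem_product, Finset.mem_filter, Finset.mem_Icc]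
      refine ⟨⟨⟨⟨?_, ?_⟩, ?_, ?_⟩, hμν⟩, hi, hj⟩ <;> omega
    · exact Finset.mem_filter.2 ⟨Finset.mem_product.2 ⟨hα, hβ⟩, d3, d2, h1⟩

variable {Ω : Type*} [MeasurableSpace Ω] {P : Measure Ω} [IsProbabilityMeasure P] {p : ℝ}
  {η : ℕ → Ω → Bool}

lemma IsCoin.depTwo_same_le (hη : IsCoin P p η) (hn : 0 < n) {F : Finset (ℕ × ℕ × ℕ)}
    (hF : F ⊆ fam n r) :
    depTwo P η (Pat r) (patSupp r) F F ≤ (n : ℝ) ^ 2 * n * (r + 1) ^ 2 * p ^ (2 * r - 1)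
      + (n : ℝ) ^ 2 * r ^ 5 * √p ^ (3 * r - 1) + 4 * r ^ 6 * n * p ^ r := by
  refine (hη.depTwo_le hn hF hF (relatedPairs n r) fun α hα β hβ hne hover hex =>
    mem_relatedPairs_of_overlap (hF hα) (hF hβ) hne hover hex).trans ?_
  refine add_le_add le_rfl (mul_le_mul_of_nonneg_right ?_ (pow_nonneg hη.nonneg r))
  exact_mod_cast card_relatedPairs_le hn r

/-- The dependence terms for progressions with one modulus, when `n ^ 2 * p ^ r` and `r` are of
logarithmic size. -/
lemma IsCoin.dep_same_le (hη : IsCoin P p η) (hp : 0 < p) (hn : 0 < n) (hr : 1 ≤ r)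
    {F : Finset (ℕ × ℕ × ℕ)} (hF : F ⊆ fam n r) {L : ℝ} (hL : 1 ≤ L)
    (hrL : (r : ℝ) + 1 ≤ L) (hpL : (n : ℝ) ^ 2 * p ^ r ≤ L) :
    depOne P η (Pat r) (patSupp r) F F + depTwo P η (Pat r) (patSupp r) F F
      ≤ 7 / p * L ^ 7 / n := by
  have h1 := hη.depOne_le hF hF
  have h2 := hη.depTwo_same_le hn hF
  have hp1 := hη.le_one
  have hn' : (0 : ℝ) < n := by exact_mod_cast hn
  set μ := (n : ℝ) ^ 2 * p ^ r with hμ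
  have hμ0 : 0 ≤ μ := by positivity
  have hL0 : 0 ≤ L := by linarith
  have hr0 : (0 : ℝ) ≤ r := Nat.cast_nonneg r
  have hrL' : (r : ℝ) ≤ L := by linarith
  have hip : 1 ≤ 1 / p := by rw [le_div_iff₀ hp]; linarith
  -- the four contributions
  have t1 : (n : ℝ) ^ 2 * n * (r + 1) ^ 2 * p ^ (2 * r) ≤ 1 / p * (L ^ 7 / n) := by
    have e : (n : ℝ) ^ 2 * n * (r + 1) ^ 2 * p ^ (2 * r) = μ ^ 2 * (r + 1) ^ 2 / n := by
      rw [hμ, two_mul, pow_add]; field_simp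
    rw [e]
    have : μ ^ 2 * (r + 1) ^ 2 ≤ L ^ 7 := by
      calc μ ^ 2 * ((r : ℝ) + 1) ^ 2 ≤ L ^ 2 * L ^ 2 := by gcongr
        _ = L ^ 4 := by ring
        _ ≤ L ^ 7 := pow_le_pow_right₀ hL (by norm_num)
    have h3 : μ ^ 2 * (r + 1) ^ 2 / n ≤ L ^ 7 / n := by gcongr
    have h4 : 0 ≤ L ^ 7 / n := by positivity
    nlinarith
  have t2 : (n : ℝ) ^ 2 * n * (r + 1) ^ 2 * p ^ (2 * r - 1) ≤ 1 / p * (L ^ 7 / n) := by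
    have e : (n : ℝ) ^ 2 * n * (r + 1) ^ 2 * p ^ (2 * r - 1)
        = 1 / p * (μ ^ 2 * (r + 1) ^ 2 / n) := by
      have : p ^ (2 * r) = p * p ^ (2 * r - 1) := by
        rw [← pow_succ']; congr 1; omega
      have h5 : μ ^ 2 = n ^ 4 * (p * p ^ (2 * r - 1)) := by
        rw [← this, hμ, two_mul, pow_add]; ring
      rw [h5]; field_simp
    rw [e]
    have : μ ^ 2 * (r + 1) ^ 2 ≤ L ^ 7 := by
      calc μ ^ 2 * ((r : ℝ) + 1) ^ 2 ≤ L ^ 2 * L ^ 2 := by gcongr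
        _ = L ^ 4 := by ring
        _ ≤ L ^ 7 := pow_le_pow_right₀ hL (by norm_num)
    gcongr
  have t3 : (n : ℝ) ^ 2 * r ^ 5 * √p ^ (3 * r - 1) ≤ 1 / p * (L ^ 7 / n) := by
    have hs0 : 0 < √p := Real.sqrt_pos.2 hp
    have hs1 : √p ≤ 1 := Real.sqrt_le_one.2 hp1
    have hsq : √p ^ 2 = p := Real.sq_sqrt hp.le
    -- `√p ^ (3 r) = (√μ / n) ^ 3`
    have e1 : √p ^ (3 * r) = √μ ^ 3 / n ^ 3 := by
      have : √μ = n * √p ^ r := by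
        have e : (n : ℝ) ^ 2 * p ^ r = (n * √p ^ r) ^ 2 := by
          rw [mul_pow, ← pow_mul, mul_comm r 2, pow_mul, hsq]
        rw [hμ, e, Real.sqrt_sq (by positivity)]
      rw [this, mul_pow, ← pow_mul, mul_comm r 3]
      field_simp
    have e2 : √p ^ (3 * r) = √p * √p ^ (3 * r - 1) := by
      rw [← pow_succ']; congr 1; omega
    have e3 : √p ^ (3 * r - 1) = √μ ^ 3 / n ^ 3 / √p := by
      rw [← e1, e2]; field_simp
    have e4 : (n : ℝ) ^ 2 * r ^ 5 * √p ^ (3 * r - 1) = 1 / √p * (√μ ^ 3 * r ^ 5 / n) := by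
      rw [e3]; field_simp
    rw [e4]
    -- The power 7 comes from this term, as `L ^ 2 * L ^ 5`, and from `t4`, as `L * L ^ 6`. The
    -- first two terms need only `L ^ 4`.
    have h5 : √μ ^ 3 ≤ L ^ 2 := by
      have h6 : √μ ≤ √L := Real.sqrt_le_sqrt hpL
      have h7 : √L ^ 2 = L := Real.sq_sqrt hL0
      have h8 : 1 ≤ √L := Real.one_le_sqrt.2 hL
      calc √μ ^ 3 ≤ √L ^ 3 := by gcongr
        _ ≤ √L ^ 4 := pow_le_pow_right₀ h8 (by norm_num)
        _ = L ^ 2 := by rw [← h7, ← pow_mul]; norm_num [Real.sqrt_sq]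
    have h9 : 1 / √p ≤ 1 / p := by
      apply one_div_le_one_div_of_le hp
      nlinarith
    have : √μ ^ 3 * r ^ 5 ≤ L ^ 7 := by
      calc √μ ^ 3 * (r : ℝ) ^ 5 ≤ L ^ 2 * L ^ 5 := by gcongr
        _ = L ^ 7 := by ring
    gcongr
  have t4 : 4 * (r : ℝ) ^ 6 * n * p ^ r ≤ 4 * (1 / p * (L ^ 7 / n)) := by
    have e : 4 * (r : ℝ) ^ 6 * n * p ^ r = 4 * (μ * r ^ 6 / n) := by
      rw [hμ]; field_simp
    rw [e]
    have : μ * r ^ 6 ≤ L ^ 7 := by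
      calc μ * (r : ℝ) ^ 6 ≤ L * L ^ 6 := by gcongr
        _ = L ^ 7 := by ring
    have h3 : μ * r ^ 6 / n ≤ L ^ 7 / n := by gcongr
    have h4 : 0 ≤ L ^ 7 / n := by positivity
    nlinarith
  have e : 7 / p * L ^ 7 / n = 7 * (1 / p * (L ^ 7 / n)) := by ring
  rw [e]
  linarith

open Classical in
lemma IsCoin.sum_adj_prob_le_of_log (hη : IsCoin P p η) (hp : 0 < p) (hn : 0 < n)
    {F : Finset (ℕ × ℕ × ℕ)} (hF : F ⊆ fam n r) {L : ℝ} (hL : 1 ≤ L)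
    (hrL : (r : ℝ) + 1 ≤ L) (hpL : (n : ℝ) ^ 2 * p ^ r ≤ L) (α : ℕ × ℕ × ℕ) :
    ∑ β ∈ F.filter (fun β => Adj (patSupp r) α β), prob P η (Pat r β) ≤ L ^ 3 / n := by
  refine (hη.sum_adj_prob_le hF).trans ?_
  have hn' : (0 : ℝ) < n := by exact_mod_cast hn
  have e : ((r : ℝ) + 1) ^ 2 * n * p ^ r = (r + 1) ^ 2 * ((n : ℝ) ^ 2 * p ^ r) / n := by
    field_simp
  rw [e]
  gcongr
  calc ((r : ℝ) + 1) ^ 2 * ((n : ℝ) ^ 2 * p ^ r) ≤ L ^ 2 * L := by gcongr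
    _ = L ^ 3 := by ring

end SameModulus

/-! ### From patterns to progressions; probability that no progression exists -/

section HasAP

/-- The bits contain an arithmetic progression mod `n` of `r` distinct terms, all `true`. -/
def HasAP (n r : ℕ) (x : ℕ → Bool) : Prop :=
  ∃ a < n, ∃ s, 1 ≤ s ∧ s ≤ n ∧ (∀ k, 1 ≤ k → k < r → ¬ n ∣ k * s) ∧
    ∀ j < r, x ((a + j * s) % n) = true

variable {n r : ℕ} {x : ℕ → Bool}

lemma dependsOn_hasAP (hn : 0 < n) (r : ℕ) :
    DependsOn (HasAP n r) ((Finset.range n : Finset ℕ) : Set ℕ) := by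
  intro x y hxy
  have : ∀ a, x (a % n) = y (a % n) := fun a =>
    hxy _ (by simpa using Nat.mod_lt a hn)
  simp only [HasAP, this]

lemma HasAP.mono {k : ℕ} (hk : k ≤ r) (h : HasAP n r x) : HasAP n k x := by
  obtain ⟨a, ha, s, hs1, hsn, ho, hx⟩ := h
  exact ⟨a, ha, s, hs1, hsn, fun i hi hik => ho i hi (by omega), fun j hj => hx j (by omega)⟩

lemma hasAP_of_pat {α : ℕ × ℕ × ℕ} (hα : α ∈ fam n r) (hr : 1 ≤ r) (hx : Pat r α x) :
    HasAP n r x := by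
  obtain ⟨m, a, s⟩ := α
  obtain ⟨rfl, ha, hs, h2s, hk⟩ := mem_fam.1 hα
  have hm : 0 < m := by omega
  refine ⟨(a + s) % m, Nat.mod_lt _ hm, s, ?_, hs.le, fun k hk1 hk2 => hk k hk1 hk2.le, ?_⟩
  · rcases Nat.eq_zero_or_pos s with rfl | h
    · exact absurd (by simp) (hk 1 le_rfl hr)
    · exact h
  · intro j hj
    have e : ((a + s) % m + j * s) % m = pos (m, a, s) (j + 1) := by
      have : a + s + j * s = a + (j + 1) * s := by ring
      simp [pos, this]
    rw [e]
    exact hx.2 _ (Finset.mem_image_of_mem _ (Finset.mem_Icc.2 ⟨by omega, by omega⟩))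

/-- Reversal: a progression can be taken with a step less than `n / 2`. -/
lemma HasAP.exists_small_step (hr : 3 ≤ r) (h : HasAP n r x) :
    ∃ a < n, ∃ s < n, 2 * s < n ∧ (∀ k, 1 ≤ k → k < r → ¬ n ∣ k * s) ∧
      ∀ j < r, x ((a + j * s) % n) = true := by
  obtain ⟨a, ha, s, hs1, hsn, ho, hx⟩ := h
  have h1 : s ≠ n := by
    rintro rfl
    exact ho 1 le_rfl (by omega) (by simp)
  -- A step equal to `n / 2` has order 2, which is too small for three distinct terms. Every other
  -- step or its opposite is below `n / 2`.
  have h2 : 2 * s ≠ n := by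
    intro h
    exact ho 2 (by omega) (by omega) (by rw [h])
  rcases lt_or_gt_of_ne h2 with hlt | hgt
  · exact ⟨a, ha, s, by omega, hlt, ho, hx⟩
  · have hadd : n - s + s = n := Nat.sub_add_cancel hsn
    refine ⟨(a + (r - 1) * s) % n, Nat.mod_lt _ (by omega), n - s, by omega, by omega, ?_, ?_⟩
    · intro k hk hkr hd
      refine ho k hk hkr ((Nat.dvd_add_right hd).1 ?_)
      rw [← mul_add, hadd]
      exact dvd_mul_left _ _
    · intro j hj
      have e : (a + (r - 1 - j) * s) % n = ((a + (r - 1) * s) % n + j * (n - s)) % n := by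
        have e1 : (a + (r - 1) * s) + j * (n - s) = (a + (r - 1 - j) * s) + n * j := by
          have e2 : (r - 1) * s = (r - 1 - j) * s + j * s := by
            rw [← add_mul, Nat.sub_add_cancel (by omega)]
          have e3 : j * s + j * (n - s) = n * j := by
            rw [← mul_add, add_comm s, hadd, mul_comm]
          rw [e2, ← e3]; ring
        rw [Nat.mod_add_mod, e1, Nat.add_mul_mod_self_left]
      rw [← e]
      exact hx _ (by omega)

/-- If there is a progression of `r` terms but no progression preceded by `false`, then some
progression is constantly `true`. -/
lemma HasAP.exists_full (hr : 3 ≤ r) (h : HasAP n r x) (hnone : ∀ α ∈ fam n r, ¬ Pat r α x) :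
    ∃ a < n, ∃ s < n, (∀ k, 1 ≤ k → k < r → ¬ n ∣ k * s) ∧
      ∀ j, x ((a + j * s) % n) = true := by
  obtain ⟨a, ha, s, hs, h2s, ho, hx⟩ := h.exists_small_step hr
  refine ⟨a, ha, s, hs, ho, ?_⟩
  have hn : 0 < n := by omega
  -- If the order of `s` is exactly `r`, the `r` given terms already form the whole cycle.
  by_cases hrs : n ∣ r * s
  · intro j
    have e : (a + j * s) % n = (a + (j % r) * s) % n := by
      obtain ⟨c, hc⟩ := hrs
      have : j * s = (j % r) * s + n * (c * (j / r)) := by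
        conv_lhs => rw [← Nat.mod_add_div j r]
        rw [add_mul, mul_right_comm, hc]; ring
      rw [this, ← add_assoc, Nat.add_mul_mod_self_left]
    rw [e]
    exact hx _ (Nat.mod_lt _ (by omega))
  · by_contra hex
    push Not at hex
    obtain ⟨j₀, hj₀⟩ := hex
    -- Since `M` is a multiple of `n`, the bits from index `M` on repeat the initial run of `r`
    -- `true` bits. The last `false` at or before `M` is therefore followed by `r` `true` bits,
    -- which is a pattern.
    set M := n * (j₀ + 1) with hM
    have hj₀M : j₀ ≤ M := by rw [hM]; nlinarith
    set j₁ := Nat.findGreatest (fun j => x ((a + j * s) % n) ≠ true) M with hj₁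
    have hj₁x : x ((a + j₁ * s) % n) ≠ true :=
      Nat.findGreatest_spec (P := fun j => x ((a + j * s) % n) ≠ true) hj₀M hj₀
    have hj₁M : j₁ ≤ M := Nat.findGreatest_le M
    have hafter : ∀ j, j₁ < j → j ≤ j₁ + r → x ((a + j * s) % n) = true := by
      intro j hj hjr
      rcases Nat.le_or_ge j M with hjM | hjM
      · by_contra hne
        exact Nat.findGreatest_is_greatest hj hjM hne
      · have h1 : j₁ ≠ M := by
          intro h
          refine hj₁x ?_
          have : a + M * s = a + 0 * s + n * ((j₀ + 1) * s) := by rw [hM]; ring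
          rw [h, this, Nat.add_mul_mod_self_left]
          exact hx 0 (by omega)
        have : a + j * s = a + (j - M) * s + n * ((j₀ + 1) * s) := by
          conv_lhs => rw [← Nat.sub_add_cancel hjM]
          rw [hM]; ring
        rw [this, Nat.add_mul_mod_self_left]
        exact hx _ (by omega)
    refine hnone (n, (a + j₁ * s) % n, s) (mem_fam.2 ⟨rfl, Nat.mod_lt _ hn, hs, h2s, ?_⟩) ⟨?_, ?_⟩
    · intro k hk hkr
      rcases Nat.lt_or_ge k r with h | h
      · exact ho k hk h
      · rwa [show k = r by omega]
    · simpa [pos] using hj₁x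
    · intro i hi
      obtain ⟨j, hj, rfl⟩ := Finset.mem_image.1 hi
      have hj := Finset.mem_Icc.1 hj
      have e : pos (n, (a + j₁ * s) % n, s) j = (a + (j₁ + j) * s) % n := by
        have : a + j₁ * s + j * s = a + (j₁ + j) * s := by ring
        simp [pos, this]
      rw [e]
      exact hafter _ (by omega) (by omega)

open Classical in
/-- The number of steps of small order. -/
lemma card_filter_small_order_le (hn : 0 < n) (R : ℕ) :
    ((Finset.range n).filter fun s => ∃ k, 1 ≤ k ∧ k ≤ R ∧ n ∣ k * s).card ≤ R ^ 2 := by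
  have hsub : ((Finset.range n).filter fun s => ∃ k, 1 ≤ k ∧ k ≤ R ∧ n ∣ k * s) ⊆
      (Finset.Icc 1 R).biUnion fun k => (Finset.range n).filter fun s : ℕ =>
        (n : ℤ) ∣ (k : ℤ) * s - 0 := by
    intro s hs
    obtain ⟨hs, k, hk1, hk2, hd⟩ := Finset.mem_filter.1 hs
    refine Finset.mem_biUnion.2 ⟨k, Finset.mem_Icc.2 ⟨hk1, hk2⟩, Finset.mem_filter.2 ⟨hs, ?_⟩⟩
    rw [sub_zero]
    exact_mod_cast hd
  refine (Finset.card_le_card hsub).trans ((Finset.card_biUnion_le_card_mul _ _ R ?_).trans ?_)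
  · intro k hk
    have hk := Finset.mem_Icc.1 hk
    refine (card_filter_dvd_mul_sub_le (q := 1) hn (by simp) (by omega) 0).trans ?_
    simpa using hk.2
  · rw [Nat.card_Icc, Nat.add_sub_cancel, sq]

lemma card_fam_le_half (n r : ℕ) : 2 * (fam n r).card ≤ n * (n + 1) := by
  have h1 : (fam n r).card ≤ (Finset.range n ×ˢ Finset.range ((n + 1) / 2)).card := by
    refine Finset.card_le_card_of_injOn (fun α => α.2) ?_ ?_
    · rintro ⟨m, a, s⟩ hα
      obtain ⟨rfl, ha, hs, h2s, -⟩ := mem_fam.1 hα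
      simp only [Finset.coe_product, Finset.coe_range, Set.mem_prod, Set.mem_Iio]
      exact ⟨ha, by omega⟩
    · rintro ⟨m, a, s⟩ hα ⟨m', a', s'⟩ hα' h
      obtain ⟨rfl, -⟩ := mem_fam.1 hα
      obtain ⟨rfl, -⟩ := mem_fam.1 hα'
      simp only at h
      rw [h]
  rw [Finset.card_product, Finset.card_range, Finset.card_range] at h1
  calc 2 * (fam n r).card ≤ 2 * (n * ((n + 1) / 2)) := by omega
    _ = n * (2 * ((n + 1) / 2)) := by ring
    _ ≤ n * (n + 1) := Nat.mul_le_mul_left n (by omega)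

/-- Most pairs `(a, s)` with `2 * s < n` belong to the family of progressions; this version allows
for a restriction to steps outside a given set. -/
lemma le_card_filter_fam (hn : 0 < n) (r : ℕ) (S : Finset ℕ) :
    n * n ≤ 2 * ((fam n r).filter fun α => α.2.2 ∉ S).card + 2 * n * (r ^ 2 + S.card) := by
  classical
  set B := (Finset.range n).filter fun s => ∃ k, 1 ≤ k ∧ k ≤ r ∧ n ∣ k * s with hB
  have h1 : Finset.range n ×ˢ Finset.range ((n + 1) / 2) ⊆
      ((fam n r).filter fun α => α.2.2 ∉ S).image (fun α => α.2) ∪ Finset.range n ×ˢ (B ∪ S) := by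
    rintro ⟨a, s⟩ h
    simp only [Finset.mem_product, Finset.mem_range] at h
    by_cases hs : s ∈ B ∪ S
    · exact Finset.mem_union_right _ (Finset.mem_product.2 ⟨Finset.mem_range.2 h.1, hs⟩)
    · refine Finset.mem_union_left _ (Finset.mem_image.2 ⟨(n, a, s), Finset.mem_filter.2 ⟨?_, ?_⟩, rfl⟩)
      · refine mem_fam.2 ⟨rfl, h.1, by omega, by omega, fun k hk1 hk2 hd => hs ?_⟩
        exact Finset.mem_union_left _ (Finset.mem_filter.2 ⟨Finset.mem_range.2 (by omega),
          k, hk1, hk2, hd⟩)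
      · exact fun h => hs (Finset.mem_union_right _ h)
  have h2 := (Finset.card_le_card h1).trans (Finset.card_union_le _ _)
  rw [Finset.card_product, Finset.card_product, Finset.card_range, Finset.card_range] at h2
  have h3 : (((fam n r).filter fun α => α.2.2 ∉ S).image (fun α => α.2)).card ≤
      ((fam n r).filter fun α => α.2.2 ∉ S).card := Finset.card_image_le
  have h4 : (B ∪ S).card ≤ r ^ 2 + S.card :=
    (Finset.card_union_le _ _).trans (Nat.add_le_add_right (card_filter_small_order_le hn r) _)
  have h5 : n * n ≤ 2 * (n * ((n + 1) / 2)) := by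
    rw [mul_left_comm]
    exact Nat.mul_le_mul_left n (by omega)
  have h6 : n * (B ∪ S).card ≤ n * (r ^ 2 + S.card) := Nat.mul_le_mul_left n h4
  calc n * n ≤ 2 * (((fam n r).filter fun α => α.2.2 ∉ S).card + n * (r ^ 2 + S.card)) := by
        omega
    _ = _ := by ring

variable {Ω : Type*} [MeasurableSpace Ω] {P : Measure Ω} [IsProbabilityMeasure P] {p : ℝ}
  {η : ℕ → Ω → Bool}

lemma IsCoin.prob_progression_le (hη : IsCoin P p η) {n k : ℕ} (a : ℕ) {s : ℕ}
    (ho : ∀ i, 1 ≤ i → i < k → ¬ n ∣ i * s) :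
    prob P η (fun x => ∀ j < k, x ((a + j * s) % n) = true) ≤ p ^ k := by
  classical
  have hc : ((Finset.range k).image fun j => (a + j * s) % n).card = k := by
    rw [Finset.card_image_of_injOn, Finset.card_range]
    have key : ∀ i j, i < j → j < k → a + i * s ≡ a + j * s [MOD n] → False := by
      intro i j hij hj h
      have h3 := (Nat.modEq_iff_dvd' (Nat.mul_le_mul_right s hij.le)).1
        (Nat.ModEq.add_left_cancel' a h)
      rw [← Nat.sub_mul] at h3
      exact ho (j - i) (by omega) (by omega) h3
    intro i hi j hj h
    simp only [Finset.coe_range, Set.mem_Iio] at hi hj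
    rcases lt_trichotomy i j with h1 | h1 | h1
    · exact (key i j h1 hj h).elim
    · exact h1
    · exact (key j i h1 hi h.symm).elim
  have := hη.prob_forall_true ((Finset.range k).image fun j => (a + j * s) % n)
  rw [hc] at this
  rw [← this]
  refine prob_mono fun x hx i hi => ?_
  obtain ⟨j, hj, rfl⟩ := Finset.mem_image.1 hi
  exact hx j (Finset.mem_range.1 hj)

/-- The union bound for the existence of a progression. -/
lemma IsCoin.prob_hasAP_le (hη : IsCoin P p η) (n r : ℕ) :
    prob P η (HasAP n r) ≤ (n : ℝ) ^ 2 * p ^ r := by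
  classical
  set F := (Finset.range n ×ˢ Finset.Icc 1 n).filter
    fun q => ∀ k, 1 ≤ k → k < r → ¬ n ∣ k * q.2 with hF
  calc prob P η (HasAP n r)
      ≤ prob P η (fun x => ∃ q ∈ F, ∀ j < r, x ((q.1 + j * q.2) % n) = true) := by
        refine prob_mono fun x hx => ?_
        obtain ⟨a, ha, s, hs1, hsn, ho, hx⟩ := hx
        refine ⟨(a, s), Finset.mem_filter.2 ⟨Finset.mem_product.2 ⟨Finset.mem_range.2 ha,
          Finset.mem_Icc.2 ⟨hs1, hsn⟩⟩, ho⟩, hx⟩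
    _ ≤ ∑ q ∈ F, prob P η (fun x => ∀ j < r, x ((q.1 + j * q.2) % n) = true) :=
        prob_exists_le _ _
    _ ≤ ∑ q ∈ F, p ^ r := Finset.sum_le_sum fun q hq =>
        hη.prob_progression_le q.1 (Finset.mem_filter.1 hq).2
    _ = F.card * p ^ r := by rw [Finset.sum_const, nsmul_eq_mul]
    _ ≤ (n : ℝ) ^ 2 * p ^ r := by
        refine mul_le_mul_of_nonneg_right ?_ (pow_nonneg hη.nonneg r)
        have : F.card ≤ n ^ 2 := by
          refine (Finset.card_filter_le _ _).trans ?_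
          simp [sq]
        exact_mod_cast this

/-- The probability that a whole cycle of at least `r` terms is `true`. -/
lemma IsCoin.prob_full_le (hη : IsCoin P p η) (hn : 0 < n) (r : ℕ) :
    prob P η (fun x => ∃ a < n, ∃ s < n, (∀ k, 1 ≤ k → k < r → ¬ n ∣ k * s) ∧
      ∀ j, x ((a + j * s) % n) = true) ≤ n * (2 * r) ^ 2 * p ^ r + (n : ℝ) ^ 2 * p ^ (2 * r) := by
  classical
  have hp := hη.nonneg
  set B := (Finset.range n).filter fun s => ∃ k, 1 ≤ k ∧ k ≤ 2 * r ∧ n ∣ k * s with hB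
  set F := (Finset.range n ×ˢ Finset.range n).filter
    fun q => ∀ k, 1 ≤ k → k < r → ¬ n ∣ k * q.2 with hF
  -- Steps of order at most `2 r` are few, at most `(2 r) ^ 2`, and their cycles cost `p ^ r`. All
  -- other cycles contain `2 r` distinct terms and cost `p ^ (2 r)`.
  have hpt : ∀ q ∈ F, prob P η (fun x => ∀ j, x ((q.1 + j * q.2) % n) = true) ≤
      (if q ∈ Finset.range n ×ˢ B then p ^ r else 0) + p ^ (2 * r) := by
    intro q hq
    obtain ⟨hq1, hq2⟩ := Finset.mem_filter.1 hq
    obtain ⟨hq1, hq3⟩ := Finset.mem_product.1 hq1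
    split_ifs with h
    · have := (prob_mono (P := P) (η := η) fun x (hx : ∀ j, x ((q.1 + j * q.2) % n) = true)
        j (_ : j < r) => hx j).trans (hη.prob_progression_le q.1 hq2)
      have h2 : 0 ≤ p ^ (2 * r) := by positivity
      linarith
    · rw [zero_add]
      refine (prob_mono (P := P) (η := η) fun x (hx : ∀ j, x ((q.1 + j * q.2) % n) = true)
        j (_ : j < 2 * r) => hx j).trans (hη.prob_progression_le q.1 fun k hk1 hk2 hd => h ?_)
      exact Finset.mem_product.2 ⟨hq1, Finset.mem_filter.2 ⟨hq3, k, hk1, hk2.le, hd⟩⟩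
  calc _ ≤ prob P η (fun x => ∃ q ∈ F, ∀ j, x ((q.1 + j * q.2) % n) = true) := by
        refine prob_mono fun x hx => ?_
        obtain ⟨a, ha, s, hs, ho, hx⟩ := hx
        exact ⟨(a, s), Finset.mem_filter.2 ⟨Finset.mem_product.2 ⟨Finset.mem_range.2 ha,
          Finset.mem_range.2 hs⟩, ho⟩, hx⟩
    _ ≤ ∑ q ∈ F, prob P η (fun x => ∀ j, x ((q.1 + j * q.2) % n) = true) :=
        prob_exists_le _ _
    _ ≤ ∑ q ∈ F, ((if q ∈ Finset.range n ×ˢ B then p ^ r else 0) + p ^ (2 * r)) :=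
        Finset.sum_le_sum hpt
    _ = (F.filter (· ∈ Finset.range n ×ˢ B)).card * p ^ r + F.card * p ^ (2 * r) := by
        rw [Finset.sum_add_distrib, ← Finset.sum_filter, Finset.sum_const, Finset.sum_const,
          nsmul_eq_mul, nsmul_eq_mul]
    _ ≤ n * (2 * r) ^ 2 * p ^ r + (n : ℝ) ^ 2 * p ^ (2 * r) := by
        refine add_le_add (mul_le_mul_of_nonneg_right ?_ (by positivity))
          (mul_le_mul_of_nonneg_right ?_ (by positivity))
        · have : (F.filter (· ∈ Finset.range n ×ˢ B)).card ≤ n * (2 * r) ^ 2 := by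
            refine (Finset.card_le_card (t := Finset.range n ×ˢ B)
              fun q hq => (Finset.mem_filter.1 hq).2).trans ?_
            rw [Finset.card_product, Finset.card_range]
            exact Nat.mul_le_mul_left n (card_filter_small_order_le hn (2 * r))
          exact_mod_cast this
        · have : F.card ≤ n ^ 2 := by
            refine (Finset.card_filter_le _ _).trans ?_
            simp [sq]
          exact_mod_cast this

lemma IsCoin.sum_prob_pat (hη : IsCoin P p η) {F : Finset (ℕ × ℕ × ℕ)} (hF : F ⊆ fam n r) :
    ∑ α ∈ F, prob P η (Pat r α) = F.card * ((1 - p) * p ^ r) := by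
  rw [Finset.sum_congr rfl fun α hα => hη.prob_pat (hF hα), Finset.sum_const, nsmul_eq_mul]

/-- The expected number of patterns is close to `(1 - p) * n ^ 2 * p ^ r / 2`. -/
lemma IsCoin.abs_sum_prob_pat_sub_le (hη : IsCoin P p η) (hn : 0 < n) (hr : 1 ≤ r) :
    |∑ α ∈ fam n r, prob P η (Pat r α) - (1 - p) * n ^ 2 * p ^ r / 2| ≤ n * r ^ 2 * p ^ r := by
  rw [hη.sum_prob_pat subset_rfl]
  have hp := hη.nonneg
  have hp1 := hη.le_one
  have h1 : 2 * ((fam n r).card : ℝ) ≤ n * (n + 1) := by exact_mod_cast card_fam_le_half n r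
  have h2 : (n : ℝ) * n ≤ 2 * (fam n r).card + 2 * n * (r ^ 2 + 0) := by
    have := le_card_filter_fam hn r ∅
    simp only [Finset.notMem_empty, not_false_eq_true, Finset.filter_true, Finset.card_empty] at this
    exact_mod_cast this
  have hr' : (1 : ℝ) ≤ r := by exact_mod_cast hr
  have hn' : (0 : ℝ) ≤ n := Nat.cast_nonneg n
  have hrr : (1 : ℝ) ≤ (r : ℝ) ^ 2 := one_le_pow₀ hr'
  have e : ((fam n r).card : ℝ) * ((1 - p) * p ^ r) - (1 - p) * n ^ 2 * p ^ r / 2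
      = (((fam n r).card : ℝ) - n ^ 2 / 2) * ((1 - p) * p ^ r) := by ring
  rw [e, abs_mul]
  have h3 : |((fam n r).card : ℝ) - (n : ℝ) ^ 2 / 2| ≤ (n : ℝ) * (r : ℝ) ^ 2 := by
    rw [abs_le]
    constructor <;> nlinarith
  have h4 : |(1 - p) * p ^ r| ≤ p ^ r := by
    rw [abs_of_nonneg (mul_nonneg (by linarith) (by positivity))]
    have : 0 ≤ p ^ r := by positivity
    nlinarith
  exact mul_le_mul h3 h4 (abs_nonneg _) (by positivity)

lemma IsCoin.prob_none_le_add (hη : IsCoin P p η) (hn : 0 < n) (hr : 3 ≤ r) :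
    prob P η (fun x => ∀ α ∈ fam n r, ¬ Pat r α x) ≤ prob P η (fun x => ¬ HasAP n r x)
      + (n * (2 * r) ^ 2 * p ^ r + (n : ℝ) ^ 2 * p ^ (2 * r)) := by
  refine (prob_mono fun x hx => ?_).trans ((prob_or_le _ _).trans
    (add_le_add le_rfl (hη.prob_full_le hn r)))
  by_cases h : HasAP n r x
  · exact Or.inr (h.exists_full hr hx)
  · exact Or.inl h

lemma prob_not_hasAP_le_none (hr : 1 ≤ r) {F : Finset (ℕ × ℕ × ℕ)} (hF : F ⊆ fam n r) :
    prob P η (fun x => ¬ HasAP n r x) ≤ prob P η (fun x => ∀ α ∈ F, ¬ Pat r α x) :=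
  prob_mono fun _ hx _ hα h => hx (hasAP_of_pat (hF hα) hr h)

/-- Poisson approximation when `n ^ 2 * p ^ r` and `r` are of logarithmic size. -/
theorem IsCoin.abs_prob_not_hasAP_sub_le (hη : IsCoin P p η) (hp : 0 < p) (hn : 0 < n) (hr : 3 ≤ r)
    {L : ℝ} (hL : 1 ≤ L) (hrL : (r : ℝ) + 1 ≤ L) (hpL : (n : ℝ) ^ 2 * p ^ r ≤ L) :
    |prob P η (fun x => ¬ HasAP n r x) - Real.exp (-((1 - p) * (n : ℝ) ^ 2 * p ^ r / 2))|
      ≤ 30 / p * (L ^ 7 / n) := by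
  classical
  have hn' : (0 : ℝ) < n := by exact_mod_cast hn
  have hp1 := hη.le_one
  have hip : 1 ≤ 1 / p := by rw [le_div_iff₀ hp]; linarith
  have hr0 : (0 : ℝ) ≤ r := Nat.cast_nonneg r
  have hμ0 : 0 ≤ (n : ℝ) ^ 2 * p ^ r := by positivity
  have hQ : 0 ≤ L ^ 7 / n := by positivity
  have h30 : 30 / p * (L ^ 7 / n) = 30 * (1 / p * (L ^ 7 / n)) := by ring
  have hQp : L ^ 7 / n ≤ 1 / p * (L ^ 7 / n) := by nlinarith
  have e2 : 0 ≤ (1 - p) * (n : ℝ) ^ 2 * p ^ r / 2 := by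
    have : 0 ≤ 1 - p := by linarith
    positivity
  -- For `n ≤ L ^ 3` the claimed error exceeds 1 and nothing is to be shown. Otherwise the
  -- neighbourhood mass `L ^ 3 / n` is at most 1, so `1 + 2 ρ ≤ 3` and the factor 7 becomes 21.
  rcases le_or_gt (n : ℝ) (L ^ 3) with hbig | hbig
  · have h1 : 1 ≤ L ^ 7 / n := by
      rw [le_div_iff₀ hn', one_mul]
      exact hbig.trans (pow_le_pow_right₀ hL (by norm_num))
    have h2 := prob_nonneg (P := P) (η := η) (fun x => ¬ HasAP n r x)
    have h3 := prob_le_one (P := P) (η := η) (fun x => ¬ HasAP n r x)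
    have h4 := Real.exp_pos (-((1 - p) * (n : ℝ) ^ 2 * p ^ r / 2))
    have h5 : Real.exp (-((1 - p) * (n : ℝ) ^ 2 * p ^ r / 2)) ≤ 1 := Real.exp_le_one_iff.2
      (by linarith)
    rw [h30, abs_le]
    constructor <;> linarith
  have hρ1 : L ^ 3 / n ≤ 1 := by rw [div_le_one hn']; exact hbig.le
  have hb := hη.dep_same_le hp hn (by omega) (subset_refl (fam n r)) hL hrL hpL
  have hmain := hη.abs_prob_none_sub_exp_le (isLocalFamily_pat r) (F := fam n r)
    (ρ := L ^ 3 / n) (by positivity)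
    (fun α _ => hη.sum_adj_prob_le_of_log hp hn (subset_refl _) hL hrL hpL α) hb (by positivity)
  have hmain2 : 7 / p * L ^ 7 / n * (1 + 2 * (L ^ 3 / n)) ≤ 21 * (1 / p * (L ^ 7 / n)) := by
    have e : 7 / p * L ^ 7 / n = 7 * (1 / p * (L ^ 7 / n)) := by ring
    rw [e]
    have : 0 ≤ 1 / p * (L ^ 7 / n) := by positivity
    nlinarith
  have hL37 : L ^ 3 / n ≤ L ^ 7 / n := by
    gcongr
    norm_num
  have hL3 : n * (r : ℝ) ^ 2 * p ^ r ≤ L ^ 3 / n := by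
    have e : n * (r : ℝ) ^ 2 * p ^ r = r ^ 2 * ((n : ℝ) ^ 2 * p ^ r) / n := by field_simp
    rw [e]
    gcongr
    calc (r : ℝ) ^ 2 * ((n : ℝ) ^ 2 * p ^ r) ≤ L ^ 2 * L := by gcongr; linarith
      _ = L ^ 3 := by ring
  have hL3' : n * (2 * (r : ℝ)) ^ 2 * p ^ r ≤ 4 * (L ^ 3 / n) := by
    have : n * (2 * (r : ℝ)) ^ 2 * p ^ r = 4 * (n * (r : ℝ) ^ 2 * p ^ r) := by ring
    rw [this]; linarith
  have hL2 : (n : ℝ) ^ 2 * p ^ (2 * r) ≤ L ^ 3 / n := by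
    have e : (n : ℝ) ^ 2 * p ^ (2 * r) = ((n : ℝ) ^ 2 * p ^ r) ^ 2 / n / n := by
      rw [two_mul, pow_add]; field_simp
    rw [e]
    have h1n : (1 : ℝ) ≤ n := by exact_mod_cast hn
    calc ((n : ℝ) ^ 2 * p ^ r) ^ 2 / n / n ≤ ((n : ℝ) ^ 2 * p ^ r) ^ 2 / n / 1 := by gcongr
      _ ≤ L ^ 2 / n / 1 := by gcongr
      _ ≤ L ^ 3 / n := by
        rw [div_one]
        gcongr
        norm_num
  have hlam := hη.abs_sum_prob_pat_sub_le hn (show 1 ≤ r by omega)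
  have hlam0 : 0 ≤ ∑ α ∈ fam n r, prob P η (Pat r α) :=
    Finset.sum_nonneg fun α _ => prob_nonneg _
  have hexp : |Real.exp (-∑ α ∈ fam n r, prob P η (Pat r α))
      - Real.exp (-((1 - p) * (n : ℝ) ^ 2 * p ^ r / 2))| ≤ L ^ 3 / n := by
    refine le_trans ?_ (hlam.trans hL3)
    set u := ∑ α ∈ fam n r, prob P η (Pat r α)
    set v := (1 - p) * (n : ℝ) ^ 2 * p ^ r / 2
    -- The function `exp (-u)` is 1-Lipschitz on `u ≥ 0`, so replacing the exact mean by its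
    -- approximation costs no more than their difference.
    have key : ∀ u v : ℝ, 0 ≤ u → u ≤ v → Real.exp (-u) - Real.exp (-v) ≤ v - u := by
      intro u v hu huv
      have h1 : Real.exp (-v) = Real.exp (-u) * Real.exp (-(v - u)) := by
        rw [← Real.exp_add]; congr 1; ring
      have h2 := Real.add_one_le_exp (-(v - u))
      have h3 : Real.exp (-u) ≤ 1 := Real.exp_le_one_iff.2 (by linarith)
      have h4 := Real.exp_pos (-u)
      rw [h1]
      nlinarith
    rcases le_total u v with h | h
    · have := key u v hlam0 h
      have h2 : Real.exp (-v) ≤ Real.exp (-u) := Real.exp_le_exp.2 (by linarith)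
      rw [abs_of_nonneg (by linarith), abs_of_nonpos (by linarith)]
      linarith
    · have := key v u e2 h
      have h2 : Real.exp (-u) ≤ Real.exp (-v) := Real.exp_le_exp.2 (by linarith)
      rw [abs_of_nonpos (by linarith), abs_of_nonneg (by linarith)]
      linarith
  have hup := prob_not_hasAP_le_none (P := P) (η := η) (show 1 ≤ r by omega) (subset_refl (fam n r))
  have hlow := hη.prob_none_le_add hn hr
  rw [h30]
  rw [abs_le] at hmain hexp ⊢
  constructor <;> linarith [hmain.1, hmain.2, hexp.1, hexp.2]

/-- An upper bound for the probability that there is no progression, with a quadratically small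
error. -/
theorem IsCoin.prob_not_hasAP_le (hη : IsCoin P p η) (hp : 0 < p) (hn : 0 < n) (hr : 3 ≤ r)
    {L : ℝ} (hL : 1 ≤ L) (hrL : (r : ℝ) + 1 ≤ L) (hpL : (n : ℝ) ^ 2 * p ^ r ≤ L) :
    prob P η (fun x => ¬ HasAP n r x) ≤
      Real.exp (8 / p * (L ^ 7 / n) - (1 - p) * (n : ℝ) ^ 2 * p ^ r / 2)
        + 14 / p * (L ^ 10 / (n : ℝ) ^ 2) := by
  classical
  have hn' : (0 : ℝ) < n := by exact_mod_cast hn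
  have hp1 := hη.le_one
  have hip : 1 ≤ 1 / p := by rw [le_div_iff₀ hp]; linarith
  have hr0 : (0 : ℝ) ≤ r := Nat.cast_nonneg r
  have hQ : 0 ≤ L ^ 7 / n := by positivity
  have hb := hη.dep_same_le hp hn (by omega) (subset_refl (fam n r)) hL hrL hpL
  have hmain := hη.prob_none_le (isLocalFamily_pat r) (F := fam n r)
    (ρ := L ^ 3 / n) (by positivity)
    (fun α _ => hη.sum_adj_prob_le_of_log hp hn (subset_refl _) hL hrL hpL α) hb (by positivity)
  have hup := prob_not_hasAP_le_none (P := P) (η := η) (show 1 ≤ r by omega) (subset_refl (fam n r))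
  have hlam := (abs_le.1 (hη.abs_sum_prob_pat_sub_le hn (show 1 ≤ r by omega))).1
  have hL3 : n * (r : ℝ) ^ 2 * p ^ r ≤ L ^ 7 / n := by
    have e : n * (r : ℝ) ^ 2 * p ^ r = r ^ 2 * ((n : ℝ) ^ 2 * p ^ r) / n := by field_simp
    rw [e]
    gcongr
    calc (r : ℝ) ^ 2 * ((n : ℝ) ^ 2 * p ^ r) ≤ L ^ 2 * L := by gcongr; linarith
      _ = L ^ 3 := by ring
      _ ≤ L ^ 7 := pow_le_pow_right₀ hL (by norm_num)
  -- In the exponent, `7 / p` from the dependence terms and 1 from approximating the mean give `8 /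
  -- p`. The additive error is `2 b ρ` with `b = 7 / p * L ^ 7 / n` and `ρ = L ^ 3 / n`.
  refine hup.trans (hmain.trans (add_le_add (Real.exp_le_exp.2 ?_) (le_of_eq ?_)))
  · have e1 : 7 / p * L ^ 7 / n = 7 * (1 / p * (L ^ 7 / n)) := by ring
    have e2 : 8 / p * (L ^ 7 / n) = 8 * (1 / p * (L ^ 7 / n)) := by ring
    have : L ^ 7 / n ≤ 1 / p * (L ^ 7 / n) := by nlinarith
    linarith
  · field_simp
    ring

end HasAP

/-! ### Translation of the random variable `W` to bits -/

section Link

variable {Ω : Type*} [MeasurableSpace Ω] {P : Measure Ω} [IsProbabilityMeasure P] {p : ℝ}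
  {ξ : ℕ → Ω → ℝ}

open Classical in
/-- The bits attached to a sequence of random variables with values in `{0, 1}`. -/
noncomputable def bit (ξ : ℕ → Ω → ℝ) (i : ℕ) (ω : Ω) : Bool := decide (ξ (i + 1) ω = 1)

open Classical in
lemma IsBernoulliSequence.isCoin (hξ : IsBernoulliSequence P p ξ) (hp : 0 ≤ p) :
    IsCoin P p (bit ξ) := by
  have hm : Measurable fun y : ℝ => decide (y = 1) :=
    measurable_to_bool (by simp [Set.preimage])
  refine ⟨fun i => hm.comp (hξ.measurable (i + 1) (by omega)), fun i => ?_, ?_⟩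
  · simp only [bit, decide_eq_true_eq, measureReal_def, hξ.prob_one (i + 1) (by omega),
      ENNReal.toReal_ofReal hp]
  · exact hξ.indep.comp (fun _ y => decide (y = 1)) fun _ => hm

lemma dvd_mul_iff_div_gcd_dvd {n s k : ℕ} (hn : 0 < n) : n ∣ k * s ↔ n / Nat.gcd s n ∣ k := by
  have hg : 0 < Nat.gcd s n := Nat.gcd_pos_of_pos_right s hn
  have hc : Nat.Coprime (n / Nat.gcd s n) (s / Nat.gcd s n) :=
    (Nat.coprime_div_gcd_div_gcd hg).symm
  rw [← hc.dvd_mul_right (m := k)]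
  have e : n ∣ k * s ↔
      n / Nat.gcd s n * Nat.gcd s n ∣ k * (s / Nat.gcd s n) * Nat.gcd s n := by
    rw [mul_assoc, Nat.div_mul_cancel (Nat.gcd_dvd_left s n),
      Nat.div_mul_cancel (Nat.gcd_dvd_right s n)]
  rw [e]
  exact Nat.mul_dvd_mul_iff_right hg

/-- The number `n / gcd(s, n)` is the additive order of `s` mod `n`, so the cap on the length says
that the terms are distinct. -/
lemma le_div_gcd_iff {n s r : ℕ} (hn : 0 < n) :
    r ≤ n / Nat.gcd s n ↔ ∀ k, 1 ≤ k → k < r → ¬ n ∣ k * s := by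
  have hg : 0 < n / Nat.gcd s n :=
    Nat.div_pos (Nat.le_of_dvd hn (Nat.gcd_dvd_right s n)) (Nat.gcd_pos_of_pos_right s hn)
  simp only [dvd_mul_iff_div_gcd_dvd hn]
  constructor
  · intro h k hk hkr hd
    exact absurd (Nat.le_of_dvd hk hd) (by omega)
  · intro h
    by_contra hlt
    exact h _ hg (by omega) dvd_rfl

lemma modRep_add_one {n k : ℕ} (hn : 0 < n) : modRep n (k + 1) = k % n + 1 := by
  unfold modRep
  have h1 := Nat.mod_lt k hn
  rcases Nat.lt_or_ge (k % n + 1) n with h | h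
  · have : (k + 1) % n = k % n + 1 := by
      rw [Nat.add_mod, Nat.mod_eq_of_lt (a := 1) (by omega)]
      exact Nat.mod_eq_of_lt h
    rw [this, if_neg (by omega)]
  · have : (k + 1) % n = 0 := by
      rw [← Nat.mod_add_mod, show k % n + 1 = n by omega, Nat.mod_self]
    rw [if_pos this]
    omega

/-- Positions `1, …, n` become residues `0, …, n - 1`. The condition `1 ≤ r` keeps `r` above the
supremum of the empty set. -/
lemma le_W_iff {n r : ℕ} (hn : 0 < n) (hr : 1 ≤ r) (ω : Ω) :
    r ≤ W ξ n ω ↔ HasAP n r (bits (bit ξ) ω) := by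
  classical
  have hbot : (⊥ : ℕ) < r := hr
  simp only [W, longestMod, longestModAt, Finset.le_sup_iff hbot, Finset.mem_Icc,
    Finset.mem_filter, id]
  constructor
  · rintro ⟨a, ⟨ha1, han⟩, s, ⟨hs1, hsn⟩, m, ⟨⟨hm1, hmn⟩, hx⟩, hrm⟩
    refine ⟨a - 1, by omega, s, hs1, hsn, (le_div_gcd_iff hn).1 (hrm.trans hmn), fun j hj => ?_⟩
    have := hx j (by omega)
    rw [show a + j * s = (a - 1 + j * s) + 1 by omega, modRep_add_one hn] at this
    simpa [bits, bit] using this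
  · rintro ⟨a, ha, s, hs1, hsn, ho, hx⟩
    refine ⟨a + 1, ⟨by omega, by omega⟩, s, ⟨hs1, hsn⟩, r,
      ⟨⟨hr, (le_div_gcd_iff hn).2 ho⟩, fun j hj => ?_⟩, le_rfl⟩
    rw [show a + 1 + j * s = (a + j * s) + 1 by omega, modRep_add_one hn]
    simpa [bits, bit] using hx j hj

lemma W_lt_iff {n r : ℕ} (hn : 0 < n) (hr : 1 ≤ r) (ω : Ω) :
    W ξ n ω < r ↔ ¬ HasAP n r (bits (bit ξ) ω) := by
  rw [← le_W_iff hn hr, not_le]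

lemma real_W_lt {n r : ℕ} (hn : 0 < n) (hr : 1 ≤ r) :
    P.real {ω | W ξ n ω < r} = prob P (bit ξ) (fun x => ¬ HasAP n r x) := by
  simp only [W_lt_iff hn hr, prob]

lemma real_le_W {n r : ℕ} (hn : 0 < n) (hr : 1 ≤ r) :
    P.real {ω | r ≤ W ξ n ω} = prob P (bit ξ) (HasAP n r) := by
  simp only [le_W_iff hn hr, prob]

end Link

/-! ### Near independence for two different moduli -/

section TwoModuli

variable {n m r : ℕ} {α β : ℕ × ℕ × ℕ}

/-- A set of more than half of `{1, …, r}` contains consecutive elements and, far from these, a third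
element. -/
lemma exists_consecutive_and_far {I : Finset ℕ} (hI : I ⊆ Finset.Icc 1 r)
    (hcard : r + 1 < 2 * I.card) (hr : 20 ≤ r) :
    ∃ i ∈ I, i + 1 ∈ I ∧ ∃ k ∈ I, (r : ℤ) ≤ 5 * |(k : ℤ) - i| := by
  obtain ⟨i, hi, hi'⟩ := exists_mem_and_succ_mem hI hcard
  refine ⟨i, hi, hi', ?_⟩
  by_contra! hne
  -- Without a far element, `I` fits in an interval of about `2 r / 5` integers, too short for more
  -- than half of `{1, …, r}`.
  have hsub : I ⊆ Finset.Icc (i - (r - 1) / 5) (i + (r - 1) / 5) := by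
    intro k hk
    have h1 := hne k hk
    have h2 := abs_le.1 (show |(k : ℤ) - i| ≤ ((r - 1) / 5 : ℕ) by omega)
    exact Finset.mem_Icc.2 ⟨by omega, by omega⟩
  have h3 := Finset.card_le_card hsub
  rw [Nat.card_Icc] at h3
  omega

/-- The range of the auxiliary parameters in the comparison of two moduli. -/
def coefBound (r : ℕ) : ℕ := r ^ 2 + r

/-- The steps mod `n` that satisfy a linear relation mod `m` with small coefficients. -/
noncomputable def badSteps (n m r : ℕ) : Finset ℕ :=
  (((Finset.Icc (-(coefBound r : ℤ)) (coefBound r)).filter (· ≠ 0)) ×ˢ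
      Finset.Icc (-(coefBound r : ℤ)) (coefBound r)).biUnion fun q =>
    (Finset.range n).filter fun s : ℕ => (m : ℤ) ∣ q.1 * s - n * q.2

/-- Since `n ≤ 2 m`, the range of steps covers at most two periods mod `m`, so each relation with
leading coefficient `u` has at most `2 |u|` solutions. -/
lemma card_badSteps_le (hm : 0 < m) (hnm : n ≤ 2 * m) (r : ℕ) :
    (badSteps n m r).card ≤ (2 * coefBound r + 1) ^ 3 := by
  have hI : (Finset.Icc (-(coefBound r : ℤ)) (coefBound r)).card = 2 * coefBound r + 1 := by
    rw [Int.card_Icc]; omega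
  refine (Finset.card_biUnion_le_card_mul _ _ (2 * coefBound r) ?_).trans ?_
  · rintro ⟨u, v⟩ hq
    simp only [Finset.mem_product, Finset.mem_filter, Finset.mem_Icc] at hq
    refine (card_filter_dvd_mul_sub_le hm hnm hq.1.2 _).trans ?_
    have : u.natAbs ≤ coefBound r := by omega
    omega
  · rw [Finset.card_product, hI]
    calc _ ≤ (2 * coefBound r + 1) * (2 * coefBound r + 1) * (2 * coefBound r + 1) := by
          gcongr
          · exact (Finset.card_filter_le _ _).trans hI.le
          · omega
      _ = _ := by ring

/-- If more than half of the terms of a progression mod `n`, whose step is not too small, lie in a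
progression mod `m`, then its step satisfies a linear relation with small coefficients. -/
lemma step_mem_badSteps (hα : α ∈ fam n r) (hβ : β ∈ fam m r) (hr : 20 ≤ r)
    (hnm : ∀ v : ℤ, v ≠ 0 → |v| ≤ coefBound r → ¬ (m : ℤ) ∣ n * v)
    (hstep : 5 * n ≤ r * α.2.2) (hover : r + 1 < 2 * (ones r α ∩ ones r β).card) :
    α.2.2 ∈ badSteps n m r := by
  have hI : commonIdx r α β ⊆ Finset.Icc 1 r := Finset.filter_subset _ _
  obtain ⟨i, hi, hi', k, hk, hik⟩ := exists_consecutive_and_far hI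
    (hover.trans_le (Nat.mul_le_mul_left 2 (card_inter_ones_le r α β))) hr
  obtain ⟨hi1, hi2⟩ := Finset.mem_filter.1 hi
  obtain ⟨hi1', hi2'⟩ := Finset.mem_filter.1 hi'
  obtain ⟨hk1, hk2⟩ := Finset.mem_filter.1 hk
  obtain ⟨j, hj, hjp⟩ := Finset.mem_image.1 hi2
  obtain ⟨j', hj', hjp'⟩ := Finset.mem_image.1 hi2'
  obtain ⟨l, hl, hlp⟩ := Finset.mem_image.1 hk2
  have hα' := hα
  obtain ⟨n', a, s⟩ := α
  obtain ⟨rfl, ha, hs, h2s, hks⟩ := mem_fam.1 hα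
  have hn : 0 < n' := by omega
  simp only [Finset.mem_Icc] at hi1 hi1' hk1 hj hj' hl
  -- the numbers of wraps
  obtain ⟨w, hw⟩ := pos_dvd (n', a, s) i
  obtain ⟨w', hw'⟩ := pos_dvd (n', a, s) (i + 1)
  obtain ⟨w'', hw''⟩ := pos_dvd (n', a, s) k
  simp only at hw hw' hw'' hstep
  push_cast at hw'
  have l0 : (pos (n', a, s) i : ℤ) < n' := by exact_mod_cast pos_lt (α := (n', a, s)) hn i
  have l1 : (pos (n', a, s) (i + 1) : ℤ) < n' := by
    exact_mod_cast pos_lt (α := (n', a, s)) hn (i + 1)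
  have l2 : (pos (n', a, s) k : ℤ) < n' := by exact_mod_cast pos_lt (α := (n', a, s)) hn k
  set y := (pos (n', a, s) i : ℤ) with hy
  set y' := (pos (n', a, s) (i + 1) : ℤ) with hy'
  set y'' := (pos (n', a, s) k : ℤ) with hy''
  have g0 : 0 ≤ y := Int.natCast_nonneg _
  have g1 : 0 ≤ y' := Int.natCast_nonneg _
  have g2 : 0 ≤ y'' := Int.natCast_nonneg _
  set Δ : ℤ := (k : ℤ) - i with hΔ
  set κ₀ : ℤ := w' - w with hκ₀
  set κ : ℤ := w'' - w with hκ
  have hyy' : y' - y = s - n' * κ₀ := by rw [hκ₀]; linarith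
  have hyy'' : y'' - y = Δ * s - n' * κ := by
    have : y'' - y = ((a : ℤ) + k * s - n' * w'') - ((a : ℤ) + i * s - n' * w) := by linarith
    rw [this, hΔ, hκ]; ring
  have hnz : (0 : ℤ) < n' := by exact_mod_cast hn
  have hsz : (s : ℤ) < n' := by exact_mod_cast hs
  have hsz0 : (0 : ℤ) ≤ s := Int.natCast_nonneg _
  have h2sz : 2 * (s : ℤ) < n' := by exact_mod_cast h2s
  have hκ₀' : κ₀ = 0 ∨ κ₀ = 1 := by
    have h1 : -1 < κ₀ := by
      by_contra h
      have := mul_le_mul_of_nonneg_left (not_lt.1 h) hnz.le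
      linarith
    have h2 : κ₀ < 2 := by
      by_contra h
      have := mul_le_mul_of_nonneg_left (not_lt.1 h) hnz.le
      linarith
    omega
  have hΔr : |Δ| ≤ (r : ℤ) - 1 := abs_le.2 ⟨by omega, by omega⟩
  have hκr : |κ| ≤ (r : ℤ) := by
    have hΔs : |Δ * s| ≤ ((r : ℤ) - 1) * n' := by
      rw [abs_mul, abs_of_nonneg hsz0]
      exact mul_le_mul hΔr hsz.le hsz0 (by omega)
    have hΔs' := abs_le.1 hΔs
    refine abs_le.2 ⟨?_, ?_⟩
    · by_contra h
      have h1 : κ ≤ -(r : ℤ) - 1 := by omega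
      have := mul_le_mul_of_nonneg_left h1 hnz.le
      linarith
    · by_contra h
      have h1 : (r : ℤ) + 1 ≤ κ := by omega
      have := mul_le_mul_of_nonneg_left h1 hnz.le
      linarith
  -- the relations in the second progression
  have d0 := pos_dvd β j
  have d1 := pos_dvd β j'
  have d2 := pos_dvd β l
  rw [fst_of_mem_fam hβ, hjp] at d0
  rw [fst_of_mem_fam hβ, hjp'] at d1
  rw [fst_of_mem_fam hβ, hlp] at d2
  set c' : ℤ := (j' : ℤ) - j with hc'
  set c : ℤ := (l : ℤ) - j with hc
  have e1 : (m : ℤ) ∣ c' * β.2.2 - (y' - y) := by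
    have e : c' * β.2.2 - (y' - y) =
      ((β.2.1 : ℤ) + j' * β.2.2 - y') - ((β.2.1 : ℤ) + j * β.2.2 - y) := by rw [hc']; ring
    rw [e]
    exact dvd_sub d1 d0
  have e2 : (m : ℤ) ∣ c * β.2.2 - (y'' - y) := by
    have e : c * β.2.2 - (y'' - y) =
      ((β.2.1 : ℤ) + l * β.2.2 - y'') - ((β.2.1 : ℤ) + j * β.2.2 - y) := by rw [hc]; ring
    rw [e]
    exact dvd_sub d2 d0
  -- Cross-multiplying the two congruences mod `m` eliminates the step of `β` and leaves a relation
  -- for `s` alone.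
  have e3 : (m : ℤ) ∣ (c - c' * Δ) * s - n' * (c * κ₀ - c' * κ) := by
    have e : (c - c' * Δ) * s - n' * (c * κ₀ - c' * κ) =
        c' * (c * β.2.2 - (y'' - y)) - c * (c' * β.2.2 - (y' - y)) := by
      rw [hyy', hyy'']; ring
    rw [e]
    exact dvd_sub (dvd_mul_of_dvd_right e2 _) (dvd_mul_of_dvd_right e1 _)
  have hcr : |c| ≤ (r : ℤ) := abs_le.2 ⟨by omega, by omega⟩
  have hcr' : |c'| ≤ (r : ℤ) := abs_le.2 ⟨by omega, by omega⟩
  have hr0 : (0 : ℤ) ≤ r := Int.natCast_nonneg _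
  have hB : (coefBound r : ℤ) = (r : ℤ) ^ 2 + r := by simp [coefBound]
  have hub : |c - c' * Δ| ≤ coefBound r := by
    have h1 : |c' * Δ| ≤ (r : ℤ) * r := by
      rw [abs_mul]
      exact mul_le_mul hcr' (by linarith) (abs_nonneg _) hr0
    have := abs_sub c (c' * Δ)
    rw [hB, sq]; linarith
  have hvb : |c * κ₀ - c' * κ| ≤ coefBound r := by
    have h1 : |c' * κ| ≤ (r : ℤ) * r := by
      rw [abs_mul]
      exact mul_le_mul hcr' hκr (abs_nonneg _) hr0
    have h2 : |c * κ₀| ≤ (r : ℤ) := by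
      rcases hκ₀' with h | h <;> rw [h] <;> simp [hcr]
    have := abs_sub (c * κ₀) (c' * κ)
    rw [hB, sq]; linarith
  -- If the coefficient of `s` vanishes, the relation says that `m` divides `n` times a small
  -- integer, which must then be 0 by `hnm`. Hence `κ = Δ κ₀` and `y'' - y = Δ (y' - y)` holds over
  -- the integers. As `2 s < n`, the difference `y' - y` has absolute value at least `s`. With `|Δ|
  -- ≥ r / 5` and `r s ≥ 5 n` the residues `y` and `y''` would be at least `n` apart, which is
  -- impossible.
  by_cases hu : c - c' * Δ = 0
  · exfalso
    have hv : c * κ₀ - c' * κ = 0 := by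
      by_contra hv
      refine hnm _ hv hvb ?_
      rw [hu, zero_mul, zero_sub] at e3
      exact dvd_neg.1 e3
    have hc'0 : c' ≠ 0 := by
      intro h0
      have hjj : j = j' := by omega
      rw [hjj, hjp'] at hjp
      have := pos_inj_of_mem_fam hα' hi1'.2 hi1.2 hjp
      omega
    have hκΔ : κ = Δ * κ₀ := by
      have : c' * (κ - Δ * κ₀) = 0 := by
        have hcc : c = c' * Δ := by linarith
        rw [hcc] at hv
        linarith
      rcases mul_eq_zero.1 this with h | h
      · exact absurd h hc'0
      · linarith
    have hfin : y'' - y = Δ * (s - n' * κ₀) := by rw [hyy'', hκΔ]; ring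
    have habs : |Δ| * |(s : ℤ) - n' * κ₀| < n' := by
      rw [← abs_mul, ← hfin]
      exact abs_lt.2 ⟨by linarith, by linarith⟩
    have hbig : (s : ℤ) ≤ |(s : ℤ) - n' * κ₀| := by
      rcases hκ₀' with h | h
      · rw [h, mul_zero, sub_zero]; exact le_abs_self _
      · rw [h, mul_one, abs_of_neg (by linarith)]; linarith
    have hstep' : 5 * (n' : ℤ) ≤ r * s := by exact_mod_cast hstep
    have h1 : |Δ| * s ≤ |Δ| * |(s : ℤ) - n' * κ₀| :=
      mul_le_mul_of_nonneg_left hbig (abs_nonneg Δ)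
    have h2 : (r : ℤ) * s ≤ 5 * |Δ| * s := mul_le_mul_of_nonneg_right hik hsz0
    linarith
  · refine Finset.mem_biUnion.2 ⟨(c - c' * Δ, c * κ₀ - c' * κ), ?_,
      Finset.mem_filter.2 ⟨Finset.mem_range.2 hs, e3⟩⟩
    simp only [Finset.mem_product, Finset.mem_filter, Finset.mem_Icc]
    exact ⟨⟨abs_le.1 hub, hu⟩, abs_le.1 hvb⟩

/-- The family of progressions whose step is not too small. -/
def famLarge (n r : ℕ) : Finset (ℕ × ℕ × ℕ) := (fam n r).filter fun α => 5 * n ≤ r * α.2.2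

/-- The pairs of progressions that meet twice and whose first step satisfies a linear relation with
small coefficients. -/
noncomputable def badPairs (n m r : ℕ) : Finset ((ℕ × ℕ × ℕ) × ℕ × ℕ × ℕ) :=
  ((fam n r).filter fun α => α.2.2 ∈ badSteps n m r).biUnion fun α =>
    {α} ×ˢ (fam m r).filter fun β => 2 ≤ (ones r α ∩ ones r β).card

lemma card_badPairs_le (hm : 0 < m) (hnm : n ≤ 2 * m) (r : ℕ) :
    (badPairs n m r).card ≤ n * (2 * coefBound r + 1) ^ 3 * r ^ 5 := by
  refine (Finset.card_biUnion_le_card_mul _ _ (r ^ 5) ?_).trans (Nat.mul_le_mul_right _ ?_)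
  · intro α hα
    rw [Finset.card_product, Finset.card_singleton, one_mul]
    refine (card_filter_two_le hm r (ones r α)).trans ?_
    rw [card_ones_of_mem_fam (Finset.mem_filter.1 hα).1, ← pow_add]
  · have h1 : ((fam n r).filter fun α => α.2.2 ∈ badSteps n m r).card ≤
        (Finset.range n ×ˢ badSteps n m r).card := by
      refine Finset.card_le_card_of_injOn (fun α => α.2) ?_ ?_
      · rintro ⟨n', a, s⟩ hα
        simp only [Finset.coe_filter, Set.mem_ofPred_eq] at hα
        simp only [Finset.coe_product, Set.mem_prod, Finset.mem_coe, Finset.mem_range]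
        exact ⟨(mem_fam.1 hα.1).2.1, hα.2⟩
      · rintro ⟨n', a, s⟩ hα ⟨n'', a', s'⟩ hα' h
        simp only [Finset.coe_filter, Set.mem_ofPred_eq] at hα hα'
        obtain ⟨rfl, -⟩ := mem_fam.1 hα.1
        obtain ⟨rfl, -⟩ := mem_fam.1 hα'.1
        simp only at h
        rw [h]
    refine h1.trans ?_
    rw [Finset.card_product, Finset.card_range]
    exact Nat.mul_le_mul_left n (card_badSteps_le hm hnm r)

/-- Discarding the steps up to `5 n / r` removes only a proportion of order `1 / r` of the
progressions. -/
lemma le_card_famLarge (hn : 0 < n) (hr : 1 ≤ r) :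
    (n : ℝ) * n ≤ 2 * (famLarge n r).card + 2 * n * (r ^ 2 + (5 * n / r + 1)) := by
  have h1 := le_card_filter_fam hn r (Finset.range (5 * n / r + 1))
  rw [Finset.card_range] at h1
  have h2 : (((fam n r).filter fun α => α.2.2 ∉ Finset.range (5 * n / r + 1))).card ≤
      (famLarge n r).card := by
    refine Finset.card_le_card fun α hα => ?_
    obtain ⟨hα, h⟩ := Finset.mem_filter.1 hα
    refine Finset.mem_filter.2 ⟨hα, ?_⟩
    rw [Finset.mem_range, not_lt] at h
    have h3 : 5 * n < r * (5 * n / r + 1) := Nat.lt_mul_div_succ (5 * n) hr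
    exact h3.le.trans (Nat.mul_le_mul_left r h)
  have h3 : n * n ≤ 2 * (famLarge n r).card + 2 * n * (r ^ 2 + (5 * n / r + 1)) := by omega
  have h4 : ((5 * n / r : ℕ) : ℝ) ≤ 5 * n / r := by
    have := Nat.cast_div_le (α := ℝ) (m := 5 * n) (n := r)
    push_cast at this
    exact this
  have h5 : (n : ℝ) * n ≤ 2 * (famLarge n r).card + 2 * n * (r ^ 2 + ((5 * n / r : ℕ) + 1)) := by
    exact_mod_cast h3
  have h6 : (0 : ℝ) ≤ n := Nat.cast_nonneg n
  nlinarith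

lemma le_card_famLarge_add (hr : 20 ≤ r) {N : ℕ} (hN : 0 < N) (hNn : N ≤ n) (hNm : N ≤ m)
    (hn2 : n ≤ 2 * N) (hm2 : m ≤ 2 * N) :
    (N : ℝ) ^ 2 - (5 * N * r ^ 2 + 20 * N ^ 2 / r) ≤
      ((famLarge n r).card + (fam m r).card : ℝ) := by
  have hc1 := le_card_famLarge (n := n) (r := r) (by omega) (by omega)
  have hc2 : (m : ℝ) * m ≤ 2 * (fam m r).card + 2 * m * r ^ 2 := by
    have := le_card_filter_fam (n := m) (by omega) r ∅
    simp only [Finset.notMem_empty, not_false_eq_true, Finset.filter_true, Finset.card_empty,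
      add_zero] at this
    exact_mod_cast this
  have hr' : (20 : ℝ) ≤ r := by exact_mod_cast hr
  have hNpos : (0 : ℝ) < N := by exact_mod_cast hN
  have hNn' : (N : ℝ) ≤ n := by exact_mod_cast hNn
  have hNm' : (N : ℝ) ≤ m := by exact_mod_cast hNm
  have hn2' : (n : ℝ) ≤ 2 * N := by exact_mod_cast hn2
  have hm2' : (m : ℝ) ≤ 2 * N := by exact_mod_cast hm2
  have d1 : (n : ℝ) * (r ^ 2 + (5 * n / r + 1)) ≤ 2 * N * (r ^ 2 + (5 * (2 * N) / r + 1)) := by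
    gcongr
  have d2 : (m : ℝ) * r ^ 2 ≤ 2 * N * r ^ 2 := by gcongr
  have d3 : N * 2 ≤ (N : ℝ) * r ^ 2 := mul_le_mul_of_nonneg_left (by nlinarith) hNpos.le
  have d4 : 2 * (N : ℝ) * (r ^ 2 + (5 * (2 * N) / r + 1)) =
      2 * (N * r ^ 2) + 20 * N ^ 2 / r + 2 * N := by ring
  have d5 : (N : ℝ) * N ≤ n * n := mul_self_le_mul_self hNpos.le hNn'
  have d6 : (N : ℝ) * N ≤ m * m := mul_self_le_mul_self hNpos.le hNm'
  have d7 : (N : ℝ) ^ 2 = N * N := sq _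
  linarith

lemma dep_union_le {Ω : Type*} [MeasurableSpace Ω] {P : Measure Ω} {η : ℕ → Ω → Bool}
    {ι : Type*} [DecidableEq ι] (R : ι → (ℕ → Bool) → Prop) (supp : ι → Finset ℕ)
    {F G : Finset ι} (hFG : Disjoint F G) :
    depOne P η R supp (F ∪ G) (F ∪ G) + depTwo P η R supp (F ∪ G) (F ∪ G) =
      (depOne P η R supp F F + depTwo P η R supp F F)
      + (depOne P η R supp G G + depTwo P η R supp G G)
      + (2 * (depOne P η R supp F G + depTwo P η R supp F G)) := by
  classical
  have hsymm : ∀ α β, Adj supp α β ↔ Adj supp β α := fun α β => by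
    simp only [Adj, eq_comm (a := α), disjoint_comm (a := supp α)]
  have h1 : depOne P η R supp G F = depOne P η R supp F G := by
    unfold depOne
    simp only [Finset.sum_filter]
    rw [Finset.sum_comm]
    refine Finset.sum_congr rfl fun α _ => Finset.sum_congr rfl fun β _ => ?_
    simp only [hsymm β α, mul_comm (prob P η (R β))]
  have h2 : depTwo P η R supp G F = depTwo P η R supp F G := by
    unfold depTwo
    simp only [Finset.sum_filter]
    rw [Finset.sum_comm]
    refine Finset.sum_congr rfl fun α _ => Finset.sum_congr rfl fun β _ => ?_
    simp only [hsymm β α, ne_comm (a := α), and_comm (a := R β _)]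
    congr
  have h3 : depOne P η R supp (F ∪ G) (F ∪ G) = depOne P η R supp F F + depOne P η R supp F G
      + (depOne P η R supp G F + depOne P η R supp G G) := by
    unfold depOne
    simp only [Finset.sum_filter]
    rw [Finset.sum_union hFG, ← Finset.sum_add_distrib, ← Finset.sum_add_distrib]
    congr 1 <;> exact Finset.sum_congr rfl fun α _ => Finset.sum_union hFG
  have h4 : depTwo P η R supp (F ∪ G) (F ∪ G) = depTwo P η R supp F F + depTwo P η R supp F G
      + (depTwo P η R supp G F + depTwo P η R supp G G) := by
    unfold depTwo
    simp only [Finset.sum_filter]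
    rw [Finset.sum_union hFG, ← Finset.sum_add_distrib, ← Finset.sum_add_distrib]
    congr 1 <;> exact Finset.sum_congr rfl fun α _ => Finset.sum_union hFG
  rw [h3, h4, h1, h2]
  ring

variable {Ω : Type*} [MeasurableSpace Ω] {P : Measure Ω} [IsProbabilityMeasure P] {p : ℝ}
  {η : ℕ → Ω → Bool}

/-- The dependence terms for progressions with two different moduli. -/
lemma IsCoin.dep_cross_le (hη : IsCoin P p η) (hp : 0 < p) (hr : 20 ≤ r) {N : ℕ} (hN : 0 < N)
    (hNm : N ≤ m) (hn2 : n ≤ 2 * N) (hm2 : m ≤ 2 * N)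
    (hnm : ∀ v : ℤ, v ≠ 0 → |v| ≤ coefBound r → ¬ (m : ℤ) ∣ n * v)
    {L : ℝ} (hL : 1 ≤ L) (hrL : (r : ℝ) + 1 ≤ L) (hpL : 4 * (N : ℝ) ^ 2 * p ^ r ≤ L) :
    depOne P η (Pat r) (patSupp r) (famLarge n r) (fam m r)
      + depTwo P η (Pat r) (patSupp r) (famLarge n r) (fam m r) ≤ 50 / p * (L ^ 12 / N) := by
  have hF : famLarge n r ⊆ fam n r := Finset.filter_subset _ _
  have hm : 0 < m := by omega
  have h1 := hη.depOne_le hF (subset_refl (fam m r))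
  have h2 := hη.depTwo_le hm hF (subset_refl (fam m r)) (badPairs n m r) (by
    intro α hα β hβ _ hover _
    obtain ⟨hα, hstep⟩ := Finset.mem_filter.1 hα
    refine Finset.mem_biUnion.2 ⟨α, Finset.mem_filter.2 ⟨hα,
      step_mem_badSteps hα hβ hr hnm hstep hover⟩, Finset.mem_product.2
      ⟨Finset.mem_singleton_self α, Finset.mem_filter.2 ⟨hβ, by simp only; omega⟩⟩⟩)
  have h3 : ((badPairs n m r).card : ℝ) ≤ n * (2 * (r ^ 2 + r) + 1) ^ 3 * r ^ 5 := by
    exact_mod_cast card_badPairs_le hm (show n ≤ 2 * m by omega) r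
  have hp1 := hη.le_one
  have hNpos : (0 : ℝ) < N := by exact_mod_cast hN
  have hn2' : (n : ℝ) ≤ 2 * N := by exact_mod_cast hn2
  have hm2' : (m : ℝ) ≤ 2 * N := by exact_mod_cast hm2
  set μ := 4 * (N : ℝ) ^ 2 * p ^ r with hμ
  have hμ0 : 0 ≤ μ := by positivity
  have hL0 : 0 ≤ L := by linarith
  have hr0 : (0 : ℝ) ≤ r := Nat.cast_nonneg r
  have hrL' : (r : ℝ) ≤ L := by linarith
  have hip : 1 ≤ 1 / p := by rw [le_div_iff₀ hp]; linarith
  have hQ : 0 ≤ L ^ 12 / N := by positivity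
  have hQp : L ^ 12 / N ≤ 1 / p * (L ^ 12 / N) := by nlinarith
  have hq4 : μ ^ 2 * ((r : ℝ) + 1) ^ 2 ≤ L ^ 12 := by
    calc μ ^ 2 * ((r : ℝ) + 1) ^ 2 ≤ L ^ 2 * L ^ 2 := by gcongr
      _ = L ^ 4 := by ring
      _ ≤ L ^ 12 := pow_le_pow_right₀ hL (by norm_num)
  have t1 : (n : ℝ) ^ 2 * m * (r + 1) ^ 2 * p ^ (2 * r) ≤ 1 / p * (L ^ 12 / N) := by
    calc (n : ℝ) ^ 2 * m * (r + 1) ^ 2 * p ^ (2 * r)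
        ≤ (2 * N : ℝ) ^ 2 * (2 * N) * (r + 1) ^ 2 * p ^ (2 * r) := by gcongr
      _ = (μ ^ 2 * (r + 1) ^ 2) / (2 * N) := by
          rw [hμ, two_mul r, pow_add]; field_simp; ring
      _ ≤ L ^ 12 / (1 * N) := by gcongr; norm_num
      _ = L ^ 12 / N := by rw [one_mul]
      _ ≤ _ := hQp
  have t2 : (n : ℝ) ^ 2 * m * (r + 1) ^ 2 * p ^ (2 * r - 1) ≤ 1 / p * (L ^ 12 / N) := by
    have e5 : p ^ (2 * r) = p * p ^ (2 * r - 1) := by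
      rw [← pow_succ']; congr 1; omega
    calc (n : ℝ) ^ 2 * m * (r + 1) ^ 2 * p ^ (2 * r - 1)
        ≤ (2 * N : ℝ) ^ 2 * (2 * N) * (r + 1) ^ 2 * p ^ (2 * r - 1) := by gcongr
      _ = 1 / p * ((μ ^ 2 * (r + 1) ^ 2) / (2 * N)) := by
          have : μ ^ 2 = 16 * (N : ℝ) ^ 4 * (p * p ^ (2 * r - 1)) := by
            rw [← e5, hμ, two_mul r, pow_add]; ring
          rw [this]; field_simp; ring
      _ ≤ 1 / p * (L ^ 12 / (1 * N)) := by gcongr; norm_num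
      _ = _ := by rw [one_mul]
  have t3 : (n : ℝ) ^ 2 * r ^ 5 * √p ^ (3 * r - 1) ≤ 1 / p * (L ^ 12 / N) := by
    have hs0 : 0 < √p := Real.sqrt_pos.2 hp
    have hs1 : √p ≤ 1 := Real.sqrt_le_one.2 hp1
    have hsq : √p ^ 2 = p := Real.sq_sqrt hp.le
    have e2 : √p ^ (3 * r) = √p * √p ^ (3 * r - 1) := by
      rw [← pow_succ']; congr 1; omega
    set θ := 2 * (N : ℝ) * √p ^ r with hθ
    have hθ0 : 0 ≤ θ := by positivity
    have hθμ : θ ^ 2 = μ := by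
      rw [hθ, mul_pow, ← pow_mul, mul_comm r 2, pow_mul, hsq, hμ]; ring
    have e3 : θ ^ 3 = 8 * (N : ℝ) ^ 3 * (√p * √p ^ (3 * r - 1)) := by
      rw [← e2, hθ, mul_pow, ← pow_mul, mul_comm r 3]; ring
    have h5 : θ ^ 3 ≤ L ^ 2 := by
      have h6 : θ ^ 2 ≤ L := hθμ ▸ hpL
      rcases le_total θ 1 with h | h
      · calc θ ^ 3 ≤ 1 := pow_le_one₀ hθ0 h
          _ ≤ L ^ 2 := one_le_pow₀ hL
      · calc θ ^ 3 ≤ θ ^ 4 := pow_le_pow_right₀ h (by norm_num)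
          _ = (θ ^ 2) ^ 2 := by ring
          _ ≤ L ^ 2 := by gcongr
    have h9 : 1 / √p ≤ 1 / p := by
      apply one_div_le_one_div_of_le hp
      nlinarith
    calc (n : ℝ) ^ 2 * r ^ 5 * √p ^ (3 * r - 1)
        ≤ (2 * N : ℝ) ^ 2 * r ^ 5 * √p ^ (3 * r - 1) := by gcongr
      _ = 1 / √p * ((θ ^ 3 * r ^ 5) / (2 * N)) := by rw [e3]; field_simp; ring
      _ ≤ 1 / p * ((L ^ 2 * L ^ 5) / (1 * N)) := by gcongr; norm_num
      _ ≤ 1 / p * (L ^ 12 / N) := by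
          rw [one_mul, ← pow_add]
          gcongr
          norm_num
  -- This is the dominant term: `coefBound r ^ 3` has order `r ^ 6`, a further `r ^ 5` counts the
  -- partners, and the intensity contributes one more factor `L`. Hence the power 12.
  have t4 : ((badPairs n m r).card : ℝ) * p ^ r ≤ 27 * (1 / p * (L ^ 12 / N)) := by
    have h6 : (2 * ((r : ℝ) ^ 2 + r) + 1) ≤ 2 * L ^ 2 := by nlinarith
    calc ((badPairs n m r).card : ℝ) * p ^ r
        ≤ (2 * N) * (2 * L ^ 2) ^ 3 * L ^ 5 * p ^ r := by
          refine mul_le_mul_of_nonneg_right (h3.trans ?_) (by positivity)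
          gcongr
      _ = 4 * (μ * L ^ 11 / N) := by rw [hμ]; field_simp; ring
      _ ≤ 4 * (L * L ^ 11 / N) := by gcongr
      _ = 4 * (L ^ 12 / N) := by ring
      _ ≤ _ := by linarith
  have e : 50 / p * (L ^ 12 / N) = 50 * (1 / p * (L ^ 12 / N)) := by ring
  rw [e]
  have : 0 ≤ 1 / p * (L ^ 12 / N) := by positivity
  linarith

/-- The events that there is no progression for two different moduli are almost independent. -/
theorem IsCoin.prob_not_hasAP_and_le (hη : IsCoin P p η) (hp : 0 < p) (hr : 20 ≤ r) {N : ℕ}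
    (hN : 0 < N) (hNn : N ≤ n) (hNm : N ≤ m) (hn2 : n ≤ 2 * N) (hm2 : m ≤ 2 * N) (hne : n ≠ m)
    (hnm : ∀ v : ℤ, v ≠ 0 → |v| ≤ coefBound r → ¬ (m : ℤ) ∣ n * v)
    {L : ℝ} (hL : 1 ≤ L) (hrL : (r : ℝ) + 1 ≤ L) (hpL : 4 * (N : ℝ) ^ 2 * p ^ r ≤ L)
    (hNL : L ^ 12 ≤ N) :
    prob P η (fun x => ¬ HasAP n r x ∧ ¬ HasAP m r x) ≤
      Real.exp (-((1 - p) * (N : ℝ) ^ 2 * p ^ r) + 5 * (4 * (N : ℝ) ^ 2 * p ^ r) / r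
        + 2 * (L ^ 12 / N)) + 570 / p * (L ^ 12 / N) := by
  classical
  have hn : 0 < n := by omega
  have hm : 0 < m := by omega
  have hp1 := hη.le_one
  have hNpos : (0 : ℝ) < N := by exact_mod_cast hN
  have hNn' : (N : ℝ) ≤ n := by exact_mod_cast hNn
  have hNm' : (N : ℝ) ≤ m := by exact_mod_cast hNm
  have hn2' : (n : ℝ) ≤ 2 * N := by exact_mod_cast hn2
  have hm2' : (m : ℝ) ≤ 2 * N := by exact_mod_cast hm2
  have hr1 : (1 : ℝ) ≤ r := by exact_mod_cast (by omega : 1 ≤ r)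
  have hip : 1 ≤ 1 / p := by rw [le_div_iff₀ hp]; linarith
  have hpr : 0 < p ^ r := by positivity
  have hF : famLarge n r ⊆ fam n r := Finset.filter_subset _ _
  have hpn : (n : ℝ) ^ 2 * p ^ r ≤ L := by
    refine le_trans ?_ hpL
    have : (n : ℝ) ^ 2 ≤ 4 * (N : ℝ) ^ 2 := by nlinarith
    gcongr
  have hpm : (m : ℝ) ^ 2 * p ^ r ≤ L := by
    refine le_trans ?_ hpL
    have : (m : ℝ) ^ 2 ≤ 4 * (N : ℝ) ^ 2 := by nlinarith
    gcongr
  have hdisj : Disjoint (famLarge n r) (fam m r) := by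
    rw [Finset.disjoint_left]
    intro α hα hα'
    exact hne ((fst_of_mem_fam (hF hα)).symm.trans (fst_of_mem_fam hα'))
  set U := famLarge n r ∪ fam m r with hU
  have hQ : 0 ≤ L ^ 12 / N := by positivity
  have h712 : ∀ k : ℝ, (N : ℝ) ≤ k → L ^ 7 / k ≤ L ^ 12 / N := fun k hk => by
    have : L ^ 7 ≤ L ^ 12 := pow_le_pow_right₀ hL (by norm_num)
    gcongr
  have h312 : ∀ k : ℝ, (N : ℝ) ≤ k → L ^ 3 / k ≤ L ^ 12 / N := fun k hk => by
    have : L ^ 3 ≤ L ^ 12 := pow_le_pow_right₀ hL (by norm_num)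
    gcongr
  have hb : depOne P η (Pat r) (patSupp r) U U + depTwo P η (Pat r) (patSupp r) U U ≤
      114 / p * (L ^ 12 / N) := by
    rw [hU, dep_union_le _ _ hdisj]
    have b1 := hη.dep_same_le hp hn (by omega) hF hL hrL hpn
    have b2 := hη.dep_same_le hp hm (by omega) (subset_refl (fam m r)) hL hrL hpm
    have b3 := hη.dep_cross_le hp hr hN hNm hn2 hm2 hnm hL hrL hpL
    have c1 : 7 / p * L ^ 7 / n ≤ 7 / p * (L ^ 12 / N) := by
      rw [mul_div_assoc]
      exact mul_le_mul_of_nonneg_left (h712 n hNn') (by positivity)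
    have c2 : 7 / p * L ^ 7 / m ≤ 7 / p * (L ^ 12 / N) := by
      rw [mul_div_assoc]
      exact mul_le_mul_of_nonneg_left (h712 m hNm') (by positivity)
    have e : 114 / p * (L ^ 12 / N) = 7 / p * (L ^ 12 / N) + 7 / p * (L ^ 12 / N)
      + 2 * (50 / p * (L ^ 12 / N)) := by ring
    rw [e]
    linarith
  have hNL' : L ^ 12 / N ≤ 1 := (div_le_one hNpos).2 hNL
  -- A crude bound suffices because only the estimate with absolute error is used. The factor `1 + 2
  -- * 2` turns `114 = 7 + 7 + 2 * 50` into 570.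
  have hρ : ∀ α ∈ U, ∑ β ∈ U.filter (fun β => Adj (patSupp r) α β), prob P η (Pat r β) ≤ 2 := by
    intro α _
    rw [hU, Finset.filter_union, Finset.sum_union (Finset.disjoint_filter_filter hdisj)]
    have s1 := hη.sum_adj_prob_le_of_log hp hn hF hL hrL hpn α
    have s2 := hη.sum_adj_prob_le_of_log hp hm (subset_refl (fam m r)) hL hrL hpm α
    linarith [h312 n hNn', h312 m hNm']
  have hmain := (abs_le.1 (hη.abs_prob_none_sub_exp_le (isLocalFamily_pat r) (F := U)
    (ρ := 2) (by norm_num) hρ hb (by positivity))).2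
  have hup : prob P η (fun x => ¬ HasAP n r x ∧ ¬ HasAP m r x) ≤
      prob P η (fun x => ∀ α ∈ U, ¬ Pat r α x) := by
    refine prob_mono fun x hx α hα h => ?_
    rcases Finset.mem_union.1 hα with hα | hα
    · exact hx.1 (hasAP_of_pat (hF hα) (by omega) h)
    · exact hx.2 (hasAP_of_pat hα (by omega) h)
  have hlam : ∑ α ∈ U, prob P η (Pat r α) =
      ((famLarge n r).card + (fam m r).card) * ((1 - p) * p ^ r) := by
    rw [hU, Finset.sum_union hdisj, hη.sum_prob_pat hF, hη.sum_prob_pat subset_rfl]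
    ring
  have hcard := le_card_famLarge_add (n := n) (m := m) hr hN hNn hNm hn2 hm2
  have hlow : (1 - p) * (N : ℝ) ^ 2 * p ^ r
      - (5 * (4 * (N : ℝ) ^ 2 * p ^ r) / r + 2 * (L ^ 12 / N)) ≤ ∑ α ∈ U, prob P η (Pat r α) := by
    rw [hlam]
    have hw0 : 0 ≤ (1 - p) * p ^ r := mul_nonneg (by linarith) hpr.le
    have hw1 : (1 - p) * p ^ r ≤ p ^ r := by nlinarith
    have f1 := mul_le_mul_of_nonneg_right hcard hw0
    have f2 : (5 * N * (r : ℝ) ^ 2 + 20 * (N : ℝ) ^ 2 / r) * ((1 - p) * p ^ r) ≤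
        (5 * N * (r : ℝ) ^ 2 + 20 * (N : ℝ) ^ 2 / r) * p ^ r :=
      mul_le_mul_of_nonneg_left hw1 (by positivity)
    have f3 : 5 * N * (r : ℝ) ^ 2 * p ^ r ≤ 2 * (L ^ 12 / N) := by
      calc 5 * N * (r : ℝ) ^ 2 * p ^ r = 5 / 4 * (r ^ 2 * (4 * (N : ℝ) ^ 2 * p ^ r) / N) := by
            field_simp
        _ ≤ 5 / 4 * (L ^ 2 * L / N) := by gcongr; linarith
        _ = 5 / 4 * (L ^ 3 / N) := by ring
        _ ≤ 2 * (L ^ 12 / N) := by linarith [h312 N le_rfl]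
    have f4 : 20 * (N : ℝ) ^ 2 / r * p ^ r = 5 * (4 * (N : ℝ) ^ 2 * p ^ r) / r := by ring
    linarith
  have hexp : Real.exp (-∑ α ∈ U, prob P η (Pat r α)) ≤
      Real.exp (-((1 - p) * (N : ℝ) ^ 2 * p ^ r) + 5 * (4 * (N : ℝ) ^ 2 * p ^ r) / r
        + 2 * (L ^ 12 / N)) := Real.exp_le_exp.2 (by linarith)
  have e : 570 / p * (L ^ 12 / N) = 114 / p * (L ^ 12 / N) * (1 + 2 * 2) := by ring
  rw [e]
  linarith

end TwoModuli

/-! ### Long progressions for some modulus of order `N` -/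

section IntegerProgressions

/-- The integer arithmetic progression `u + d, …, u + h * d`. -/
def prog (h u d : ℕ) : Finset ℕ := (Finset.Icc 1 h).image fun j => u + j * d

variable {h u u' d d' : ℕ}

lemma card_prog (hd : 0 < d) (h u : ℕ) : (prog h u d).card = h := by
  rw [prog, Finset.card_image_of_injective, Nat.card_Icc, Nat.add_sub_cancel]
  intro i j hij
  have : i * d = j * d := by simpa using hij
  exact Nat.eq_of_mul_eq_mul_right hd this

/-- With a larger intersection, two consecutive terms of the progression with the smaller step `d`
would lie in the other one. Then `d` would be a positive multiple of `d' > d`. -/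
lemma two_mul_card_inter_prog_le_of_lt (hd : 0 < d) (hdd : d < d') :
    2 * (prog h u d ∩ prog h u' d').card ≤ h + 1 := by
  by_contra hlt
  set I := (Finset.Icc 1 h).filter fun j => u + j * d ∈ prog h u' d' with hI
  have h1 : (prog h u d ∩ prog h u' d').card ≤ I.card := by
    refine (Finset.card_le_card (t := I.image fun j => u + j * d) ?_).trans Finset.card_image_le
    intro y hy
    obtain ⟨hy1, hy2⟩ := Finset.mem_inter.1 hy
    obtain ⟨j, hj, rfl⟩ := Finset.mem_image.1 hy1
    exact Finset.mem_image_of_mem (fun j => u + j * d) (Finset.mem_filter.2 ⟨hj, hy2⟩)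
  obtain ⟨i, hi, hi'⟩ := exists_mem_and_succ_mem (r := h) (I := I) (Finset.filter_subset _ _)
    (by omega)
  obtain ⟨k, -, hk⟩ := Finset.mem_image.1 (Finset.mem_filter.1 hi).2
  obtain ⟨k', -, hk'⟩ := Finset.mem_image.1 (Finset.mem_filter.1 hi').2
  have h2 : k * d' + d = k' * d' := by
    simp only [add_mul, one_mul] at hk hk'
    omega
  rcases Nat.le_or_ge k' k with h3 | h3
  · have := Nat.mul_le_mul_right d' h3
    omega
  · obtain ⟨e, rfl⟩ := Nat.exists_eq_add_of_le h3
    rw [add_mul] at h2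
    have h4 : d = e * d' := by omega
    rcases Nat.eq_zero_or_pos e with rfl | he
    · omega
    · have := Nat.mul_le_mul_right d' (show 1 ≤ e from he)
      omega

lemma two_mul_card_inter_prog_le (hd : 0 < d) (hd' : 0 < d') (hdd : d ≠ d') :
    2 * (prog h u d ∩ prog h u' d').card ≤ h + 1 := by
  rcases lt_or_gt_of_ne hdd with hlt | hlt
  · exact two_mul_card_inter_prog_le_of_lt hd hlt
  · rw [Finset.inter_comm]
    exact two_mul_card_inter_prog_le_of_lt hd' hlt

lemma card_meeting_pairs_le (h d d' c N : ℕ) :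
    ((Finset.Ico c (c + N) ×ˢ Finset.Ico c (c + N)).filter
      fun q => ¬ Disjoint (prog h q.1 d) (prog h q.2 d')).card ≤ h ^ 2 * N := by
  have hsub : ((Finset.Ico c (c + N) ×ˢ Finset.Ico c (c + N)).filter
      fun q => ¬ Disjoint (prog h q.1 d) (prog h q.2 d')) ⊆
      (Finset.Icc 1 h ×ˢ Finset.Icc 1 h).biUnion fun w =>
        (Finset.Ico c (c + N) ×ˢ Finset.Ico c (c + N)).filter
          fun q => q.1 + w.1 * d = q.2 + w.2 * d' := by
    intro q hq
    obtain ⟨hq, hd⟩ := Finset.mem_filter.1 hq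
    obtain ⟨y, hy1, hy2⟩ := Finset.not_disjoint_iff.1 hd
    obtain ⟨j, hj, rfl⟩ := Finset.mem_image.1 hy1
    obtain ⟨k, hk, hjk⟩ := Finset.mem_image.1 hy2
    exact Finset.mem_biUnion.2 ⟨(j, k), Finset.mem_product.2 ⟨hj, hk⟩,
      Finset.mem_filter.2 ⟨hq, hjk.symm⟩⟩
  refine (Finset.card_le_card hsub).trans ((Finset.card_biUnion_le_card_mul _ _ N ?_).trans ?_)
  · rintro ⟨j, k⟩ -
    refine (Finset.card_le_card_of_injOn (t := Finset.Ico c (c + N)) (fun q => q.1) ?_ ?_).trans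
      (by simp)
    · rintro ⟨a, b⟩ hq
      simp only [Finset.coe_filter, Finset.mem_product, Set.mem_ofPred_eq] at hq
      exact Finset.mem_coe.2 hq.1.1
    · rintro ⟨a, b⟩ hq ⟨a', b'⟩ hq' heq
      simp only [Finset.coe_filter, Finset.mem_product, Set.mem_ofPred_eq] at hq hq' heq
      subst heq
      have : b = b' := by omega
      rw [this]
  · simp [sq]

variable {Ω : Type*} [MeasurableSpace Ω] {P : Measure Ω} [IsProbabilityMeasure P] {p : ℝ}
  {η : ℕ → Ω → Bool}

/-- All bits in a finite set are `true`. -/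
def AllTrue (T : Finset ℕ) (x : ℕ → Bool) : Prop := ∀ i ∈ T, x i = true

lemma dependsOn_allTrue (T : Finset ℕ) : DependsOn (AllTrue T) (T : Set ℕ) := by
  intro x y hxy
  refine propext (forall₂_congr fun i hi => ?_)
  rw [hxy i hi]

lemma finDep_allTrue (T : Finset ℕ) : FinDep (AllTrue T) := ⟨T, dependsOn_allTrue T⟩

lemma IsCoin.prob_allTrue (hη : IsCoin P p η) (T : Finset ℕ) : prob P η (AllTrue T) = p ^ T.card :=
  hη.prob_forall_true T

lemma ind_allTrue_mul (S T : Finset ℕ) (x : ℕ → Bool) :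
    ind (AllTrue S) x * ind (AllTrue T) x = ind (AllTrue (S ∪ T)) x := by
  rw [ind_mul]
  congr 1
  ext y
  simp only [AllTrue, Finset.mem_union]
  exact ⟨fun hy i hi => hi.elim (hy.1 i) (hy.2 i),
    fun hy => ⟨fun i hi => hy i (Or.inl hi), fun i hi => hy i (Or.inr hi)⟩⟩

/-- The number of progressions with a given step and start in a given interval that are `true`. -/
noncomputable def progCount (h c N d : ℕ) (x : ℕ → Bool) : ℝ :=
  ∑ u ∈ Finset.Ico c (c + N), ind (AllTrue (prog h u d)) x

lemma progCount_nonneg (h c N d : ℕ) (x : ℕ → Bool) : 0 ≤ progCount h c N d x :=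
  Finset.sum_nonneg fun _ _ => ind_nonneg _ _

/-- The restriction `h * D ≤ N` keeps every progression within `2 N` positions of the left end of
its zone, so the counts for the zones at `0` and `6 N` are independent. -/
lemma dependsOn_progCount {h c N d D : ℕ} (hd : d ≤ D) (hD : h * D ≤ N) :
    DependsOn (progCount h c N d) ((Finset.Ico c (c + 2 * N) : Finset ℕ) : Set ℕ) := by
  intro x y hxy
  refine Finset.sum_congr rfl fun u hu => ?_
  have h1 : AllTrue (prog h u d) x = AllTrue (prog h u d) y := by
    refine dependsOn_allTrue _ fun i hi => hxy i ?_
    obtain ⟨j, hj, rfl⟩ := Finset.mem_image.1 (Finset.mem_coe.1 hi)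
    have hu := Finset.mem_Ico.1 hu
    have hj := Finset.mem_Icc.1 hj
    have : j * d ≤ h * D := Nat.mul_le_mul hj.2 hd
    simp only [Finset.coe_Ico, Set.mem_Ico]
    omega
  by_cases hx : AllTrue (prog h u d) x
  · rw [ind_of hx, ind_of (h1 ▸ hx)]
  · rw [ind_of_not hx, ind_of_not (h1 ▸ hx)]

lemma finDep_progCount (h c N d : ℕ) : FinDep (progCount h c N d) :=
  FinDep.sum _ fun _ _ => (finDep_allTrue _).ind

lemma IsCoin.expct_progCount (hη : IsCoin P p η) {d : ℕ} (hd : 0 < d) (h c N : ℕ) :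
    expct P η (progCount h c N d) = N * p ^ h := by
  have e : progCount h c N d = fun x =>
      ∑ u ∈ Finset.Ico c (c + N), ind (AllTrue (prog h u d)) x := rfl
  have h1 : ∀ u ∈ Finset.Ico c (c + N), expct P η (ind (AllTrue (prog h u d))) = p ^ h :=
    fun u _ => by rw [hη.expct_ind (finDep_allTrue _), hη.prob_allTrue, card_prog hd]
  rw [e, hη.expct_sum _ fun _ _ => (finDep_allTrue _).ind, Finset.sum_congr rfl h1,
    Finset.sum_const, nsmul_eq_mul, Nat.card_Ico, Nat.add_sub_cancel_left]

lemma IsCoin.expct_progCount_mul_le (hη : IsCoin P p η) {d d' : ℕ} (hd : 0 < d) (hd' : 0 < d')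
    (h c N : ℕ) {B : ℝ} (hB : 0 ≤ B)
    (hBp : ∀ u u', p ^ (prog h u d ∪ prog h u' d').card ≤ B) :
    expct P η (fun x => progCount h c N d x * progCount h c N d' x)
      ≤ (N * p ^ h) ^ 2 + h ^ 2 * N * B := by
  have e : (fun x => progCount h c N d x * progCount h c N d' x) = fun x =>
      ∑ q ∈ Finset.Ico c (c + N) ×ˢ Finset.Ico c (c + N),
        ind (AllTrue (prog h q.1 d ∪ prog h q.2 d')) x := by
    ext x
    rw [progCount, progCount, Finset.sum_mul_sum, Finset.sum_product]
    exact Finset.sum_congr rfl fun u _ => Finset.sum_congr rfl fun u' _ => ind_allTrue_mul _ _ x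
  rw [e, hη.expct_sum _ fun _ _ => (finDep_allTrue _).ind]
  simp only [hη.expct_ind (finDep_allTrue _), hη.prob_allTrue]
  have hp := hη.nonneg
  calc _ ≤ ∑ q ∈ Finset.Ico c (c + N) ×ˢ Finset.Ico c (c + N),
        ((p ^ h) ^ 2 + if ¬ Disjoint (prog h q.1 d) (prog h q.2 d') then B else 0) := by
        refine Finset.sum_le_sum fun q _ => ?_
        by_cases hdis : Disjoint (prog h q.1 d) (prog h q.2 d')
        · rw [Finset.card_union_of_disjoint hdis, card_prog hd, card_prog hd', pow_add]
          simp [hdis, sq]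
        · rw [if_pos hdis]
          have := hBp q.1 q.2
          have h2 : 0 ≤ (p ^ h) ^ 2 := by positivity
          linarith
    _ = N * N * (p ^ h) ^ 2 + ((Finset.Ico c (c + N) ×ˢ Finset.Ico c (c + N)).filter
          fun q => ¬ Disjoint (prog h q.1 d) (prog h q.2 d')).card * B := by
        rw [Finset.sum_add_distrib, ← Finset.sum_filter, Finset.sum_const, Finset.sum_const,
          nsmul_eq_mul, nsmul_eq_mul, Finset.card_product]
        simp
    _ ≤ N * N * (p ^ h) ^ 2 + ((h ^ 2 * N : ℕ) : ℝ) * B := by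
        gcongr
        exact card_meeting_pairs_le h d d' c N
    _ = _ := by push_cast; ring

lemma IsCoin.expct_progCount_mul_le_of_ne (hη : IsCoin P p η) {d d' : ℕ} (hd : 0 < d)
    (hd' : 0 < d') (hne : d ≠ d') (h c N : ℕ) :
    expct P η (fun x => progCount h c N d x * progCount h c N d' x)
      ≤ (N * p ^ h) ^ 2 + h ^ 2 * N * √p ^ (3 * h - 1) := by
  have hsq : √p ^ 2 = p := Real.sq_sqrt hη.nonneg
  refine hη.expct_progCount_mul_le hd hd' h c N (pow_nonneg (Real.sqrt_nonneg p) _)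
    fun u u' => ?_
  have h1 := Finset.card_union_add_card_inter (prog h u d) (prog h u' d')
  have h2 := two_mul_card_inter_prog_le (h := h) (u := u) (u' := u') hd hd' hne
  rw [card_prog hd, card_prog hd'] at h1
  conv_lhs => rw [← hsq, ← pow_mul]
  exact pow_le_pow_of_le_one (Real.sqrt_nonneg p) (Real.sqrt_le_one.2 hη.le_one) (by omega)

lemma IsCoin.expct_progCount_sq_le (hη : IsCoin P p η) {d : ℕ} (hd : 0 < d) (h c N : ℕ) :
    expct P η (fun x => progCount h c N d x * progCount h c N d x)
      ≤ (N * p ^ h) ^ 2 + h ^ 2 * N * p ^ h := by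
  refine hη.expct_progCount_mul_le hd hd h c N (pow_nonneg hη.nonneg _) fun u u' => ?_
  refine pow_le_pow_of_le_one hη.nonneg hη.le_one ?_
  calc h = (prog h u d).card := (card_prog hd h u).symm
    _ ≤ _ := Finset.card_le_card Finset.subset_union_left

/-- Chebyshev's inequality in the form needed to show that a random variable does not vanish. -/
lemma IsCoin.prob_eq_zero_le (hη : IsCoin P p η) {X : (ℕ → Bool) → ℝ} (hX : FinDep X) {M V : ℝ}
    (hM : expct P η X = M) (hM0 : 0 < M) (hV : expct P η (fun x => X x * X x) ≤ V) :
    prob P η (fun x => X x = 0) ≤ (V - M ^ 2) / M ^ 2 := by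
  have hXX : FinDep (fun x => X x * X x) := hX.comp fun y => y * y
  have hXM : FinDep (fun x => X x * (2 * M)) := hX.comp fun y => y * (2 * M)
  have h1 : expct P η (fun x => X x * X x - X x * (2 * M) + M ^ 2) ≤ V - M ^ 2 := by
    rw [hη.expct_add (hXX.comp₂ (· - ·) hXM) (FinDep.const _), hη.expct_sub hXX hXM,
      expct_mul_const, expct_const, hM]
    nlinarith
  have h2 : prob P η (fun x => X x = 0) * M ^ 2 ≤ V - M ^ 2 := by
    rw [← hη.expct_ind (hX.comp (· = 0)), ← expct_mul_const]
    refine le_trans (hη.expct_mono ((hX.comp (· = 0)).ind.comp fun y => y * M ^ 2)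
      ((hXX.comp₂ (· - ·) hXM).comp fun y => y + M ^ 2) fun x => ?_) h1
    by_cases hx : X x = 0
    · rw [ind_of hx, hx]
      simp
    · rw [ind_of_not hx]
      nlinarith [sq_nonneg (X x - M)]
  rwa [le_div_iff₀ (by positivity)]

/-- Modulo `n = 2 (v - u) - d`, twice the step `s = v - u` is congruent to `d`. The progression with
step `s` therefore alternates between the two integer progressions and advances by `d` in each. Two
runs of `h` terms become one of `2 h` terms. -/
lemma hasAP_of_two_progs {h N u v d D : ℕ} (hd : 0 < d) (hdD : d ≤ D) (hD : h * D ≤ N)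
    (hh : 1 ≤ h) (hu : u < N) (hv : 6 * N ≤ v) (hv' : v < 7 * N) {x : ℕ → Bool}
    (hxu : AllTrue (prog h u d) x) (hxv : AllTrue (prog h v d) x) :
    HasAP (2 * (v - u) - d) (2 * h) x := by
  have hdN : d ≤ N := by nlinarith
  set n := 2 * (v - u) - d with hn
  set s := v - u with hs
  have hbound : ∀ j, 1 ≤ j → j ≤ h → j * d ≤ N := fun j _ hj2 =>
    (Nat.mul_le_mul hj2 hdD).trans hD
  have hterm : ∀ j, j < 2 * h → ((u + d) + j * s) % n = if j % 2 = 0 then u + (j / 2 + 1) * d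
      else v + (j / 2 + 1) * d := by
    intro j hj
    have hb := hbound (j / 2 + 1) (by omega) (by omega)
    have h2 : 2 * s = n + d := by omega
    have h3 : j * s = (j / 2) * (2 * s) + (j % 2) * s := by
      conv_lhs => rw [← Nat.div_add_mod j 2]
      ring
    have h4 : (u + d) + j * s = (u + (j / 2 + 1) * d + (j % 2) * s) + n * (j / 2) := by
      rw [h3, h2]; ring
    rw [h4, Nat.add_mul_mod_self_left]
    rcases Nat.mod_two_eq_zero_or_one j with h5 | h5
    · rw [h5, if_pos rfl, zero_mul, add_zero]
      exact Nat.mod_eq_of_lt (by omega)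
    · rw [h5, if_neg one_ne_zero, one_mul]
      have : u + (j / 2 + 1) * d + s = v + (j / 2 + 1) * d := by omega
      rw [this]
      exact Nat.mod_eq_of_lt (by omega)
  refine ⟨u + d, by omega, s, by omega, by omega, ?_, ?_⟩
  · intro k hk hk2 hdvd
    have h1 := hterm k hk2
    obtain ⟨c, hc⟩ := hdvd
    rw [hc, Nat.add_mul_mod_self_left, Nat.mod_eq_of_lt (by omega)] at h1
    have hb := hbound (k / 2 + 1) (by omega) (by omega)
    split_ifs at h1 with h2
    · have h3 : 1 ≤ k / 2 := by omega
      have h4 := Nat.mul_le_mul_right d h3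
      rw [add_mul] at h1
      omega
    · omega
  · intro j hj
    rw [hterm j hj]
    split_ifs
    · exact hxu _ (Finset.mem_image_of_mem (fun j => u + j * d)
        (Finset.mem_Icc.2 ⟨by omega, by omega⟩))
    · exact hxv _ (Finset.mem_image_of_mem (fun j => v + j * d)
        (Finset.mem_Icc.2 ⟨by omega, by omega⟩))

/-- With high probability there is a modulus of order `N` with a progression of `2 * h` terms. -/
theorem IsCoin.prob_forall_not_hasAP_le (hη : IsCoin P p η) (hp : 0 < p) {h N D : ℕ} (hh : 1 ≤ h)
    (hN : 0 < N) (hD0 : 0 < D) (hD : h * D ≤ N) :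
    prob P η (fun x => ∀ n, 9 * N ≤ n → n ≤ 14 * N → ¬ HasAP n (2 * h) x) ≤
      ((1 + (h : ℝ) ^ 2 * √p ^ (3 * h - 1) / (N * (p ^ h) ^ 2)) ^ 2 - 1)
        + (1 + (h : ℝ) ^ 2 / (N * p ^ h)) ^ 2 / D := by
  -- `X` counts triples `(u, v, d)` for which both progressions are `true`. Letting `d` vary
  -- supplies the third power of `N`, up to logarithms, behind the constant `3 / 2`.
  set X : (ℕ → Bool) → ℝ := fun x =>
    ∑ d ∈ Finset.Icc 1 D, progCount h 0 N d x * progCount h (6 * N) N d x with hX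
  have hfd : ∀ d, FinDep fun x => progCount h 0 N d x * progCount h (6 * N) N d x := fun d =>
    (finDep_progCount _ _ _ _).comp₂ (· * ·) (finDep_progCount _ _ _ _)
  have hXf : FinDep X := FinDep.sum _ fun d _ => hfd d
  have hdisj : Disjoint (Finset.Ico 0 (0 + 2 * N)) (Finset.Ico (6 * N) (6 * N + 2 * N)) := by
    rw [Finset.disjoint_left]
    intro i hi hi'
    rw [Finset.mem_Ico] at hi hi'
    omega
  set m : ℝ := N * p ^ h with hm
  have hNpos : (0 : ℝ) < N := by exact_mod_cast hN
  have hm0 : 0 < m := by positivity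
  have hDpos : (0 : ℝ) < D := by exact_mod_cast hD0
  have hEX : expct P η X = D * m ^ 2 := by
    rw [hX, hη.expct_sum _ fun d _ => hfd d]
    have : ∀ d ∈ Finset.Icc 1 D, expct P η (fun x => progCount h 0 N d x *
        progCount h (6 * N) N d x) = m ^ 2 := by
      intro d hd
      have hd := Finset.mem_Icc.1 hd
      rw [hη.expct_mul_of_disjoint (dependsOn_progCount hd.2 hD) (dependsOn_progCount hd.2 hD) hdisj,
        hη.expct_progCount (by omega), hη.expct_progCount (by omega), hm, sq]
    rw [Finset.sum_congr rfl this]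
    simp
  -- In one zone, `a` bounds the mixed moment for two different steps, where progressions share at
  -- most about half of their terms. The larger `b` bounds the second moment for a single step, and
  -- occurs for only `D` of the `D ^ 2` pairs.
  set a : ℝ := m ^ 2 + h ^ 2 * N * √p ^ (3 * h - 1) with ha
  set b : ℝ := m ^ 2 + h ^ 2 * N * p ^ h with hb
  have ha0 : 0 ≤ a := by positivity
  have hb0 : 0 ≤ b := by positivity
  have hEXX : expct P η (fun x => X x * X x) ≤ D ^ 2 * a ^ 2 + D * b ^ 2 := by
    have e : (fun x => X x * X x) = fun x => ∑ d ∈ Finset.Icc 1 D, ∑ d' ∈ Finset.Icc 1 D,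
        (progCount h 0 N d x * progCount h 0 N d' x) *
          (progCount h (6 * N) N d x * progCount h (6 * N) N d' x) := by
      ext x
      rw [hX, Finset.sum_mul_sum]
      exact Finset.sum_congr rfl fun d _ => Finset.sum_congr rfl fun d' _ => by ring
    have hfd2 : ∀ c d d', FinDep fun x => progCount h c N d x * progCount h c N d' x :=
      fun c d d' => (finDep_progCount _ _ _ _).comp₂ (· * ·) (finDep_progCount _ _ _ _)
    have hfd4 : ∀ d d', FinDep fun x => (progCount h 0 N d x * progCount h 0 N d' x) *
          (progCount h (6 * N) N d x * progCount h (6 * N) N d' x) := fun d d' =>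
      (hfd2 0 d d').comp₂ (· * ·) (hfd2 _ d d')
    rw [e, hη.expct_sum _ fun d _ => FinDep.sum _ fun d' _ => hfd4 d d']
    have hterm : ∀ d ∈ Finset.Icc 1 D, ∀ d' ∈ Finset.Icc 1 D,
        expct P η (fun x => (progCount h 0 N d x * progCount h 0 N d' x) *
          (progCount h (6 * N) N d x * progCount h (6 * N) N d' x)) ≤
        a ^ 2 + if d' = d then b ^ 2 else 0 := by
      intro d hd d' hd'
      have hd := Finset.mem_Icc.1 hd
      have hd' := Finset.mem_Icc.1 hd'
      have hdep : ∀ c, DependsOn (fun x => progCount h c N d x * progCount h c N d' x)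
          ((Finset.Ico c (c + 2 * N) : Finset ℕ) : Set ℕ) := fun c => by
        have := DependsOn.comp₂ (· * ·) (dependsOn_progCount (c := c) hd.2 hD)
          (dependsOn_progCount (c := c) hd'.2 hD)
        rwa [Set.union_self] at this
      rw [hη.expct_mul_of_disjoint (hdep 0) (hdep (6 * N)) hdisj]
      have hnn : ∀ c, 0 ≤ expct P η (fun x => progCount h c N d x * progCount h c N d' x) :=
        fun c => expct_nonneg fun x => mul_nonneg (progCount_nonneg _ _ _ _ _)
          (progCount_nonneg _ _ _ _ _)
      by_cases hdd : d' = d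
      · subst hdd
        rw [if_pos rfl]
        have h1 := mul_le_mul (hη.expct_progCount_sq_le (d := d') (by omega) h 0 N)
          (hη.expct_progCount_sq_le (d := d') (by omega) h (6 * N) N) (hnn _) hb0
        have h2 : 0 ≤ a ^ 2 := by positivity
        calc _ ≤ b * b := h1
          _ ≤ _ := by rw [sq b]; linarith
      · rw [if_neg hdd, add_zero, sq]
        exact mul_le_mul
          (hη.expct_progCount_mul_le_of_ne (by omega) (by omega) (Ne.symm hdd) h 0 N)
          (hη.expct_progCount_mul_le_of_ne (by omega) (by omega) (Ne.symm hdd) h (6 * N) N)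
          (hnn _) ha0
    calc _ ≤ ∑ d ∈ Finset.Icc 1 D, ∑ d' ∈ Finset.Icc 1 D,
          (a ^ 2 + if d' = d then b ^ 2 else 0) := by
          refine Finset.sum_le_sum fun d hd => ?_
          rw [hη.expct_sum _ fun d' _ => hfd4 d d']
          exact Finset.sum_le_sum fun d' hd' => hterm d hd d' hd'
      _ = D ^ 2 * a ^ 2 + D * b ^ 2 := by
          have : ∀ d ∈ Finset.Icc 1 D, ∑ d' ∈ Finset.Icc 1 D,
              (a ^ 2 + if d' = d then b ^ 2 else 0) = D * a ^ 2 + b ^ 2 := by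
            intro d hd
            rw [Finset.sum_add_distrib, Finset.sum_ite_eq' , if_pos hd]
            simp
          rw [Finset.sum_congr rfl this]
          simp
          ring
  have hmono : prob P η (fun x => ∀ n, 9 * N ≤ n → n ≤ 14 * N → ¬ HasAP n (2 * h) x) ≤
      prob P η (fun x => X x = 0) := by
    refine prob_mono fun x hx => Finset.sum_eq_zero fun d hd => ?_
    have hd := Finset.mem_Icc.1 hd
    rw [progCount, progCount, Finset.sum_mul_sum]
    refine Finset.sum_eq_zero fun u hu => Finset.sum_eq_zero fun v hv => ?_
    have hu := Finset.mem_Ico.1 hu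
    have hv := Finset.mem_Ico.1 hv
    have hdN : d ≤ N := by nlinarith
    by_cases h1 : AllTrue (prog h u d) x
    · by_cases h2 : AllTrue (prog h v d) x
      · exact absurd (hasAP_of_two_progs (by omega) hd.2 hD hh (by omega) hv.1 (by omega) h1 h2)
          (hx _ (by omega) (by omega))
      · rw [ind_of_not h2, mul_zero]
    · rw [ind_of_not h1, zero_mul]
  refine hmono.trans ((hη.prob_eq_zero_le hXf hEX (by positivity) hEXX).trans (le_of_eq ?_))
  have e1 : a = m ^ 2 * (1 + (h : ℝ) ^ 2 * √p ^ (3 * h - 1) / (N * (p ^ h) ^ 2)) := by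
    rw [ha, hm]; field_simp
  have e2 : b = m ^ 2 * (1 + (h : ℝ) ^ 2 / m) := by
    rw [hb, hm]; field_simp
  rw [e1, e2]
  field_simp
  ring

end IntegerProgressions

/-! ### The constants `C` and `D` -/

section Constants

variable {p : ℝ}

/-- The constant `C` is defined so that `p ^ (C log n) = n ^ (-2)`. The intensity thus depends only
on the distance of `r` from `C log n`. -/
lemma sq_mul_pow_eq_rpow (hp0 : 0 < p) (hp1 : p < 1) {n : ℕ} (hn : 1 ≤ n) (r : ℕ) :
    (n : ℝ) ^ 2 * p ^ r = p ^ ((r : ℝ) - C p * Real.log n) := by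
  have hn' : (0 : ℝ) < n := by exact_mod_cast hn
  have hl : Real.log p ≠ 0 := (Real.log_neg hp0 hp1).ne
  rw [Real.rpow_sub hp0, Real.rpow_natCast]
  have : p ^ (C p * Real.log n) = ((n : ℝ) ^ 2)⁻¹ := by
    rw [Real.rpow_def_of_pos hp0, C, ← Real.exp_log (by positivity : (0 : ℝ) < ((n : ℝ) ^ 2)⁻¹),
      Real.log_inv, Real.log_pow]
    congr 1
    push_cast
    field_simp
  rw [this, div_inv_eq_mul, mul_comm]

lemma rpow_D_mul (hp0 : 0 < p) (hp1 : p < 1) (y : ℝ) : p ^ (D p * y) = Real.exp y := by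
  have hl : Real.log p ≠ 0 := (Real.log_neg hp0 hp1).ne
  rw [Real.rpow_def_of_pos hp0, D]
  congr 1
  field_simp

lemma C_eq_neg_two_mul_D (p : ℝ) : C p = -2 * D p := by
  simp only [C, D]; ring

lemma D_neg (hp0 : 0 < p) (hp1 : p < 1) : D p < 0 :=
  div_neg_of_pos_of_neg one_pos (Real.log_neg hp0 hp1)

lemma C_pos (hp0 : 0 < p) (hp1 : p < 1) : 0 < C p := by
  rw [C_eq_neg_two_mul_D]
  linarith [D_neg hp0 hp1]

lemma log_two_le_log {n : ℕ} (hn : 2 ≤ n) : Real.log 2 ≤ Real.log n :=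
  Real.log_le_log (by norm_num) (by exact_mod_cast hn)

/-- A term of the sequence `n ^ 2 * p ^ r` just below a given level. -/
lemma exists_level (hp0 : 0 < p) (hp1 : p < 1) {x t : ℝ} (ht : 0 < t) {r : ℕ} (hr : t < x * p ^ r) :
    ∃ r', r < r' ∧ x * p ^ r' ≤ t ∧ p * t < x * p ^ r' := by
  classical
  have hex : ∃ k, x * p ^ k ≤ t := by
    have h := (tendsto_pow_atTop_nhds_zero_of_lt_one hp0.le hp1).const_mul x
    rw [mul_zero] at h
    exact (h.eventually (eventually_le_nhds ht)).exists
  have hx : 0 < x := by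
    have := ht.trans hr
    exact pos_of_mul_pos_left this (by positivity)
  have hlt : r < Nat.find hex := by
    by_contra h
    have h1 := Nat.find_spec hex
    have h2 : p ^ r ≤ p ^ Nat.find hex := pow_le_pow_of_le_one hp0.le hp1.le (not_lt.1 h)
    nlinarith
  refine ⟨Nat.find hex, hlt, Nat.find_spec hex, ?_⟩
  have h3 := Nat.find_min hex (Nat.sub_lt (by omega : 0 < Nat.find hex) one_pos)
  have h4 : p ^ Nat.find hex = p * p ^ (Nat.find hex - 1) := by
    rw [← pow_succ', Nat.sub_add_cancel (by omega)]
  rw [h4]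
  rw [not_le] at h3
  nlinarith

end Constants

/-! ### Uniform absolute and relative error bounds -/

section ErrorBound

variable {p : ℝ}

/-- The factor in front of `log n` in the size of the relevant lengths and intensities. -/
noncomputable def logFactor (p A : ℝ) : ℝ := A + 3 / (-Real.log p) + 2 / Real.log 2

/-- The summand `A` dominates the intensity, `3 / (-log p)` dominates the length, and `2 / log 2`
contributes at least 2 for every `n ≥ 2`, absorbing the additive constants. -/
lemma logFactor_spec (hp0 : 0 < p) (hp1 : p < 1) {A : ℝ} (hA : 0 ≤ A) {n : ℕ} (hn : 2 ≤ n) :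
    0 ≤ logFactor p A ∧ 1 ≤ logFactor p A * Real.log n ∧ A * Real.log n ≤ logFactor p A * Real.log n
      ∧ ∀ r : ℕ, (r : ℝ) ≤ 3 / (-Real.log p) * Real.log n →
        (r : ℝ) + 1 ≤ logFactor p A * Real.log n := by
  have hl := Real.log_neg hp0 hp1
  have h2 : 0 < Real.log 2 := Real.log_pos (by norm_num)
  have hn2 := log_two_le_log hn
  have h3 : 0 ≤ 3 / (-Real.log p) := div_nonneg (by norm_num) (by linarith)
  have h4 : 2 / Real.log 2 * Real.log 2 = 2 := by field_simp
  have h5 : 2 ≤ 2 / Real.log 2 * Real.log n := by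
    have := mul_le_mul_of_nonneg_left hn2 (by positivity : 0 ≤ 2 / Real.log 2)
    linarith
  have hlog : 0 ≤ Real.log n := by linarith
  have h6 : 0 ≤ 3 / (-Real.log p) * Real.log n := mul_nonneg h3 hlog
  have h7 : 0 ≤ A * Real.log n := mul_nonneg hA hlog
  have e : logFactor p A * Real.log n = A * Real.log n + 3 / (-Real.log p) * Real.log n
      + 2 / Real.log 2 * Real.log n := by rw [logFactor]; ring
  refine ⟨by unfold logFactor; positivity, ?_, ?_, fun r hr => ?_⟩ <;> rw [e] <;> linarith

lemma sq_mul_pow_le_inv (hp0 : 0 < p) (hp1 : p < 1) {n : ℕ} (hn : 1 ≤ n) {r : ℕ}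
    (hr : 3 / (-Real.log p) * Real.log n ≤ r) : (n : ℝ) ^ 2 * p ^ r ≤ 1 / (n : ℝ) := by
  have hl := Real.log_neg hp0 hp1
  have hn' : (0 : ℝ) < n := by exact_mod_cast hn
  have h1 : 3 * Real.log n ≤ r * -Real.log p := by
    have := mul_le_mul_of_nonneg_right hr (by linarith : 0 ≤ -Real.log p)
    have e : 3 / (-Real.log p) * Real.log n * -Real.log p = 3 * Real.log n := by
      rw [mul_right_comm, div_mul_cancel₀ _ (neg_ne_zero.2 hl.ne)]
    linarith
  have h2 : p ^ r ≤ ((n : ℝ) ^ 3)⁻¹ := by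
    rw [← Real.log_le_log_iff (by positivity) (by positivity), Real.log_pow, Real.log_inv,
      Real.log_pow]
    push_cast
    linarith
  refine (mul_le_mul_of_nonneg_left h2 (by positivity)).trans (le_of_eq ?_)
  field_simp

set_option maxHeartbeats 400000 in
/-- The Poisson approximation with an error of order `log n ^ 7 / n`, uniformly in `r`. -/
theorem exists_poisson_error_bound (hp0 : 0 < p) (hp1 : p < 1) : ∃ K : ℝ, 0 ≤ K ∧
    ∀ (n r : ℕ), 2 ≤ n → 1 < r → ∀ (Ω : Type*) [MeasurableSpace Ω] (P : Measure Ω)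
      [IsProbabilityMeasure P] (η : ℕ → Ω → Bool), IsCoin P p η →
        |prob P η (fun x => ¬ HasAP n r x) - Real.exp (-((1 - p) * (n : ℝ) ^ 2 * p ^ r / 2))|
          ≤ K * (Real.log n ^ 7 / n) := by
  have hq : 0 < 1 - p := by linarith
  have h2 : 0 < Real.log 2 := Real.log_pos (by norm_num)
  have h2' : 0.69 < Real.log 2 := by have := Real.log_two_gt_d9; linarith
  -- With this choice, an intensity `n ^ 2 * p ^ r` of at least `p * A * log n` makes the Poisson
  -- term at most `1 / n`.
  set A : ℝ := 2 / ((1 - p) * p) with hA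
  have hA0 : 0 < A := by positivity
  set c := logFactor p A with hc
  have hc0 : 0 ≤ c := (logFactor_spec hp0 hp1 hA0.le le_rfl).1
  set K₁ : ℝ := 30 / p * c ^ 7 with hK₁
  set K₂ : ℝ := 1 / Real.log 2 ^ 7 with hK₂
  have hK₁0 : 0 ≤ K₁ := by positivity
  have hK₂0 : 0 < K₂ := by positivity
  refine ⟨K₁ + (2 + A / p ^ 2) * K₂, by positivity, ?_⟩
  intro n r hn hr Ω _ P _ η hη
  have hn' : (0 : ℝ) < n := by exact_mod_cast (by omega : 0 < n)
  have hn1 : (1 : ℝ) ≤ n := by exact_mod_cast (by omega : 1 ≤ n)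
  have hlog2 := log_two_le_log hn
  have hlog : 0 < Real.log n := by linarith
  have hlogn : Real.log n ≤ n := (Real.log_le_sub_one_of_pos hn').trans (by linarith)
  have hone : 1 ≤ K₂ * Real.log n ^ 7 := by
    rw [hK₂, one_div_mul_eq_div, one_le_div (by positivity)]
    exact pow_le_pow_left₀ h2.le hlog2 7
  have hinv : 1 / (n : ℝ) ≤ K₂ * (Real.log n ^ 7 / n) := by
    rw [← mul_div_assoc]
    exact div_le_div_of_nonneg_right hone hn'.le
  have hE0 : 0 ≤ Real.log n ^ 7 / n := by positivity
  have hexp : K₁ * (Real.log n ^ 7 / n) + 2 * (K₂ * (Real.log n ^ 7 / n))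
      + A / p ^ 2 * (K₂ * (Real.log n ^ 7 / n))
      = (K₁ + (2 + A / p ^ 2) * K₂) * (Real.log n ^ 7 / n) := by ring
  have n1 : 0 ≤ K₁ * (Real.log n ^ 7 / n) := by positivity
  have n2 : 0 ≤ K₂ * (Real.log n ^ 7 / n) := by positivity
  have n3 : 0 ≤ A / p ^ 2 * (K₂ * (Real.log n ^ 7 / n)) := by positivity
  rw [← hexp]
  have hprob0 := prob_nonneg (P := P) (η := η) (fun x => ¬ HasAP n r x)
  have hprob1 := prob_le_one (P := P) (η := η) (fun x => ¬ HasAP n r x)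
  set v := (1 - p) * (n : ℝ) ^ 2 * p ^ r / 2 with hv
  have hv0 : 0 ≤ v := by positivity
  have hexp0 := Real.exp_pos (-v)
  have hexp1 : Real.exp (-v) ≤ 1 := Real.exp_le_one_iff.2 (by linarith)
  have hmain : ∀ r : ℕ, 3 ≤ r → (r : ℝ) ≤ 3 / (-Real.log p) * Real.log n →
      (n : ℝ) ^ 2 * p ^ r ≤ A * Real.log n →
      |prob P η (fun x => ¬ HasAP n r x) - Real.exp (-((1 - p) * (n : ℝ) ^ 2 * p ^ r / 2))|
        ≤ K₁ * (Real.log n ^ 7 / n) := by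
    intro r hr3 hr hμ
    obtain ⟨-, hL1, hLA, hLr⟩ := logFactor_spec hp0 hp1 hA0.le hn
    have := hη.abs_prob_not_hasAP_sub_le hp0 (by omega) hr3 hL1 (hLr r hr) (hμ.trans hLA)
    refine this.trans (le_of_eq ?_)
    rw [hK₁, mul_pow]
    ring
  -- There are three regimes. For very large `r`, both quantities are within `1 / n` of 1. For
  -- intensity at most `A log n` the Poisson estimate applies. For larger intensity both quantities
  -- are small.
  rcases le_or_gt (3 / (-Real.log p) * Real.log n) (r : ℝ) with hbig | hsmall
  · have h3 := sq_mul_pow_le_inv hp0 hp1 (by omega : 1 ≤ n) hbig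
    have h4 : prob P η (fun x => ¬ HasAP n r x) = 1 - prob P η (HasAP n r) :=
      hη.prob_not ⟨_, dependsOn_hasAP (by omega) r⟩
    have h5 := hη.prob_hasAP_le n r
    have h6 := Real.add_one_le_exp (-v)
    have h7 : v ≤ 1 / n := by
      have : v = (1 - p) / 2 * ((n : ℝ) ^ 2 * p ^ r) := by rw [hv]; ring
      rw [this]
      have h8 : 0 ≤ (n : ℝ) ^ 2 * p ^ r := by positivity
      exact (mul_le_of_le_one_left h8 (by linarith)).trans h3
    rw [abs_le]
    constructor <;> linarith [prob_nonneg (P := P) (η := η) (HasAP n r)]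
  · rcases le_or_gt ((n : ℝ) ^ 2 * p ^ r) (A * Real.log n) with hμ | hμ
    · rcases Nat.lt_or_ge r 3 with hr3 | hr3
      · obtain rfl : r = 2 := by omega
        have h3 : (n : ℝ) ≤ A / p ^ 2 := by
          rw [le_div_iff₀ (by positivity)]
          have : (n : ℝ) * (n * p ^ 2) ≤ n * A := by
            have := mul_le_mul_of_nonneg_left hlogn hA0.le
            linarith
          exact le_of_mul_le_mul_left this hn'
        have h4 : 1 ≤ A / p ^ 2 * (K₂ * (Real.log n ^ 7 / n)) := by
          have : A / p ^ 2 * (K₂ * (Real.log n ^ 7 / n)) =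
              (A / p ^ 2) / n * (K₂ * Real.log n ^ 7) := by ring
          rw [this]
          exact one_le_mul_of_one_le_of_one_le ((one_le_div hn').2 h3) hone
        rw [abs_le]
        constructor <;> linarith
      · exact (hmain r hr3 hsmall.le hμ).trans (by linarith)
    · obtain ⟨r', hrr', hμ', hμ''⟩ := exists_level hp0 hp1 (by positivity) hμ
      have hr'3 : 3 ≤ r' := by omega
      have hqA : (1 - p) * (p * (A * Real.log n)) = 2 * Real.log n := by
        rw [hA]; field_simp
      have hr's : (r' : ℝ) ≤ 3 / (-Real.log p) * Real.log n := by
        by_contra h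
        have h3 := sq_mul_pow_le_inv hp0 hp1 (by omega : 1 ≤ n) (not_le.1 h).le
        have h4 : 1 / (n : ℝ) ≤ 1 := by rw [div_le_one hn']; exact hn1
        have h5 : (1 - p) * (p * (A * Real.log n)) ≤ p * (A * Real.log n) := by
          exact mul_le_of_le_one_left (by positivity) (by linarith)
        linarith
      have h3 := (abs_le.1 (hmain r' hr'3 hr's hμ')).2
      have h4 : prob P η (fun x => ¬ HasAP n r x) ≤ prob P η (fun x => ¬ HasAP n r' x) :=
        prob_mono fun x hx h => hx (h.mono hrr'.le)
      have hexpn : Real.exp (-Real.log n) = 1 / n := by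
        rw [Real.exp_neg, Real.exp_log hn', one_div]
      have h5 : Real.exp (-((1 - p) * (n : ℝ) ^ 2 * p ^ r' / 2)) ≤ 1 / n := by
        rw [← hexpn]
        apply Real.exp_le_exp.2
        have := mul_le_mul_of_nonneg_left hμ''.le hq.le
        linarith
      have h6 : Real.exp (-v) ≤ 1 / n := by
        rw [← hexpn]
        apply Real.exp_le_exp.2
        have h7 : p * (A * Real.log n) ≤ (n : ℝ) ^ 2 * p ^ r := by
          refine le_trans ?_ hμ.le
          exact mul_le_of_le_one_left (by positivity) hp1.le
        have := mul_le_mul_of_nonneg_left h7 hq.le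
        rw [hv]
        linarith
      rw [abs_le]
      constructor <;> linarith

/-- The relative form of the Poisson approximation. -/
theorem exists_relative_error_bound (hp0 : 0 < p) (hp1 : p < 1) {K : ℝ} (hK0 : 0 ≤ K) (a : ℝ) :
    ∃ K' : ℝ, ∀ (Ω : Type*) [MeasurableSpace Ω] (P : Measure Ω) [IsProbabilityMeasure P]
      (ξ : ℕ → Ω → ℝ), IsCoin P p (bit ξ) →
      (∀ n r : ℕ, 2 ≤ n → 1 < r →
        |prob P (bit ξ) (fun x => ¬ HasAP n r x) - Real.exp (-((1 - p) * (n : ℝ) ^ 2 * p ^ r / 2))|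
          ≤ K * (Real.log n ^ 7 / n)) →
      ∀ n : ℕ, 2 ≤ n → ∀ x : ℝ, D p * Real.log (Real.log n) + a ≤ x →
        (∃ z : ℤ, C p * Real.log n + x = z) →
          |Real.exp ((1 - p) / 2 * p ^ x) *
              P.real {ω | (W ξ n ω : ℝ) < C p * Real.log n + x} - 1|
            ≤ K' * (Real.log n ^ 7 / (n : ℝ) ^ (1 - (1 - p) * p ^ a / 2)) := by
  have hq : 0 < 1 - p := by linarith
  have h2 : 0 < Real.log 2 := Real.log_pos (by norm_num)
  set K₂ : ℝ := 1 / Real.log 2 ^ 7 with hK₂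
  have hK₂0 : 0 < K₂ := by positivity
  have hDneg := D_neg hp0 hp1
  -- If the level `C log n + x` is at most 1, then `C = -2 D` and `log (log n) ≤ log n` give `-D log
  -- n ≤ 1 - a`, that is `n ≤ M`. These finitely many `n` are covered by the constant.
  set M : ℝ := Real.exp ((1 - a) / (-D p)) with hM
  refine ⟨K + 2 * M * K₂, ?_⟩
  intro Ω _ P _ ξ hη hbound n hn x hx ⟨z, hz⟩
  have hn' : (0 : ℝ) < n := by exact_mod_cast (by omega : 0 < n)
  have hlog2 := log_two_le_log hn
  have hlog : 0 < Real.log n := by linarith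
  have hone : 1 ≤ K₂ * Real.log n ^ 7 := by
    rw [hK₂, one_div_mul_eq_div, one_le_div (by positivity)]
    exact pow_le_pow_left₀ h2.le hlog2 7
  set y := (1 - p) / 2 * p ^ x with hy
  have hpx : 0 < p ^ x := Real.rpow_pos_of_pos hp0 x
  have hy0 : 0 ≤ y := by positivity
  set R : ℝ := (n : ℝ) ^ ((1 - p) * p ^ a / 2) with hR
  have hR0 : 0 < R := Real.rpow_pos_of_pos hn' _
  -- By `p ^ (D log log n) = log n`, the hypothesis on `x` gives `p ^ x ≤ p ^ a * log n`. This is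
  -- the source of the power of `n` lost in the relative error.
  have hey : Real.exp y ≤ R := by
    have h3 : p ^ x ≤ Real.log n * p ^ a := by
      calc p ^ x ≤ p ^ (D p * Real.log (Real.log n) + a) :=
            Real.rpow_le_rpow_of_exponent_ge hp0 hp1.le hx
        _ = Real.log n * p ^ a := by
            rw [Real.rpow_add hp0, rpow_D_mul hp0 hp1, Real.exp_log hlog]
    rw [hR, Real.rpow_def_of_pos hn']
    apply Real.exp_le_exp.2
    rw [hy]
    have := mul_le_mul_of_nonneg_left h3 (by linarith : 0 ≤ (1 - p) / 2)
    linarith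
  have hRHS : Real.log n ^ 7 / (n : ℝ) ^ (1 - (1 - p) * p ^ a / 2) = Real.log n ^ 7 / n * R := by
    rw [Real.rpow_sub hn', Real.rpow_one, ← hR]
    field_simp
  rw [hRHS]
  have hE0 : 0 ≤ Real.log n ^ 7 / n := by positivity
  have hM0 : 0 < M := Real.exp_pos _
  have hsplit : (K + 2 * M * K₂) * (Real.log n ^ 7 / n * R) =
      R * (K * (Real.log n ^ 7 / n)) + 2 * M * (K₂ * Real.log n ^ 7) / n * R := by ring
  rw [hsplit]
  have s1 : 0 ≤ R * (K * (Real.log n ^ 7 / n)) := by positivity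
  have s2 : 0 ≤ 2 * M * (K₂ * Real.log n ^ 7) / n * R := by positivity
  rw [hz]
  rcases le_or_gt z 1 with hz1 | hz1
  · have hnM : (n : ℝ) ≤ M := by
      rw [← Real.log_le_log_iff hn' hM0, hM, Real.log_exp, le_div_iff₀ (by linarith)]
      have h3 : (z : ℝ) ≤ 1 := by exact_mod_cast hz1
      rw [C_eq_neg_two_mul_D] at hz
      have h4 : Real.log (Real.log n) ≤ Real.log n :=
        (Real.log_le_sub_one_of_pos hlog).trans (by linarith)
      nlinarith
    have h5 : 1 ≤ M * (K₂ * Real.log n ^ 7) / n := by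
      rw [le_div_iff₀ hn']
      nlinarith
    have h6 : 2 * R ≤ 2 * M * (K₂ * Real.log n ^ 7) / n * R := by
      have : 2 * M * (K₂ * Real.log n ^ 7) / n * R = 2 * (M * (K₂ * Real.log n ^ 7) / n) * R := by
        ring
      rw [this]
      nlinarith
    have h7 : 0 ≤ P.real {ω | (W ξ n ω : ℝ) < z} := measureReal_nonneg
    have h8 : P.real {ω | (W ξ n ω : ℝ) < z} ≤ 1 := measureReal_le_one
    have h9 : 1 ≤ Real.exp y := Real.one_le_exp hy0
    have h10 : Real.exp y * P.real {ω | (W ξ n ω : ℝ) < z} ≤ Real.exp y := by nlinarith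
    have h11 : 0 ≤ Real.exp y * P.real {ω | (W ξ n ω : ℝ) < z} := by positivity
    rw [abs_le]
    constructor <;> linarith
  · obtain ⟨r, rfl⟩ := Int.eq_ofNat_of_zero_le (by omega : 0 ≤ z)
    have hr : 1 < r := by exact_mod_cast hz1
    have hset : {ω | (W ξ n ω : ℝ) < ((r : ℤ) : ℝ)} = {ω | W ξ n ω < r} := by
      ext ω
      simp
    rw [hset, real_W_lt (by omega) (by omega)]
    have hyr : (1 - p) * (n : ℝ) ^ 2 * p ^ r / 2 = y := by
      have : (n : ℝ) ^ 2 * p ^ r = p ^ x := by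
        rw [sq_mul_pow_eq_rpow hp0 hp1 (by omega)]
        congr 1
        have : ((r : ℤ) : ℝ) = (r : ℝ) := by simp
        rw [this] at hz
        linarith
      rw [hy, ← this]; ring
    have hb := hbound n r hn hr
    rw [hyr] at hb
    have e : Real.exp y * prob P (bit ξ) (fun x => ¬ HasAP n r x) - 1 =
        Real.exp y * (prob P (bit ξ) (fun x => ¬ HasAP n r x) - Real.exp (-y)) := by
      rw [mul_sub, ← Real.exp_add, add_neg_cancel, Real.exp_zero]
    rw [e, abs_mul, abs_of_pos (Real.exp_pos y)]
    have := mul_le_mul hey hb (abs_nonneg _) hR0.le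
    linarith

end ErrorBound

/-! ### Limits of logarithms; limsup and liminf in the extended reals -/

section Limits

lemma tendsto_log_nat : Tendsto (fun n : ℕ => Real.log n) atTop atTop :=
  Real.tendsto_log_atTop.comp tendsto_natCast_atTop_atTop

lemma tendsto_log_log_nat : Tendsto (fun n : ℕ => Real.log (Real.log n)) atTop atTop :=
  Real.tendsto_log_atTop.comp tendsto_log_nat

lemma tendsto_log_pow_mul_rpow_neg (k : ℕ) {s : ℝ} (hs : 0 < s) :
    Tendsto (fun x : ℝ => Real.log x ^ k * x ^ (-s)) atTop (𝓝 0) := by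
  have h := (isLittleO_log_rpow_rpow_atTop (k : ℝ) hs).tendsto_div_nhds_zero
  refine h.congr' ?_
  filter_upwards [eventually_gt_atTop 0] with x hx
  rw [Real.rpow_natCast, Real.rpow_neg hx.le, div_eq_mul_inv]

lemma tendsto_log_pow_div_nat (k : ℕ) : Tendsto (fun n : ℕ => Real.log n ^ k / n) atTop (𝓝 0) := by
  refine ((tendsto_log_pow_mul_rpow_neg k one_pos).comp tendsto_natCast_atTop_atTop).congr ?_
  intro n
  simp [Real.rpow_neg_one, div_eq_mul_inv]

lemma summable_of_tendsto_mul_rpow {f : ℕ → ℝ} {s : ℝ} (hs : 1 < s) (hf : ∀ᶠ n in atTop, 0 ≤ f n)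
    (h : Tendsto (fun n : ℕ => f n * (n : ℝ) ^ s) atTop (𝓝 0)) : Summable f := by
  refine Summable.of_norm_bounded_eventually_nat
    (Real.summable_nat_rpow.2 (by linarith : -s < -1)) ?_
  filter_upwards [h.eventually (eventually_le_nhds one_pos), hf, eventually_gt_atTop 0]
    with n h1 h2 h3
  have hn : (0 : ℝ) < n := by exact_mod_cast h3
  rw [Real.norm_of_nonneg h2, Real.rpow_neg hn.le]
  rwa [← one_div, le_div_iff₀ (Real.rpow_pos_of_pos hn _)]

lemma limsup_coe_eq {u : ℕ → ℝ} {c : ℝ} (h1 : ∀ ε > 0, ∀ᶠ n in atTop, u n ≤ c + ε)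
    (h2 : ∀ ε > 0, ∃ᶠ n in atTop, c - ε ≤ u n) :
    limsup (fun n => (u n : EReal)) atTop = (c : EReal) := by
  apply le_antisymm
  · refine EReal.le_of_forall_lt_iff_le.1 fun z hz => ?_
    refine limsup_le_of_le (by isBoundedDefault) ?_
    filter_upwards [h1 (z - c) (sub_pos.2 (EReal.coe_lt_coe_iff.1 hz))] with n hn
    exact EReal.coe_le_coe_iff.2 (by linarith)
  · refine EReal.ge_of_forall_gt_iff_ge.1 fun z hz => ?_
    refine le_limsup_of_frequently_le ?_ (by isBoundedDefault)
    refine (h2 (c - z) (sub_pos.2 (EReal.coe_lt_coe_iff.1 hz))).mono fun n hn => ?_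
    exact EReal.coe_le_coe_iff.2 (by linarith)

lemma liminf_coe_eq {u : ℕ → ℝ} {c : ℝ} (h1 : ∀ ε > 0, ∀ᶠ n in atTop, c - ε ≤ u n)
    (h2 : ∀ ε > 0, ∃ᶠ n in atTop, u n ≤ c + ε) :
    liminf (fun n => (u n : EReal)) atTop = (c : EReal) := by
  apply le_antisymm
  · refine EReal.le_of_forall_lt_iff_le.1 fun z hz => ?_
    refine liminf_le_of_frequently_le ?_ (by isBoundedDefault)
    refine (h2 (z - c) (sub_pos.2 (EReal.coe_lt_coe_iff.1 hz))).mono fun n hn => ?_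
    exact EReal.coe_le_coe_iff.2 (by linarith)
  · refine EReal.ge_of_forall_gt_iff_ge.1 fun z hz => ?_
    refine le_liminf_of_le (by isBoundedDefault) ?_
    filter_upwards [h1 (c - z) (sub_pos.2 (EReal.coe_lt_coe_iff.1 hz))] with n hn
    exact EReal.coe_le_coe_iff.2 (by linarith)

end Limits

/-! ### Borel–Cantelli type criteria -/

section AlmostSure

variable {Ω : Type*} [MeasurableSpace Ω] {P : Measure Ω} [IsProbabilityMeasure P]

lemma ae_eventually_notMem_of_real_le {s : ℕ → Set Ω} {f : ℕ → ℝ} (hf : Summable f)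
    (h : ∀ᶠ n in atTop, P.real (s n) ≤ f n) : ∀ᵐ ω ∂P, ∀ᶠ n in atTop, ω ∉ s n := by
  have hs : Summable fun n => P.real (s n) := by
    refine Summable.of_norm_bounded_eventually_nat hf ?_
    filter_upwards [h] with n hn
    rwa [Real.norm_of_nonneg measureReal_nonneg]
  apply ae_eventually_notMem
  have := hs.tsum_ofReal_ne_top
  simpa [ofReal_measureReal] using this

/-- If no `A n` with `n ≥ N` occurs, then every window `T J` with large `J` is missed entirely, and
this has probability tending to 0. No independence is required. -/
lemma ae_frequently_mem {A : ℕ → Set Ω} {T : ℕ → Set ℕ} {e : ℕ → ℝ}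
    (hT : ∀ N, ∀ᶠ J in atTop, ∀ n ∈ T J, N ≤ n) (he : Tendsto e atTop (𝓝 0))
    (h : ∀ᶠ J in atTop, P.real {ω | ∀ n ∈ T J, ω ∉ A n} ≤ e J) :
    ∀ᵐ ω ∂P, ∃ᶠ n in atTop, ω ∈ A n := by
  have key : ∀ N, ∀ᵐ ω ∂P, ∃ n ≥ N, ω ∈ A n := by
    intro N
    have h0 : P.real {ω | ¬ ∃ n ≥ N, ω ∈ A n} ≤ 0 := by
      refine ge_of_tendsto he ?_
      filter_upwards [hT N, h] with J h1 h2
      refine le_trans (measureReal_mono ?_) h2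
      intro ω hω n hn hA
      exact hω ⟨n, h1 n hn, hA⟩
    rw [ae_iff]
    exact (measureReal_eq_zero_iff).1 (le_antisymm h0 measureReal_nonneg)
  filter_upwards [ae_all_iff.2 key] with ω hω
  exact frequently_atTop.2 hω

lemma ae_forall_pos {Q : ℝ → Ω → Prop} (hQ : ∀ ε δ ω, ε ≤ δ → Q ε ω → Q δ ω)
    (h : ∀ ε > 0, ∀ᵐ ω ∂P, Q ε ω) : ∀ᵐ ω ∂P, ∀ ε > 0, Q ε ω := by
  have := ae_all_iff.2 fun j : ℕ => h (1 / (j + 1)) (by positivity)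
  filter_upwards [this] with ω hω ε hε
  obtain ⟨j, hj⟩ := exists_nat_one_div_lt hε
  exact hQ _ _ _ hj.le (hω j)

lemma ae_limsup_coe_eq {u : ℕ → Ω → ℝ} {c : ℝ}
    (h1 : ∀ ε > 0, ∀ᵐ ω ∂P, ∀ᶠ n in atTop, u n ω ≤ c + ε)
    (h2 : ∀ ε > 0, ∀ᵐ ω ∂P, ∃ᶠ n in atTop, c - ε ≤ u n ω) :
    ∀ᵐ ω ∂P, limsup (fun n => (u n ω : EReal)) atTop = (c : EReal) := by
  filter_upwards [ae_forall_pos (fun ε δ ω hεδ h => h.mono fun n hn => by linarith) h1,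
    ae_forall_pos (fun ε δ ω hεδ h => h.mono fun n hn => by linarith) h2] with ω h3 h4
  exact limsup_coe_eq h3 h4

lemma ae_liminf_coe_eq {u : ℕ → Ω → ℝ} {c : ℝ}
    (h1 : ∀ ε > 0, ∀ᵐ ω ∂P, ∀ᶠ n in atTop, c - ε ≤ u n ω)
    (h2 : ∀ ε > 0, ∀ᵐ ω ∂P, ∃ᶠ n in atTop, u n ω ≤ c + ε) :
    ∀ᵐ ω ∂P, liminf (fun n => (u n ω : EReal)) atTop = (c : EReal) := by
  filter_upwards [ae_forall_pos (fun ε δ ω hεδ h => h.mono fun n hn => by linarith) h1,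
    ae_forall_pos (fun ε δ ω hεδ h => h.mono fun n hn => by linarith) h2] with ω h3 h4
  exact liminf_coe_eq h3 h4

end AlmostSure

/-! ### Tail bounds and convergence in probability -/

section Tails

variable {Ω : Type*} [MeasurableSpace Ω] {P : Measure Ω} [IsProbabilityMeasure P] {p : ℝ}
  {ξ : ℕ → Ω → ℝ}

lemma measurable_W (hη : IsCoin P p (bit ξ)) {n : ℕ} (hn : 0 < n) : Measurable (W ξ n) := by
  refine measurable_of_Ici fun r => ?_
  rcases Nat.eq_zero_or_pos r with rfl | hr
  · have : W ξ n ⁻¹' Set.Ici 0 = Set.univ := by ext; simp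
    rw [this]
    exact MeasurableSet.univ
  · have : W ξ n ⁻¹' Set.Ici r = {ω | HasAP n r (bits (bit ξ) ω)} := by
      ext ω
      exact le_W_iff hn hr ω
    rw [this]
    exact hη.measurableSet ⟨_, dependsOn_hasAP hn r⟩

lemma rpow_mul_log (hp0 : 0 < p) (ε : ℝ) {y : ℝ} (hy : 0 < y) :
    p ^ (ε * Real.log y) = y ^ (ε * Real.log p) := by
  rw [Real.rpow_def_of_pos hp0, Real.rpow_def_of_pos hy]
  ring_nf

/-- The union bound for the upper tail. -/
lemma real_add_le_W_le (hp0 : 0 < p) (hp1 : p < 1) (hη : IsCoin P p (bit ξ)) {n : ℕ} (hn : 0 < n)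
    (x : ℝ) : P.real {ω | C p * Real.log n + x ≤ W ξ n ω} ≤ p ^ x := by
  rcases le_or_gt (C p * Real.log n + x) 0 with h | h
  · have h1 : 0 ≤ C p * Real.log n :=
      mul_nonneg (C_pos hp0 hp1).le (Real.log_natCast_nonneg n)
    exact measureReal_le_one.trans (Real.one_le_rpow_of_pos_of_le_one_of_nonpos hp0 hp1.le
      (by linarith))
  · set r := ⌈C p * Real.log n + x⌉₊ with hr
    have hr1 : 1 ≤ r := Nat.one_le_iff_ne_zero.2 (Nat.ceil_pos.2 h).ne'
    have hset : {ω | C p * Real.log n + x ≤ W ξ n ω} = {ω | r ≤ W ξ n ω} := by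
      ext ω
      change _ ↔ ⌈C p * Real.log n + x⌉₊ ≤ W ξ n ω
      rw [Nat.ceil_le]
      rfl
    rw [hset, real_le_W hn hr1]
    refine (hη.prob_hasAP_le n r).trans ?_
    rw [sq_mul_pow_eq_rpow hp0 hp1 hn]
    apply Real.rpow_le_rpow_of_exponent_ge hp0 hp1.le
    have := Nat.le_ceil (C p * Real.log n + x)
    linarith

lemma le_normW_iff {n : ℕ} (hn : 0 < Real.log (Real.log n)) (c : ℝ) (ω : Ω) :
    c ≤ normW ξ p n ω ↔ C p * Real.log n + c * Real.log (Real.log n) ≤ W ξ n ω := by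
  rw [normW, le_div_iff₀ hn, le_sub_iff_add_le']

lemma normW_le_iff {n : ℕ} (hn : 0 < Real.log (Real.log n)) (c : ℝ) (ω : Ω) :
    normW ξ p n ω ≤ c ↔ (W ξ n ω : ℝ) ≤ C p * Real.log n + c * Real.log (Real.log n) := by
  rw [normW, div_le_iff₀ hn, sub_le_iff_le_add']

lemma real_le_normW_le (hp0 : 0 < p) (hp1 : p < 1) (hη : IsCoin P p (bit ξ)) (c : ℝ) :
    ∀ᶠ n : ℕ in atTop, P.real {ω | c ≤ normW ξ p n ω} ≤ Real.log n ^ (c * Real.log p) := by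
  filter_upwards [tendsto_log_log_nat.eventually_gt_atTop 0, tendsto_log_nat.eventually_gt_atTop 0,
    eventually_gt_atTop 0] with n h1 h2 h3
  rw [← rpow_mul_log hp0 c h2]
  simp only [le_normW_iff h1]
  exact real_add_le_W_le hp0 hp1 hη h3 _

lemma exists_real_normW_le_le (hp0 : 0 < p) (hp1 : p < 1) : ∃ K : ℝ, 0 ≤ K ∧
    ∀ (Ω : Type*) [MeasurableSpace Ω] (P : Measure Ω) [IsProbabilityMeasure P] (ξ : ℕ → Ω → ℝ),
      IsCoin P p (bit ξ) → ∀ ε > 0, ∀ᶠ n : ℕ in atTop, P.real {ω | normW ξ p n ω ≤ -ε} ≤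
        Real.exp (-((1 - p) * p / 2 * Real.log n ^ (-ε * Real.log p)))
          + K * (Real.log n ^ 7 / n) := by
  obtain ⟨K, hK0, hK⟩ := exists_poisson_error_bound hp0 hp1
  refine ⟨K, hK0, fun Ω _ P _ ξ hη ε hε => ?_⟩
  have hC := C_pos hp0 hp1
  -- The level must reach 1 so that `r = ⌊y⌋₊ + 1` is at least 2, the range of the error bound.
  -- Rounding up by at most 1 costs the factor `p` in the exponent.
  have hlow : ∀ᶠ n : ℕ in atTop, 1 ≤ C p * Real.log n + -ε * Real.log (Real.log n) := by
    have h1 : Tendsto (fun x : ℝ => x * (C p + -ε * (Real.log x / x))) atTop atTop := by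
      refine Tendsto.atTop_mul_pos hC tendsto_id ?_
      have := (Real.isLittleO_log_id_atTop.tendsto_div_nhds_zero).const_mul (-ε)
      simpa using this.const_add (C p)
    filter_upwards [(h1.comp tendsto_log_nat).eventually_ge_atTop 1,
      tendsto_log_nat.eventually_gt_atTop 0] with n h2 h3
    refine h2.trans (le_of_eq ?_)
    simp only [Function.comp]
    field_simp
  filter_upwards [hlow, tendsto_log_log_nat.eventually_gt_atTop 0,
    tendsto_log_nat.eventually_gt_atTop 0, eventually_ge_atTop 2] with n h1 h2 h3 h4
  set y := C p * Real.log n + -ε * Real.log (Real.log n) with hy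
  set r := ⌊y⌋₊ + 1 with hr
  have hfl : 1 ≤ ⌊y⌋₊ := Nat.le_floor (by exact_mod_cast h1)
  have hfl2 : (⌊y⌋₊ : ℝ) ≤ y := Nat.floor_le (by linarith)
  have hsub : {ω | normW ξ p n ω ≤ -ε} ⊆ {ω | W ξ n ω < r} := by
    intro ω hω
    have h5 := (normW_le_iff h2 _ ω).1 hω
    exact Nat.lt_succ_of_le (Nat.le_floor h5)
  refine (measureReal_mono hsub).trans ?_
  rw [real_W_lt (by omega) (by omega)]
  have h5 := (abs_le.1 (hK n r h4 (by omega) Ω P (bit ξ) hη)).2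
  have h6 : Real.exp (-((1 - p) * (n : ℝ) ^ 2 * p ^ r / 2)) ≤
      Real.exp (-((1 - p) * p / 2 * Real.log n ^ (-ε * Real.log p))) := by
    apply Real.exp_le_exp.2
    have h7 : p * Real.log n ^ (-ε * Real.log p) ≤ (n : ℝ) ^ 2 * p ^ r := by
      rw [sq_mul_pow_eq_rpow hp0 hp1 (by omega), ← rpow_mul_log hp0 _ h3]
      have : p * p ^ (-ε * Real.log (Real.log n)) = p ^ (1 + -ε * Real.log (Real.log n)) := by
        rw [Real.rpow_add hp0, Real.rpow_one]
      rw [this]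
      apply Real.rpow_le_rpow_of_exponent_ge hp0 hp1.le
      rw [hr]
      push_cast
      linarith
    have := mul_le_mul_of_nonneg_left h7 (by linarith : 0 ≤ (1 - p) / 2)
    linarith
  linarith

lemma tendsto_lower_tail (hp0 : 0 < p) (hp1 : p < 1) (K : ℝ) {ε : ℝ} (hε : 0 < ε) :
    Tendsto (fun n : ℕ => Real.exp (-((1 - p) * p / 2 * Real.log n ^ (-ε * Real.log p)))
          + K * (Real.log n ^ 7 / n)) atTop (𝓝 0) := by
  have h1 : 0 < -ε * Real.log p := by nlinarith [Real.log_neg hp0 hp1]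
  have h2 : 0 < (1 - p) * p / 2 := by
    have : 0 < 1 - p := by linarith
    positivity
  have h3 := ((tendsto_rpow_atTop h1).comp tendsto_log_nat).const_mul_atTop h2
  have h4 := Real.tendsto_exp_neg_atTop_nhds_zero.comp h3
  have h5 := h4.add ((tendsto_log_pow_div_nat 7).const_mul K)
  simpa using h5

/-- Convergence in probability. -/
theorem tendstoInMeasure_normW (hp0 : 0 < p) (hp1 : p < 1) (hη : IsCoin P p (bit ξ)) :
    TendstoInMeasure P (normW ξ p) atTop (fun _ => (0 : ℝ)) := by
  obtain ⟨K, -, hK⟩ := exists_real_normW_le_le hp0 hp1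
  rw [tendstoInMeasure_iff_norm]
  intro ε hε
  have hl := Real.log_neg hp0 hp1
  have h1 := (tendsto_rpow_neg_atTop (by nlinarith : 0 < -(ε * Real.log p))).comp tendsto_log_nat
  rw [neg_neg] at h1
  have h2 := h1.add (tendsto_lower_tail hp0 hp1 K hε)
  rw [add_zero] at h2
  have h3 : Tendsto (fun n => P.real {ω | ε ≤ ‖normW ξ p n ω - 0‖}) atTop (𝓝 0) := by
    refine squeeze_zero' (Eventually.of_forall fun _ => measureReal_nonneg) ?_ h2
    filter_upwards [real_le_normW_le hp0 hp1 hη ε, hK Ω P ξ hη ε hε] with n h4 h5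
    have hsub : {ω | ε ≤ ‖normW ξ p n ω - 0‖} ⊆
        {ω | ε ≤ normW ξ p n ω} ∪ {ω | normW ξ p n ω ≤ -ε} := by
      intro ω hω
      simp only [Set.mem_ofPred_eq, sub_zero, Real.norm_eq_abs] at hω
      rcases le_abs.1 hω with h | h
      · exact Or.inl h
      · exact Or.inr (show normW ξ p n ω ≤ -ε by linarith)
    exact (measureReal_mono hsub).trans ((measureReal_union_le _ _).trans (add_le_add h4 h5))
  have h4 := (ENNReal.continuous_ofReal.tendsto 0).comp h3
  rw [ENNReal.ofReal_zero] at h4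
  refine h4.congr fun n => ?_
  simp [ofReal_measureReal]

end Tails

/-! ### The upper limit `3 / 2` -/

section LimsupRatio

variable {Ω : Type*} [MeasurableSpace Ω] {P : Measure Ω} [IsProbabilityMeasure P] {p : ℝ}
  {ξ : ℕ → Ω → ℝ}

lemma C_mul_log (hp0 : 0 < p) (hp1 : p < 1) : C p * Real.log p = -2 := by
  have := (Real.log_neg hp0 hp1).ne
  rw [C]
  field_simp

/-- At level `(3/2 + ε) C log n` the union bound is `p ^ ((1/2 + ε) C log n) = n ^ (-1 - 2 ε)`,
which is summable. -/
lemma ae_eventually_ratio_le (hp0 : 0 < p) (hp1 : p < 1) (hη : IsCoin P p (bit ξ)) {ε : ℝ}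
    (hε : 0 < ε) :
    ∀ᵐ ω ∂P, ∀ᶠ n : ℕ in atTop, (W ξ n ω : ℝ) / (C p * Real.log n) ≤ 3 / 2 + ε := by
  have hC := C_pos hp0 hp1
  have hsum : Summable fun n : ℕ => (n : ℝ) ^ ((1 / 2 + ε) * C p * Real.log p) := by
    rw [Real.summable_nat_rpow, mul_assoc, C_mul_log hp0 hp1]
    linarith
  have h := ae_eventually_notMem_of_real_le (P := P)
    (s := fun n => {ω | C p * Real.log n + (1 / 2 + ε) * C p * Real.log n ≤ W ξ n ω}) hsum (by
      filter_upwards [eventually_gt_atTop 0] with n hn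
      rw [← rpow_mul_log hp0 _ (by exact_mod_cast hn)]
      exact real_add_le_W_le hp0 hp1 hη hn _)
  filter_upwards [h] with ω hω
  filter_upwards [hω, tendsto_log_nat.eventually_gt_atTop 0] with n h1 h2
  rw [div_le_iff₀ (mul_pos hC h2)]
  have h1' : ¬ (C p * Real.log n + (1 / 2 + ε) * C p * Real.log n ≤ W ξ n ω) := h1
  linarith

/-- The second-moment bound for long progressions split over two zones, with explicit rates. -/
lemma IsCoin.prob_forall_not_hasAP_le_of_floor {η : ℕ → Ω → Bool} (hη : IsCoin P p η)
    (hp0 : 0 < p) (hp1 : p < 1) {β : ℝ} (hβ : 1 ≤ β) (hβ' : β ≤ 3 / 2) : ∀ᶠ N : ℕ in atTop,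
    prob P η (fun x => ∀ n, 9 * N ≤ n → n ≤ 14 * N →
        ¬ HasAP n (2 * ⌊β / (-Real.log p) * Real.log N⌋₊) x) ≤
      ((1 + (β / (-Real.log p)) ^ 2 / √p * (Real.log N ^ 2 * (N : ℝ) ^ (-(1 / 4) : ℝ))) ^ 2 - 1)
        + (4 * (β / (-Real.log p)) * (Real.log N ^ 1 * (N : ℝ) ^ (-1 : ℝ))
          + 4 * (β / (-Real.log p)) ^ 5 * (Real.log N ^ 5 * (N : ℝ) ^ (-(3 - 2 * β)))) := by
  have hl := Real.log_neg hp0 hp1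
  set c := β / (-Real.log p) with hc
  have hc0 : 0 < c := div_pos (by linarith) (by linarith)
  have hcl : c * Real.log p = -β := by
    rw [hc, div_mul_eq_mul_div, mul_div_assoc, div_neg, div_self hl.ne]
    ring
  have hlogN : ∀ᶠ N : ℕ in atTop, c * Real.log N ≤ N := by
    have := (tendsto_log_pow_div_nat 1).const_mul c
    rw [mul_zero] at this
    filter_upwards [this.eventually (eventually_le_nhds one_pos), eventually_gt_atTop 0]
      with N h1 h2
    have h3 : (0 : ℝ) < N := by exact_mod_cast h2
    rwa [pow_one, ← mul_div_assoc, div_le_one h3] at h1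
  filter_upwards [hlogN, (tendsto_log_nat.const_mul_atTop hc0).eventually_ge_atTop 1,
    eventually_gt_atTop 0] with N h1 h2 h3
  have hN : (0 : ℝ) < N := by exact_mod_cast h3
  have hN1 : (1 : ℝ) ≤ N := by exact_mod_cast h3
  set h := ⌊c * Real.log N⌋₊ with hh
  have hh1 : 1 ≤ h := Nat.le_floor (by exact_mod_cast h2)
  have hhle : (h : ℝ) ≤ c * Real.log N := Nat.floor_le (by linarith)
  have hhN : h ≤ N := by
    have : (h : ℝ) ≤ N := hhle.trans h1
    exact_mod_cast this
  have hh0 : (0 : ℝ) < h := by exact_mod_cast hh1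
  -- This is the largest range of steps compatible with `h * D ≤ N`. It makes the number of triples
  -- of order `N ^ 3 / h`.
  set d := N / h with hd
  have hd1 : 1 ≤ d := (Nat.one_le_div_iff hh1).2 hhN
  have hd2 : (N : ℝ) ≤ 2 * h * d := by
    have h4 := Nat.lt_div_mul_add (a := N) hh1
    have h5 : N ≤ 2 * h * d := by
      have h6 : h ≤ d * h := Nat.le_mul_of_pos_left h hd1
      have h7 : 2 * h * d = d * h + d * h := by ring
      rw [← hd] at h4
      omega
    exact_mod_cast h5
  refine (hη.prob_forall_not_hasAP_le hp0 hh1 h3 hd1 (Nat.mul_div_le N h)).trans ?_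
  have hph : (N : ℝ) ^ (-β) ≤ p ^ h := by
    rw [← hcl, ← rpow_mul_log hp0 _ hN, ← Real.rpow_natCast]
    exact Real.rpow_le_rpow_of_exponent_ge hp0 hp1.le hhle
  have hs0 : 0 < √p := Real.sqrt_pos.2 hp0
  have hNb : 0 < (N : ℝ) ^ (-β) := Real.rpow_pos_of_pos hN _
  have hsq : √p ^ h * √p ^ h = p ^ h := by
    rw [← mul_pow, Real.mul_self_sqrt hp0.le]
  -- The bound `β ≤ 3 / 2` enters here. The correction for different steps behaves like `h ^ 2 / (N
  -- * √p ^ h)`, hence at most like `log N ^ 2 * N ^ (-1/4)`.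
  have hsh : (N : ℝ) ^ (-(3 / 4) : ℝ) ≤ √p ^ h := by
    have h4 : (N : ℝ) ^ (-(3 / 4) : ℝ) * (N : ℝ) ^ (-(3 / 4) : ℝ) ≤ √p ^ h * √p ^ h := by
      rw [hsq, ← Real.rpow_add hN]
      refine le_trans ?_ hph
      exact Real.rpow_le_rpow_of_exponent_le hN1 (by linarith)
    exact abs_le_of_sq_le_sq' (by rw [sq, sq]; exact h4) (by positivity) |>.2
  have hx1 : (h : ℝ) ^ 2 * √p ^ (3 * h - 1) / (N * (p ^ h) ^ 2) ≤
      c ^ 2 / √p * (Real.log N ^ 2 * (N : ℝ) ^ (-(1 / 4) : ℝ)) := by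
    have e1 : √p ^ (3 * h - 1) * √p = √p ^ h * √p ^ h * √p ^ h := by
      rw [← pow_succ, Nat.sub_add_cancel (by omega), ← pow_add, ← pow_add]
      congr 1; ring
    have e2 : (h : ℝ) ^ 2 * √p ^ (3 * h - 1) / (N * (p ^ h) ^ 2) =
        (h : ℝ) ^ 2 / √p * ((N : ℝ)⁻¹ * (√p ^ h)⁻¹) := by
      rw [← hsq]
      have hsh0 : √p ^ h ≠ 0 := (pow_pos hs0 h).ne'
      have e3 : √p ^ (3 * h - 1) = √p ^ h * √p ^ h * √p ^ h / √p := by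
        rw [← e1]; field_simp
      rw [e3]
      field_simp
    have e4 : (N : ℝ) ^ (-(1 / 4) : ℝ) = (N : ℝ)⁻¹ * ((N : ℝ) ^ (-(3 / 4) : ℝ))⁻¹ := by
      rw [← Real.rpow_neg hN.le, ← Real.rpow_neg_one, ← Real.rpow_add hN]
      norm_num
    rw [e2, e4]
    have h5 : (h : ℝ) ^ 2 ≤ c ^ 2 * Real.log N ^ 2 := by
      rw [← mul_pow]
      exact pow_le_pow_left₀ hh0.le hhle 2
    have h6 : (√p ^ h)⁻¹ ≤ ((N : ℝ) ^ (-(3 / 4) : ℝ))⁻¹ :=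
      inv_anti₀ (Real.rpow_pos_of_pos hN _) hsh
    calc h ^ 2 / √p * ((N : ℝ)⁻¹ * (√p ^ h)⁻¹)
        ≤ c ^ 2 * Real.log N ^ 2 / √p * ((N : ℝ)⁻¹ * ((N : ℝ) ^ (-(3 / 4) : ℝ))⁻¹) := by gcongr
      _ = _ := by ring
  have hx2 : (h : ℝ) ^ 2 / (N * p ^ h) ≤ h ^ 2 * (N : ℝ) ^ (β - 1) := by
    have e4 : (N : ℝ) ^ (β - 1) = (N * (N : ℝ) ^ (-β))⁻¹ := by
      rw [mul_inv, ← Real.rpow_neg hN.le, neg_neg, ← Real.rpow_neg_one, ← Real.rpow_add hN]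
      congr 1; ring
    rw [e4, ← div_eq_mul_inv]
    gcongr
  have hx1' : 0 ≤ (h : ℝ) ^ 2 * √p ^ (3 * h - 1) / (N * (p ^ h) ^ 2) := by positivity
  have hd0 : (0 : ℝ) < d := by exact_mod_cast hd1
  refine add_le_add (by gcongr) ?_
  have h7 : (1 : ℝ) / d ≤ 2 * h / N := by
    rw [div_le_div_iff₀ hd0 hN]
    linarith
  have hx2' : 0 ≤ (h : ℝ) ^ 2 / (N * p ^ h) := by positivity
  set z := (h : ℝ) ^ 2 * (N : ℝ) ^ (β - 1) with hz
  have h8 : (1 + (h : ℝ) ^ 2 / (N * p ^ h)) ^ 2 ≤ 2 + 2 * z ^ 2 := by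
    have : (1 + (h : ℝ) ^ 2 / (N * p ^ h)) ^ 2 ≤ (1 + z) ^ 2 := by gcongr
    nlinarith [sq_nonneg (1 - z)]
  have e5 : z ^ 2 * (N : ℝ)⁻¹ = h ^ 4 * (N : ℝ) ^ (-(3 - 2 * β)) := by
    rw [hz, mul_pow, ← pow_mul, ← Real.rpow_natCast ((N : ℝ) ^ (β - 1)), ← Real.rpow_mul hN.le,
      ← Real.rpow_neg_one, mul_assoc, ← Real.rpow_add hN]
    congr 2
    push_cast; ring
  calc (1 + (h : ℝ) ^ 2 / (N * p ^ h)) ^ 2 / d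
      = (1 + (h : ℝ) ^ 2 / (N * p ^ h)) ^ 2 * (1 / d) := by ring
    _ ≤ (2 + 2 * z ^ 2) * (2 * h / N) := by gcongr
    _ = 4 * h * (N : ℝ)⁻¹ + 4 * h * (z ^ 2 * (N : ℝ)⁻¹) := by ring
    _ = 4 * h * (N : ℝ)⁻¹ + 4 * h ^ 5 * (N : ℝ) ^ (-(3 - 2 * β)) := by rw [e5]; ring
    _ ≤ 4 * (c * Real.log N) * (N : ℝ)⁻¹
        + 4 * (c * Real.log N) ^ 5 * (N : ℝ) ^ (-(3 - 2 * β)) := by gcongr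
    _ = _ := by rw [Real.rpow_neg_one]; ring

lemma ae_frequently_le_ratio (hp0 : 0 < p) (hp1 : p < 1) (hη : IsCoin P p (bit ξ)) {ε : ℝ}
    (hε : 0 < ε) (hε1 : ε ≤ 1) :
    ∀ᵐ ω ∂P, ∃ᶠ n : ℕ in atTop, 3 / 2 - ε ≤ (W ξ n ω : ℝ) / (C p * Real.log n) := by
  have hC := C_pos hp0 hp1
  have hl := Real.log_neg hp0 hp1
  -- Half of `ε` keeps `3 - 2 β = ε` positive. The other half absorbs the floor and the passage from
  -- `log N` to `log n` with `n ≤ 14 N`.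
  set β := 3 / 2 - ε / 2 with hβ
  have hc : 2 * (β / (-Real.log p)) = β * C p := by
    rw [C]
    field_simp
  have hcast : Tendsto (fun N : ℕ => (N : ℝ)) atTop atTop := tendsto_natCast_atTop_atTop
  have he : Tendsto (fun N : ℕ =>
      ((1 + (β / (-Real.log p)) ^ 2 / √p * (Real.log N ^ 2 * (N : ℝ) ^ (-(1 / 4) : ℝ))) ^ 2 - 1)
        + (4 * (β / (-Real.log p)) * (Real.log N ^ 1 * (N : ℝ) ^ (-1 : ℝ))
          + 4 * (β / (-Real.log p)) ^ 5 * (Real.log N ^ 5 * (N : ℝ) ^ (-(3 - 2 * β)))))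
      atTop (𝓝 0) := by
    have t1 := (tendsto_log_pow_mul_rpow_neg 2 (by norm_num : (0 : ℝ) < 1 / 4)).comp hcast
    have t2 := (tendsto_log_pow_mul_rpow_neg 1 (by norm_num : (0 : ℝ) < 1)).comp hcast
    have t3 := (tendsto_log_pow_mul_rpow_neg 5 (by linarith : (0 : ℝ) < 3 - 2 * β)).comp hcast
    have := ((((t1.const_mul ((β / (-Real.log p)) ^ 2 / √p)).const_add 1).pow 2).sub_const 1).add
      ((t2.const_mul (4 * (β / (-Real.log p)))).add
        (t3.const_mul (4 * (β / (-Real.log p)) ^ 5)))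
    simpa using this
  refine ae_frequently_mem (T := fun N => {n | 9 * N ≤ n ∧ n ≤ 14 * N})
    (A := fun n => {ω | 3 / 2 - ε ≤ (W ξ n ω : ℝ) / (C p * Real.log n)}) ?_ he ?_
  · intro N
    filter_upwards [eventually_ge_atTop N] with J hJ n hn
    have := hn.1
    omega
  · filter_upwards [hη.prob_forall_not_hasAP_le_of_floor hp0 hp1 (β := β) (by linarith)
      (by linarith), eventually_gt_atTop 0,
      (tendsto_log_nat.const_mul_atTop (by positivity : 0 < ε / 2 * C p)).eventually_ge_atTop
        (2 + 3 / 2 * C p * Real.log 14),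
      (tendsto_log_nat.const_mul_atTop (by
        exact div_pos (by linarith) (by linarith) : 0 < β / (-Real.log p))).eventually_ge_atTop 1]
      with N h1 h2 h3 h4
    refine le_trans (measureReal_mono ?_) h1
    intro ω hω n hn1 hn2 hAP
    refine hω n ⟨hn1, hn2⟩ ?_
    have hh1 : 1 ≤ ⌊β / (-Real.log p) * Real.log N⌋₊ := Nat.le_floor (by exact_mod_cast h4)
    have hW : 2 * ⌊β / (-Real.log p) * Real.log N⌋₊ ≤ W ξ n ω :=
      (le_W_iff (by omega) (by omega) ω).2 hAP
    have hW' : 2 * (⌊β / (-Real.log p) * Real.log N⌋₊ : ℝ) ≤ W ξ n ω := by exact_mod_cast hW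
    have hfl := Nat.lt_floor_add_one (β / (-Real.log p) * Real.log N)
    have hN : (0 : ℝ) < N := by exact_mod_cast h2
    have hn0 : (2 : ℝ) ≤ n := by
      have : 2 ≤ n := by omega
      exact_mod_cast this
    have hlogn : Real.log n ≤ Real.log N + Real.log 14 := by
      rw [← Real.log_mul hN.ne' (by norm_num)]
      apply Real.log_le_log (by linarith)
      have : (n : ℝ) ≤ 14 * N := by exact_mod_cast hn2
      linarith
    have hlogn0 : 0 < Real.log n := Real.log_pos (by linarith)
    change 3 / 2 - ε ≤ (W ξ n ω : ℝ) / (C p * Real.log n)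
    rw [le_div_iff₀ (mul_pos hC hlogn0)]
    have h5 : (3 / 2 - ε) * (C p * Real.log n) ≤
        (3 / 2 - ε) * (C p * (Real.log N + Real.log 14)) :=
      mul_le_mul_of_nonneg_left (mul_le_mul_of_nonneg_left hlogn hC.le) (by linarith)
    have h14 : 0 < Real.log 14 := Real.log_pos (by norm_num)
    have h6 : 0 ≤ ε * (C p * Real.log 14) := by positivity
    have h7 : 2 * (β / (-Real.log p) * Real.log N) = β * C p * Real.log N := by
      rw [← mul_assoc, hc]
    have h8 : β * C p * Real.log N = (3 / 2 - ε) * (C p * Real.log N) + ε / 2 * C p * Real.log N := by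
      rw [hβ]; ring
    linarith

/-- The almost sure upper limit of `W / (C log n)`. -/
theorem ae_limsup_ratio (hp0 : 0 < p) (hp1 : p < 1) (hη : IsCoin P p (bit ξ)) :
    ∀ᵐ ω ∂P, limsup (fun n : ℕ => (((W ξ n ω : ℝ) / (C p * Real.log n) : ℝ) : EReal)) atTop
      = ((3 / 2 : ℝ) : EReal) := by
  refine ae_limsup_coe_eq (fun ε hε => ae_eventually_ratio_le hp0 hp1 hη hε) fun ε hε => ?_
  filter_upwards [ae_frequently_le_ratio hp0 hp1 hη (lt_min hε one_pos) (min_le_right ε 1)]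
    with ω hω
  exact hω.mono fun n hn => le_trans (by linarith [min_le_left ε 1]) hn

end LimsupRatio

/-! ### Almost sure lower bound for the lower limit -/

section LowerBound

variable {Ω : Type*} [MeasurableSpace Ω] {P : Measure Ω} [IsProbabilityMeasure P] {p : ℝ}
  {ξ : ℕ → Ω → ℝ}

/-- The absolute error of order `log n ^ 7 / n` is not summable, so the one-sided bound with
quadratically small error is used. The constant `A = 4 / ((1 - p) p)` puts an intensity above `p A
log n` into the main term, making it at most `e * n ^ (-2)`. -/
lemma exists_real_W_lt_le (hp0 : 0 < p) (hp1 : p < 1) (hη : IsCoin P p (bit ξ)) :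
    ∃ A c : ℝ, 0 < A ∧ ∀ᶠ n : ℕ in atTop,
      P.real {ω | (W ξ n ω : ℝ) < C p * Real.log n + D p * (Real.log A + Real.log (Real.log n))} ≤
        Real.exp 1 * (n : ℝ) ^ (-2 : ℝ) + c * (Real.log n ^ 10 * (n : ℝ) ^ (-2 : ℝ)) := by
  have hq : 0 < 1 - p := by linarith
  set A : ℝ := 4 / ((1 - p) * p) with hA
  have hA0 : 0 < A := by positivity
  have hqA : ∀ y, (1 - p) * (p * (A * y)) = 4 * y := by
    intro y
    rw [hA]; field_simp
  set c := logFactor p A with hc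
  have hc0 : 0 ≤ c := (logFactor_spec hp0 hp1 hA0.le le_rfl).1
  refine ⟨A, 14 / p * c ^ 10, hA0, ?_⟩
  have t1 := ((tendsto_log_pow_div_nat 1).const_mul A)
  rw [mul_zero] at t1
  have t2 := ((tendsto_log_pow_div_nat 7).const_mul (8 / p * c ^ 7))
  rw [mul_zero] at t2
  have hp2 : 0 < p ^ 2 := by positivity
  filter_upwards [t1.eventually (gt_mem_nhds hp2), t2.eventually (eventually_le_nhds one_pos),
    eventually_ge_atTop 2, tendsto_log_nat.eventually_ge_atTop 1] with n h1 h2 h3 h4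
  have hn : (0 : ℝ) < n := by exact_mod_cast (by omega : 0 < n)
  have hn1 : (1 : ℝ) ≤ n := by exact_mod_cast (by omega : 1 ≤ n)
  have h5 : A * Real.log n < (n : ℝ) ^ 2 * p ^ 2 := by
    rw [pow_one, ← mul_div_assoc, div_lt_iff₀ hn] at h1
    have : p ^ 2 * n * 1 ≤ p ^ 2 * n * n := by gcongr
    linarith
  have hAl : 0 < A * Real.log n := by positivity
  obtain ⟨r, hr, hr1, hr2⟩ := exists_level hp0 hp1 hAl h5
  have hrs : (r : ℝ) ≤ 3 / (-Real.log p) * Real.log n := by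
    by_contra h
    have h6 := sq_mul_pow_le_inv hp0 hp1 (by omega : 1 ≤ n) (not_le.1 h).le
    have h7 : 1 / (n : ℝ) ≤ 1 := by rw [div_le_one hn]; exact hn1
    have h8 : (1 - p) * (p * (A * Real.log n)) ≤ p * (A * Real.log n) :=
      mul_le_of_le_one_left (by positivity) (by linarith)
    have := hqA (Real.log n)
    linarith
  obtain ⟨-, hL1, hLA, hLr⟩ := logFactor_spec hp0 hp1 hA0.le h3
  have hmain := hη.prob_not_hasAP_le hp0 (by omega : 0 < n) (by omega : 3 ≤ r) hL1 (hLr r hrs)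
    (hr1.trans hLA)
  have hlev : C p * Real.log n + D p * (Real.log A + Real.log (Real.log n)) ≤ r := by
    rw [sq_mul_pow_eq_rpow hp0 hp1 (by omega)] at hr1
    have h6 : p ^ ((r : ℝ) - C p * Real.log n) ≤ p ^ (D p * Real.log (A * Real.log n)) := by
      rwa [rpow_D_mul hp0 hp1, Real.exp_log hAl]
    rw [Real.rpow_le_rpow_left_iff_of_base_lt_one hp0 hp1,
      Real.log_mul hA0.ne' (by linarith)] at h6
    linarith
  have hsub : {ω | (W ξ n ω : ℝ) < C p * Real.log n + D p * (Real.log A + Real.log (Real.log n))} ⊆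
      {ω | W ξ n ω < r} := by
    intro ω hω
    have h6 : (W ξ n ω : ℝ) < r := lt_of_lt_of_le hω hlev
    exact_mod_cast h6
  refine (measureReal_mono hsub).trans ?_
  rw [real_W_lt (by omega) (by omega)]
  refine hmain.trans (add_le_add ?_ (le_of_eq ?_))
  · have h6 : (n : ℝ) ^ (-2 : ℝ) = Real.exp (-2 * Real.log n) := by
      rw [Real.rpow_def_of_pos hn]; ring_nf
    rw [h6, ← Real.exp_add]
    apply Real.exp_le_exp.2
    have h7 := mul_le_mul_of_nonneg_left hr2.le hq.le
    rw [hqA] at h7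
    have h8 : 8 / p * ((c * Real.log n) ^ 7 / n) ≤ 1 := by
      refine le_trans (le_of_eq ?_) h2
      rw [mul_pow]; ring
    linarith
  · rw [Real.rpow_neg hn.le, mul_pow]
    norm_num
    ring

lemma ae_eventually_le_normW (hp0 : 0 < p) (hp1 : p < 1) (hη : IsCoin P p (bit ξ)) {ε : ℝ}
    (hε : 0 < ε) : ∀ᵐ ω ∂P, ∀ᶠ n : ℕ in atTop, D p - ε ≤ normW ξ p n ω := by
  obtain ⟨A, c, hA, h⟩ := exists_real_W_lt_le hp0 hp1 hη
  have hs1 : Summable fun n : ℕ => Real.exp 1 * (n : ℝ) ^ (-2 : ℝ) :=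
    (Real.summable_nat_rpow.2 (by norm_num)).mul_left _
  have hs2 : Summable fun n : ℕ => c * (Real.log n ^ 10 * (n : ℝ) ^ (-2 : ℝ)) := by
    refine Summable.mul_left _ (summable_of_tendsto_mul_rpow (s := 3 / 2) (by norm_num) ?_ ?_)
    · filter_upwards with n
      have := Real.log_natCast_nonneg n
      positivity
    · refine ((tendsto_log_pow_mul_rpow_neg 10 (by norm_num : (0 : ℝ) < 1 / 2)).comp
        tendsto_natCast_atTop_atTop).congr' ?_
      filter_upwards [eventually_gt_atTop 0] with n hn
      have hn' : (0 : ℝ) < n := by exact_mod_cast hn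
      simp only [Function.comp]
      rw [mul_assoc, ← Real.rpow_add hn']
      norm_num
  filter_upwards [ae_eventually_notMem_of_real_le (hs1.add hs2) h] with ω hω
  filter_upwards [hω, (tendsto_log_log_nat.const_mul_atTop hε).eventually_ge_atTop
    (-(D p * Real.log A)), tendsto_log_log_nat.eventually_gt_atTop 0] with n h1 h2 h3
  have h4 : ¬ ((W ξ n ω : ℝ) < C p * Real.log n + D p * (Real.log A + Real.log (Real.log n))) := h1
  rw [le_normW_iff h3]
  linarith

end LowerBound

/-! ### Second moment method for a family of events -/

section SecondMoment

variable {Ω : Type*} [MeasurableSpace Ω] {P : Measure Ω} [IsProbabilityMeasure P] {p : ℝ}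
  {η : ℕ → Ω → Bool}

open Classical in
/-- The second moment method for a finite family of events with uniformly bounded pairs. -/
lemma IsCoin.prob_forall_not_le_of_pairs (hη : IsCoin P p η) {T : Finset ℕ} (hT : T.Nonempty)
    {A : ℕ → (ℕ → Bool) → Prop} (hA : ∀ n ∈ T, FinDep (A n)) {m v : ℝ} (hm : 0 < m) (hv : 0 ≤ v)
    (h1 : ∀ n ∈ T, m ≤ prob P η (A n))
    (h2 : ∀ n ∈ T, ∀ k ∈ T, n ≠ k → prob P η (fun x => A n x ∧ A k x) ≤ v) :
    prob P η (fun x => ∀ n ∈ T, ¬ A n x) ≤ 1 / (T.card * m) + v / m ^ 2 - 1 := by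
  have hc : (0 : ℝ) < T.card := by exact_mod_cast hT.card_pos
  set X : (ℕ → Bool) → ℝ := fun x => ∑ n : T, ind (A n) x with hX
  have hfd : ∀ n : T, FinDep (ind (A n)) := fun n => (hA n n.2).ind
  have hXf : FinDep X := FinDep.sum _ fun n _ => hfd n
  set M := ∑ n : T, prob P η (A n) with hM
  have hEX : expct P η X = M := by
    rw [hX, hη.expct_sum _ fun n _ => hfd n]
    exact Finset.sum_congr rfl fun n _ => hη.expct_ind (hA n n.2)
  have hcard : (Finset.univ : Finset T).card = T.card := by simp
  have hMge : T.card * m ≤ M := by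
    rw [← nsmul_eq_mul, ← hcard]
    exact Finset.card_nsmul_le_sum _ _ _ fun n _ => h1 n n.2
  have hM0 : 0 < M := lt_of_lt_of_le (by positivity) hMge
  have hEXX : expct P η (fun x => X x * X x) ≤ M + T.card ^ 2 * v := by
    have e : (fun x => X x * X x) = fun x => ∑ n : T, ∑ k : T, ind (fun y => A n y ∧ A k y) x := by
      funext x
      rw [hX, Finset.sum_mul_sum]
      refine Finset.sum_congr rfl fun n _ => Finset.sum_congr rfl fun k _ => ?_
      rw [ind_mul]
    have hfd2 : ∀ n k : T, FinDep fun y => A n y ∧ A k y := fun n k =>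
      (hA n n.2).comp₂ (· ∧ ·) (hA k k.2)
    rw [e, hη.expct_sum _ fun n _ => FinDep.sum _ fun k _ => (hfd2 n k).ind]
    have hrow : ∀ n : T, expct P η (fun x => ∑ k : T, ind (fun y => A n y ∧ A k y) x) ≤
        prob P η (A n) + T.card * v := by
      intro n
      rw [hη.expct_sum _ fun k _ => (hfd2 n k).ind]
      have hterm : ∀ k : T, expct P η (ind fun y => A n y ∧ A k y) ≤
          (if k = n then prob P η (A n) else 0) + v := by
        intro k
        rw [hη.expct_ind (hfd2 n k)]
        split_ifs with hk
        · have : prob P η (fun x => A n x ∧ A k x) ≤ prob P η (A n) :=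
            prob_mono fun x hx => hx.1
          linarith
        · have := h2 n n.2 k k.2 fun h => hk (Subtype.ext h.symm)
          linarith
      refine (Finset.sum_le_sum fun k _ => hterm k).trans (le_of_eq ?_)
      rw [Finset.sum_add_distrib, Finset.sum_ite_eq' Finset.univ n, if_pos (Finset.mem_univ n),
        Finset.sum_const, hcard, nsmul_eq_mul]
    refine (Finset.sum_le_sum fun n _ => hrow n).trans (le_of_eq ?_)
    rw [Finset.sum_add_distrib, Finset.sum_const, hcard, nsmul_eq_mul]
    ring
  have hmain := hη.prob_eq_zero_le hXf hEX hM0 hEXX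
  have hsub : prob P η (fun x => ∀ n ∈ T, ¬ A n x) ≤ prob P η (fun x => X x = 0) := by
    refine prob_mono fun x hx => ?_
    refine Finset.sum_eq_zero fun n _ => ?_
    exact ind_of_not (hx n n.2)
  refine hsub.trans (hmain.trans ?_)
  have e : (M + T.card ^ 2 * v - M ^ 2) / M ^ 2 = 1 / M + T.card ^ 2 * v / M ^ 2 - 1 := by
    field_simp
  rw [e]
  have h3 : 1 / M ≤ 1 / (T.card * m) := one_div_le_one_div_of_le (by positivity) hMge
  have h4 : T.card ^ 2 * v / M ^ 2 ≤ T.card ^ 2 * v / (T.card * m) ^ 2 := by gcongr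
  have h5 : T.card ^ 2 * v / (T.card * m) ^ 2 = v / m ^ 2 := by field_simp
  linarith

end SecondMoment

/-! ### Short longest progressions in a window of moduli -/

section Liminf

variable {Ω : Type*} [MeasurableSpace Ω] {P : Measure Ω} [IsProbabilityMeasure P] {p : ℝ}
  {ξ : ℕ → Ω → ℝ}

/-- For `x ≥ 1` the derivative `C + c / x` is at least `-2 D + D > 0`. This lets a level chosen at
the left end of a window serve for all moduli in it. -/
lemma C_mul_add_log_mono (hp0 : 0 < p) (hp1 : p < 1) {c x y : ℝ} (hc : D p ≤ c) (hx : 1 ≤ x)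
    (hxy : x ≤ y) : C p * x + c * Real.log x ≤ C p * y + c * Real.log y := by
  have hD := D_neg hp0 hp1
  have hx0 : 0 < x := by linarith
  have h1 : Real.log x ≤ Real.log y := Real.log_le_log hx0 hxy
  have h2 : Real.log y - Real.log x ≤ y - x := by
    rw [← Real.log_div (by linarith) hx0.ne']
    refine (Real.log_le_sub_one_of_pos (div_pos (by linarith) hx0)).trans ?_
    have e : y / x - 1 = (y - x) / x := by field_simp
    rw [e]
    exact div_le_self (by linarith) hx
  have h3 : D p * (Real.log y - Real.log x) ≤ c * (Real.log y - Real.log x) :=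
    mul_le_mul_of_nonneg_right hc (by linarith)
  have h4 : D p * (y - x) ≤ D p * (Real.log y - Real.log x) := mul_le_mul_of_nonpos_left h2 hD.le
  have h5 : D p * (y - x) ≤ 0 := mul_nonpos_of_nonpos_of_nonneg hD.le (by linarith)
  rw [C_eq_neg_two_mul_D]
  linarith

lemma C_div_two_mul_le (hp0 : 0 < p) (hp1 : p < 1) {c y : ℝ} (hc : D p ≤ c) (hy : 1 ≤ y) :
    C p / 2 * y ≤ C p * y + c * Real.log y := by
  have hD := D_neg hp0 hp1
  have h1 : Real.log y ≤ y := (Real.log_le_sub_one_of_pos (by linarith)).trans (by linarith)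
  have h2 : D p * Real.log y ≤ c * Real.log y :=
    mul_le_mul_of_nonneg_right hc (Real.log_nonneg hy)
  have h3 := mul_le_mul_of_nonpos_left h1 hD.le
  rw [C_eq_neg_two_mul_D]
  linarith

/-- Reducing mod `m`, the product may be replaced by `(n - m) v`, which is nonzero and smaller than
`m` in absolute value. -/
lemma not_dvd_mul_of_close {N g n m r : ℕ} (hn : N ≤ n) (hn' : n < N + g) (hm : N ≤ m)
    (hm' : m < N + g) (hnm : n ≠ m) (hg : g * coefBound r ≤ N) {v : ℤ} (hv : v ≠ 0)
    (hvr : |v| ≤ coefBound r) : ¬ (m : ℤ) ∣ n * v := by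
  intro h
  have h1 : (m : ℤ) ∣ (n - m) * v := by
    rw [sub_mul]
    exact dvd_sub h (dvd_mul_right _ _)
  have h2 : ((n : ℤ) - m) * v ≠ 0 := mul_ne_zero (sub_ne_zero.2 (by exact_mod_cast hnm)) hv
  have h3 := Int.le_of_dvd (abs_pos.2 h2) ((dvd_abs _ _).2 h1)
  rw [abs_mul] at h3
  have h4 : |(n : ℤ) - m| ≤ g - 1 := by
    rw [abs_le]; omega
  have h5 : |(n : ℤ) - m| * |v| ≤ (g - 1) * |v| := mul_le_mul_of_nonneg_right h4 (abs_nonneg v)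
  have h6 : (g : ℤ) * |v| ≤ g * coefBound r := mul_le_mul_of_nonneg_left hvr (by omega)
  have h7 : (g : ℤ) * coefBound r ≤ N := by exact_mod_cast hg
  have h8 : 0 < |v| := abs_pos.2 hv
  have h9 : (m : ℤ) ≤ g * |v| - |v| := by linarith
  have h10 : (N : ℤ) ≤ m := by exact_mod_cast hm
  linarith

/-- For moduli in a short window, short longest progressions occur with high probability. -/
lemma IsCoin.prob_forall_hasAP_window_le {η : ℕ → Ω → Bool} (hη : IsCoin P p η) (hp0 : 0 < p)
    {N r g : ℕ} (hr : 20 ≤ r) (hg1 : 1 ≤ g) (hg : g * g ≤ N)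
    {L lam G δ : ℝ} (hL : 1 ≤ L) (hrL : (r : ℝ) + 1 ≤ L) (hpL : 4 * (N : ℝ) ^ 2 * p ^ r ≤ L)
    (hNL : L ^ 12 ≤ N) (hlam : (1 - p) * (N : ℝ) ^ 2 * p ^ r = 2 * lam)
    (hG : Real.exp lam ≤ G) (hδ : 5 * (4 * (N : ℝ) ^ 2 * p ^ r) / r ≤ δ)
    (ha : 0 < Real.exp (-(3 / L)) - 30 / p * (L ^ 7 / N) * G) :
    prob P η (fun x => ∀ n ∈ Finset.Ico N (N + g), HasAP n r x) ≤
      1 / (g / G * (Real.exp (-(3 / L)) - 30 / p * (L ^ 7 / N) * G)) +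
        (Real.exp (δ + 2 * (L ^ 12 / N)) + 570 / p * (L ^ 12 / N) * G ^ 2) /
          (Real.exp (-(3 / L)) - 30 / p * (L ^ 7 / N) * G) ^ 2 - 1 := by
  classical
  have hp1 := hη.le_one
  have hL0 : 0 < L := by linarith
  have hN1 : (1 : ℝ) ≤ N := (one_le_pow₀ hL).trans hNL
  have hN0 : (0 : ℝ) < N := by linarith
  have hNpos : 0 < N := by exact_mod_cast hN0
  have hgN : g ≤ N := (Nat.le_mul_self g).trans hg
  have hg0 : (0 : ℝ) < g := by exact_mod_cast hg1
  have hG0 : 0 < G := (Real.exp_pos _).trans_le hG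
  have hμ0 : 0 ≤ (N : ℝ) ^ 2 * p ^ r := by positivity
  have hgL : (g : ℝ) * L ^ 2 ≤ N := by
    have h1 : (g : ℝ) * g ≤ N := by exact_mod_cast hg
    have h2 : L ^ 4 ≤ N := (pow_le_pow_right₀ hL (by norm_num)).trans hNL
    refine abs_le_of_sq_le_sq' ?_ hN0.le |>.2
    calc ((g : ℝ) * L ^ 2) ^ 2 = ((g : ℝ) * g) * L ^ 4 := by ring
      _ ≤ (N : ℝ) * N := by gcongr
      _ = (N : ℝ) ^ 2 := by ring
  have hcoef : g * coefBound r ≤ N := by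
    have h1 : ((g * coefBound r : ℕ) : ℝ) ≤ N := by
      refine le_trans ?_ hgL
      rw [coefBound]
      push_cast
      refine mul_le_mul_of_nonneg_left ?_ hg0.le
      have : ((r : ℝ) + 1) ^ 2 ≤ L ^ 2 := by gcongr
      have : (0 : ℝ) ≤ r := Nat.cast_nonneg r
      nlinarith
    exact_mod_cast h1
  set a := Real.exp (-(3 / L)) - 30 / p * (L ^ 7 / N) * G with ha_def
  set b := Real.exp (δ + 2 * (L ^ 12 / N)) + 570 / p * (L ^ 12 / N) * G ^ 2 with hb_def
  have hel := Real.exp_pos (-lam)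
  have heG : 1 ≤ Real.exp (-lam) * G := by
    calc (1 : ℝ) = Real.exp (-lam) * Real.exp lam := by rw [← Real.exp_add]; simp
      _ ≤ _ := by gcongr
  have hfd : ∀ n ∈ Finset.Ico N (N + g), FinDep fun x => ¬ HasAP n r x := by
    intro n hn
    rw [Finset.mem_Ico] at hn
    exact (show FinDep (HasAP n r) from ⟨_, dependsOn_hasAP (by omega) r⟩).comp Not
  -- Within the window `n ^ 2` exceeds `N ^ 2` by at most `3 N g`. Since `g ^ 2 ≤ N`, this changes
  -- the intensity by at most `3 / L`, so all single probabilities are at least `exp (-λ)` times the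
  -- common factor `a`.
  have hsingle : ∀ n ∈ Finset.Ico N (N + g), Real.exp (-lam) * a ≤
      prob P η (fun x => ¬ HasAP n r x) := by
    intro n hn
    rw [Finset.mem_Ico] at hn
    have hn1 : (N : ℝ) ≤ n := by exact_mod_cast hn.1
    have hn2 : (n : ℝ) ≤ N + g := by exact_mod_cast hn.2.le
    have hgN' : (g : ℝ) ≤ N := by exact_mod_cast hgN
    have hsq : (n : ℝ) ^ 2 ≤ N ^ 2 + 3 * (N * g) := by nlinarith
    have hn4 : (n : ℝ) ^ 2 * p ^ r ≤ L := by
      refine le_trans ?_ hpL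
      have : (n : ℝ) ^ 2 ≤ 4 * (N : ℝ) ^ 2 := by nlinarith
      gcongr
    have h1 := (abs_le.1 (hη.abs_prob_not_hasAP_sub_le hp0 (by omega) (by omega) hL hrL hn4)).1
    have h2 : 30 / p * (L ^ 7 / n) ≤ Real.exp (-lam) * (30 / p * (L ^ 7 / N) * G) := by
      calc 30 / p * (L ^ 7 / n) ≤ 30 / p * (L ^ 7 / N) * 1 := by rw [mul_one]; gcongr
        _ ≤ 30 / p * (L ^ 7 / N) * (Real.exp (-lam) * G) := by gcongr
        _ = _ := by ring
    have h3 : Real.exp (-lam) * Real.exp (-(3 / L)) ≤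
        Real.exp (-((1 - p) * (n : ℝ) ^ 2 * p ^ r / 2)) := by
      rw [← Real.exp_add]
      apply Real.exp_le_exp.2
      have h4 : (1 - p) * (n : ℝ) ^ 2 * p ^ r ≤ 2 * lam + (1 - p) * (3 * (N * g)) * p ^ r := by
        rw [← hlam]
        have : 0 ≤ (1 - p) * p ^ r := mul_nonneg (by linarith) (by positivity)
        nlinarith
      have h5 : (1 - p) * (3 * (N * g)) * p ^ r ≤ 3 / L := by
        have h6 : (1 - p) * (3 * (N * g)) * p ^ r ≤ 1 * (3 * (N * g)) * p ^ r := by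
          gcongr
          linarith
        refine h6.trans ?_
        rw [le_div_iff₀ hL0]
        refine le_of_mul_le_mul_right ?_ hN0
        calc 1 * (3 * ((N : ℝ) * g)) * p ^ r * L * N
            = 3 * (g * L * ((N : ℝ) ^ 2 * p ^ r)) := by ring
          _ ≤ 3 * (g * L * L) := by
              refine mul_le_mul_of_nonneg_left (mul_le_mul_of_nonneg_left ?_ ?_) ?_
              · linarith
              · positivity
              · norm_num
          _ = 3 * (g * L ^ 2) := by ring
          _ ≤ 3 * N := by gcongr
      have h6 : 0 ≤ 3 / L := by positivity
      linarith
    have h4 : Real.exp (-lam) * a = Real.exp (-lam) * Real.exp (-(3 / L)) -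
        Real.exp (-lam) * (30 / p * (L ^ 7 / N) * G) := by rw [ha_def]; ring
    linarith
  -- Pairs are measured against `exp (-λ) ^ 2`. The additive error is rescaled with `G ≥ exp λ`, so
  -- that only the ratio `b / a ^ 2` enters the second moment bound.
  have hpair : ∀ n ∈ Finset.Ico N (N + g), ∀ m ∈ Finset.Ico N (N + g), n ≠ m →
      prob P η (fun x => ¬ HasAP n r x ∧ ¬ HasAP m r x) ≤ Real.exp (-lam) ^ 2 * b := by
    intro n hn m hm hnm
    rw [Finset.mem_Ico] at hn hm
    refine (hη.prob_not_hasAP_and_le hp0 hr hNpos hn.1 hm.1 (by omega) (by omega) hnm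
      (fun v hv hvr => not_dvd_mul_of_close hn.1 hn.2 hm.1 hm.2 hnm hcoef hv hvr)
      hL hrL hpL hNL).trans ?_
    have e1 : Real.exp (-lam) ^ 2 = Real.exp (-(2 * lam)) := by
      rw [← Real.exp_nat_mul]
      congr 1
      push_cast; ring
    rw [hb_def, mul_add, e1, ← Real.exp_add, hlam]
    refine add_le_add (Real.exp_le_exp.2 (by linarith)) ?_
    rw [← e1]
    calc 570 / p * (L ^ 12 / N) = 570 / p * (L ^ 12 / N) * 1 ^ 2 := by ring
      _ ≤ 570 / p * (L ^ 12 / N) * (Real.exp (-lam) * G) ^ 2 := by gcongr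
      _ = _ := by ring
  have hb0 : 0 ≤ b := by positivity
  have hmain := hη.prob_forall_not_le_of_pairs (T := Finset.Ico N (N + g))
    (A := fun n x => ¬ HasAP n r x) (Finset.nonempty_Ico.2 (by omega)) hfd
    (m := Real.exp (-lam) * a) (v := Real.exp (-lam) ^ 2 * b) (by positivity) (by positivity)
    hsingle hpair
  simp only [not_not] at hmain
  refine hmain.trans ?_
  have hcard : ((Finset.Ico N (N + g)).card : ℝ) = g := by simp
  rw [hcard]
  have e2 : Real.exp (-lam) ^ 2 * b / (Real.exp (-lam) * a) ^ 2 = b / a ^ 2 := by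
    field_simp
  rw [e2]
  have h1 : 1 / ((g : ℝ) * (Real.exp (-lam) * a)) ≤ 1 / (g / G * a) := by
    apply one_div_le_one_div_of_le (by positivity)
    have : (g : ℝ) / G ≤ g * Real.exp (-lam) := by
      rw [div_le_iff₀ hG0, mul_assoc]
      exact le_mul_of_one_le_right hg0.le heG
    calc (g : ℝ) / G * a ≤ g * Real.exp (-lam) * a := by gcongr
      _ = _ := by ring
  linarith

end Liminf

/-! ### The lower limit `D` -/

section LiminfLimit

variable {Ω : Type*} [MeasurableSpace Ω] {P : Measure Ω} [IsProbabilityMeasure P] {p : ℝ}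
  {ξ : ℕ → Ω → ℝ}

lemma tendsto_log_pow_div_mul_rpow (κ : ℝ) (k : ℕ) {s : ℝ} (hs : s < 1) :
    Tendsto (fun N : ℕ => (κ * Real.log N) ^ k / N * (N : ℝ) ^ s) atTop (𝓝 0) := by
  have h := ((tendsto_log_pow_mul_rpow_neg k (by linarith : 0 < 1 - s)).comp
    tendsto_natCast_atTop_atTop).const_mul (κ ^ k)
  rw [mul_zero] at h
  refine h.congr' ?_
  filter_upwards [eventually_gt_atTop 0] with N hN
  have hN' : (0 : ℝ) < N := by exact_mod_cast hN
  simp only [Function.comp]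
  rw [mul_pow, neg_sub, Real.rpow_sub hN', Real.rpow_one]
  ring

lemma tendsto_sqrt_div_rpow :
    Tendsto (fun N : ℕ => (Nat.sqrt N : ℝ) / (N : ℝ) ^ (1 / 8 : ℝ)) atTop atTop := by
  have h1 : Tendsto (fun N : ℕ => 1 / 2 * (N : ℝ) ^ (3 / 8 : ℝ)) atTop atTop :=
    ((tendsto_rpow_atTop (by norm_num)).comp tendsto_natCast_atTop_atTop).const_mul_atTop
      (by norm_num)
  refine tendsto_atTop_mono' _ ?_ h1
  filter_upwards [eventually_ge_atTop 1] with N hN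
  have hN0 : (0 : ℝ) < N := by exact_mod_cast hN
  rw [le_div_iff₀ (Real.rpow_pos_of_pos hN0 _), mul_assoc, ← Real.rpow_add hN0]
  have h2 : (N : ℝ) ≤ (2 * Nat.sqrt N) ^ 2 := by
    have h3 : N < (Nat.sqrt N + 1) * (Nat.sqrt N + 1) := Nat.lt_succ_sqrt N
    have h4 : 1 ≤ Nat.sqrt N := Nat.sqrt_pos.2 hN
    have h5 : N ≤ (2 * Nat.sqrt N) ^ 2 := by nlinarith
    exact_mod_cast h5
  have h3 : (N : ℝ) ^ (3 / 8 + 1 / 8 : ℝ) = √N := by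
    rw [Real.sqrt_eq_rpow]; norm_num
  have h4 := Real.sqrt_le_iff.2 ⟨by positivity, h2⟩
  rw [h3]
  linarith

lemma tendsto_window_bound {κ τ β : ℝ} (hκ : 0 < κ) (hβ : β < 1) :
    Tendsto (fun N : ℕ => Real.exp (-(3 / (κ * Real.log N)))
        - 30 / p * ((κ * Real.log N) ^ 7 / N) * (N : ℝ) ^ (1 / 8 : ℝ)) atTop (𝓝 1) ∧
    Tendsto (fun N : ℕ => 1 / ((Nat.sqrt N : ℝ) / (N : ℝ) ^ (1 / 8 : ℝ) *
          (Real.exp (-(3 / (κ * Real.log N)))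
            - 30 / p * ((κ * Real.log N) ^ 7 / N) * (N : ℝ) ^ (1 / 8 : ℝ))) +
        (Real.exp (τ * Real.log N ^ (β - 1) + 2 * ((κ * Real.log N) ^ 12 / N))
          + 570 / p * ((κ * Real.log N) ^ 12 / N) * ((N : ℝ) ^ (1 / 8 : ℝ)) ^ 2) /
          (Real.exp (-(3 / (κ * Real.log N)))
            - 30 / p * ((κ * Real.log N) ^ 7 / N) * (N : ℝ) ^ (1 / 8 : ℝ)) ^ 2 - 1)
      atTop (𝓝 0) := by
  have ha : Tendsto (fun N : ℕ => Real.exp (-(3 / (κ * Real.log N)))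
        - 30 / p * ((κ * Real.log N) ^ 7 / N) * (N : ℝ) ^ (1 / 8 : ℝ)) atTop (𝓝 1) := by
    have t1 := ((tendsto_log_nat.const_mul_atTop hκ).const_div_atTop 3).neg
    have t2 := (Real.continuous_exp.tendsto _).comp t1
    have t3 := (tendsto_log_pow_div_mul_rpow κ 7 (by norm_num : (1 / 8 : ℝ) < 1)).const_mul (30 / p)
    have := t2.sub t3
    simp only [neg_zero, Real.exp_zero, mul_zero, sub_zero] at this
    refine this.congr fun N => ?_
    simp only [Function.comp]
    ring
  refine ⟨ha, ?_⟩
  have hb : Tendsto (fun N : ℕ => Real.exp (τ * Real.log N ^ (β - 1)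
        + 2 * ((κ * Real.log N) ^ 12 / N))
      + 570 / p * ((κ * Real.log N) ^ 12 / N) * ((N : ℝ) ^ (1 / 8 : ℝ)) ^ 2) atTop (𝓝 1) := by
    have t1 := ((tendsto_rpow_neg_atTop (by linarith : 0 < 1 - β)).comp tendsto_log_nat).const_mul τ
    have t2 := (tendsto_log_pow_div_mul_rpow κ 12 (by norm_num : (0 : ℝ) < 1)).const_mul 2
    have t3 := (Real.continuous_exp.tendsto _).comp (t1.add t2)
    have t4 := (tendsto_log_pow_div_mul_rpow κ 12 (by norm_num : (1 / 4 : ℝ) < 1)).const_mul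
      (570 / p)
    have := t3.add t4
    simp only [mul_zero, add_zero, Real.exp_zero] at this
    refine this.congr fun N => ?_
    simp only [Function.comp, Real.rpow_zero, mul_one, neg_sub]
    rw [← Real.rpow_natCast ((N : ℝ) ^ (1 / 8 : ℝ)), ← Real.rpow_mul (Nat.cast_nonneg N)]
    norm_num
    ring
  have hg := (tendsto_sqrt_div_rpow.atTop_mul_pos one_pos ha).const_div_atTop 1
  have := (hg.add (hb.div (ha.pow 2) (by norm_num))).sub_const 1
  simpa using this

lemma ae_frequently_normW_le (hp0 : 0 < p) (hp1 : p < 1) (hη : IsCoin P p (bit ξ)) {ε : ℝ}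
    (hε : 0 < ε) : ∀ᵐ ω ∂P, ∃ᶠ n : ℕ in atTop, normW ξ p n ω ≤ D p + ε := by
  have hl := Real.log_neg hp0 hp1
  have hC := C_pos hp0 hp1
  set c := D p + ε with hc
  have hDc : D p ≤ c := by linarith
  -- Here `β = 1 + ε log p < 1`, so the intensity at the chosen level is at most of order `(log N) ^
  -- β = o(log N)`. Probabilities of short lengths then decay more slowly than any fixed negative
  -- power of `N`.
  set β := c * Real.log p with hβ
  have hβ1 : β < 1 := by
    rw [hβ, hc, add_mul, D, one_div_mul_cancel hl.ne]
    nlinarith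
  -- The first three summands bound `r + 1` and the last bounds `4 N ^ 2 p ^ r`, both in units of
  -- `log N`.
  set κ := C p + |c| + 1 + 4 / p with hκ
  have hκ0 : 0 < κ := by positivity
  set τ := 80 / (p * C p) with hτ
  obtain ⟨ha, he⟩ := tendsto_window_bound (p := p) (τ := τ) hκ0 hβ1
  have hβlim : Tendsto (fun N : ℕ => Real.log N ^ (β - 1)) atTop (𝓝 0) := by
    have := (tendsto_rpow_neg_atTop (by linarith : 0 < 1 - β)).comp tendsto_log_nat
    rwa [neg_sub] at this
  refine ae_frequently_mem (T := fun N => {n | n ∈ Finset.Ico N (N + Nat.sqrt N)})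
    (A := fun n => {ω | normW ξ p n ω ≤ c}) ?_ he ?_
  · intro N
    filter_upwards [eventually_ge_atTop N] with J hJ n hn
    exact hJ.trans (Finset.mem_Ico.1 hn).1
  have t1 := hβlim.const_mul ((1 - p) / (2 * p))
  rw [mul_zero] at t1
  have t2 := tendsto_log_pow_div_mul_rpow κ 12 (by norm_num : (0 : ℝ) < 1)
  filter_upwards [ha.eventually (lt_mem_nhds one_pos),
    t1.eventually (eventually_le_nhds (by norm_num : (0 : ℝ) < 1 / 8)),
    t2.eventually (eventually_le_nhds one_pos),
    (tendsto_log_nat.const_mul_atTop (half_pos hC)).eventually_ge_atTop 22,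
    (tendsto_log_nat.const_mul_atTop (by positivity : 0 < C p / 4)).eventually_ge_atTop 1,
    tendsto_log_nat.eventually_ge_atTop 1, tendsto_log_log_nat.eventually_gt_atTop 0,
    eventually_ge_atTop 2] with N h1 h2 h3 h4 h5 h6 h7 h8
  have hN : (0 : ℝ) < N := by exact_mod_cast (by omega : 0 < N)
  set y := Real.log N with hy
  have hy0 : 0 < y := by linarith
  have hly : Real.log y ≤ y := (Real.log_le_sub_one_of_pos hy0).trans (by linarith)
  set z := C p * y + c * Real.log y with hz
  have hzlow : C p / 2 * y ≤ z := C_div_two_mul_le hp0 hp1 hDc h6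
  set r := ⌊z⌋₊ with hr
  have hrz : (r : ℝ) ≤ z := Nat.floor_le (by linarith)
  have hrz' : z < r + 1 := Nat.lt_floor_add_one z
  have hr20 : 20 ≤ r := Nat.le_floor (by norm_num; linarith)
  have hr0 : (0 : ℝ) < r := by exact_mod_cast (by omega : 0 < r)
  have hrC : C p / 4 * y ≤ r := by linarith
  have hβy : y ^ β = y ^ (β - 1) * y := by
    rw [Real.rpow_sub_one hy0.ne']
    field_simp
  have hβ0 : 0 < y ^ β := Real.rpow_pos_of_pos hy0 _
  have hβy1 : y ^ β ≤ y := by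
    calc y ^ β ≤ y ^ (1 : ℝ) := Real.rpow_le_rpow_of_exponent_le h6 hβ1.le
      _ = y := Real.rpow_one y
  have hμ : (N : ℝ) ^ 2 * p ^ r ≤ y ^ β / p := by
    rw [sq_mul_pow_eq_rpow hp0 hp1 (by omega), hβ, ← rpow_mul_log hp0 _ hy0]
    have : p ^ (c * Real.log y) / p = p ^ (c * Real.log y - 1) := by
      rw [Real.rpow_sub_one hp0.ne']
    rw [this]
    exact Real.rpow_le_rpow_of_exponent_ge hp0 hp1.le (by linarith)
  have hμ0 : 0 ≤ (N : ℝ) ^ 2 * p ^ r := by positivity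
  have hκy : κ * y = (C p + |c| + 1) * y + 4 / p * y := by rw [hκ]; ring
  have h4y : 0 < 4 / p * y := by positivity
  have hcy : c * Real.log y ≤ |c| * y :=
    (mul_le_mul_of_nonneg_right (le_abs_self c) (Real.log_nonneg h6)).trans
      (mul_le_mul_of_nonneg_left hly (abs_nonneg c))
  have hL : 1 ≤ κ * y := by
    have : 1 * 1 ≤ (C p + |c| + 1) * y := by
      apply mul_le_mul _ h6 zero_le_one (by positivity)
      have := abs_nonneg c
      linarith
    linarith
  have hrL : (r : ℝ) + 1 ≤ κ * y := by
    have : (C p + |c| + 1) * y = C p * y + |c| * y + y := by ring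
    linarith
  have hpL : 4 * (N : ℝ) ^ 2 * p ^ r ≤ κ * y := by
    have e : 4 / p * y = 4 * (y / p) := by ring
    have h9 : y ^ β / p ≤ y / p := by gcongr
    have h10 : 0 ≤ (C p + |c| + 1) * y := by positivity
    linarith
  have hNL : (κ * y) ^ 12 ≤ N := by
    rw [Real.rpow_zero, mul_one, div_le_one hN] at h3
    exact h3
  -- Any fixed small power works since the exponent is `o(log N)`. With `1 / 8`, the expected number
  -- of good moduli among `√N` still diverges, and the rescaled errors, which involve `G ^ 2 = N ^
  -- (1/4)`, still vanish.
  have hG : Real.exp ((1 - p) * (N : ℝ) ^ 2 * p ^ r / 2) ≤ (N : ℝ) ^ (1 / 8 : ℝ) := by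
    rw [Real.rpow_def_of_pos hN]
    apply Real.exp_le_exp.2
    have h9 : (1 - p) / 2 * ((N : ℝ) ^ 2 * p ^ r) ≤ (1 - p) / 2 * (y ^ β / p) :=
      mul_le_mul_of_nonneg_left hμ (by linarith)
    have h10 : (1 - p) / 2 * (y ^ β / p) = (1 - p) / (2 * p) * y ^ (β - 1) * y := by
      rw [hβy]; field_simp
    have h11 := mul_le_mul_of_nonneg_right h2 hy0.le
    rw [← hy]
    linarith
  have hδ : 5 * (4 * (N : ℝ) ^ 2 * p ^ r) / r ≤ τ * y ^ (β - 1) := by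
    rw [div_le_iff₀ hr0]
    have h9 : τ * y ^ (β - 1) * (C p / 4 * y) ≤ τ * y ^ (β - 1) * r :=
      mul_le_mul_of_nonneg_left hrC (by positivity)
    have h10 : τ * y ^ (β - 1) * (C p / 4 * y) = 20 * (y ^ β / p) := by
      rw [hβy, hτ]; field_simp; norm_num
    linarith
  have hg1 : 1 ≤ Nat.sqrt N := Nat.sqrt_pos.2 (by omega)
  have hmain := hη.prob_forall_hasAP_window_le hp0 hr20 hg1 (Nat.sqrt_le N) hL hrL hpL hNL
    (lam := (1 - p) * (N : ℝ) ^ 2 * p ^ r / 2) (by ring) hG hδ h1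
  refine le_trans (measureReal_mono ?_) hmain
  intro ω hω n hn
  have hn' := Finset.mem_Ico.1 hn
  by_contra hAP
  refine hω n hn ?_
  have hyn : y ≤ Real.log n := Real.log_le_log hN (by exact_mod_cast hn'.1)
  have hlln : 0 < Real.log (Real.log n) := h7.trans_le (Real.log_le_log hy0 hyn)
  rw [normW_le_iff hlln]
  refine le_trans ?_ (C_mul_add_log_mono hp0 hp1 hDc h6 hyn)
  refine le_trans ?_ hrz
  have : W ξ n ω < r := by
    by_contra h
    exact hAP ((le_W_iff (by omega) (by omega) ω).1 (not_lt.1 h))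
  exact_mod_cast this.le

/-- The almost sure lower limit of the normalised longest length. -/
theorem ae_liminf_normW (hp0 : 0 < p) (hp1 : p < 1) (hη : IsCoin P p (bit ξ)) :
    ∀ᵐ ω ∂P, liminf (fun n : ℕ => ((normW ξ p n ω : ℝ) : EReal)) atTop = ((D p : ℝ) : EReal) :=
  ae_liminf_coe_eq (fun _ hε => ae_eventually_le_normW hp0 hp1 hη hε)
    fun _ hε => ae_frequently_normW_le hp0 hp1 hη hε

end LiminfLimit

/-! ### Independent events on disjoint blocks of positions -/

section Blocks

variable {Ω : Type*} [MeasurableSpace Ω] {P : Measure Ω} [IsProbabilityMeasure P] {p : ℝ}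
  {η : ℕ → Ω → Bool}

lemma IsCoin.prob_and_of_disjoint (hη : IsCoin P p η) {A B : (ℕ → Bool) → Prop} {S T : Finset ℕ}
    (hA : DependsOn A (S : Set ℕ)) (hB : DependsOn B (T : Set ℕ)) (hST : Disjoint S T) :
    prob P η (fun x => A x ∧ B x) = prob P η A * prob P η B := by
  classical
  have hA' : DependsOn (ind A) (S : Set ℕ) :=
    DependsOn.comp_left (fun a : Prop => if a then (1 : ℝ) else 0) hA
  have hB' : DependsOn (ind B) (T : Set ℕ) :=
    DependsOn.comp_left (fun a : Prop => if a then (1 : ℝ) else 0) hB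
  have h := hη.expct_mul_of_disjoint hA' hB' hST
  rw [hη.expct_ind ⟨S, hA⟩, hη.expct_ind ⟨T, hB⟩] at h
  rw [← h, ← hη.expct_ind ((show FinDep A from ⟨S, hA⟩).comp₂ (· ∧ ·) ⟨T, hB⟩)]
  congr 1
  funext x
  rw [ind_mul]

lemma IsCoin.prob_forall_not_le_pow (hη : IsCoin P p η) {A : ℕ → (ℕ → Bool) → Prop}
    {b : ℕ → ℕ} (hb : Monotone b)
    (hA : ∀ t, DependsOn (A t) (Finset.Ico (b t) (b (t + 1)) : Set ℕ)) {π : ℝ} {T : ℕ}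
    (hπ : ∀ t < T, π ≤ prob P η (A t)) :
    prob P η (fun x => ∀ t < T, ¬ A t x) ≤ (1 - π) ^ T := by
  have key : ∀ T, (∀ t < T, π ≤ prob P η (A t)) →
      DependsOn (fun x => ∀ t < T, ¬ A t x) (Finset.Ico (b 0) (b T) : Set ℕ) ∧
      prob P η (fun x => ∀ t < T, ¬ A t x) ≤ (1 - π) ^ T := by
    intro T
    induction T with
    | zero =>
      intro _
      refine ⟨fun x y _ => by simp, ?_⟩
      simpa using prob_le_one (P := P) (η := η) _
    | succ T ih =>
      intro h
      obtain ⟨h1, h2⟩ := ih fun t ht => h t (by omega)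
      have hnot : DependsOn (fun x => ¬ A T x) (Finset.Ico (b T) (b (T + 1)) : Set ℕ) :=
        DependsOn.comp_left Not (hA T)
      have e : (fun x => ∀ t < T + 1, ¬ A t x) = fun x => (∀ t < T, ¬ A t x) ∧ ¬ A T x := by
        funext x
        exact propext Nat.forall_lt_succ_right
      have hdisj : Disjoint (Finset.Ico (b 0) (b T)) (Finset.Ico (b T) (b (T + 1))) :=
        Finset.Ico_disjoint_Ico_consecutive _ _ _
      rw [e]
      constructor
      · have := DependsOn.comp₂ (· ∧ ·) h1 hnot
        rwa [← Finset.coe_union, Finset.Ico_union_Ico_eq_Ico (hb (Nat.zero_le T))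
          (hb (Nat.le_succ T))] at this
      · rw [hη.prob_and_of_disjoint h1 hnot hdisj, pow_succ]
        have h3 : prob P η (fun x => ¬ A T x) ≤ 1 - π := by
          rw [hη.prob_not ⟨_, hA T⟩]
          linarith [h T (by omega)]
        exact mul_le_mul h2 h3 (prob_nonneg _) (h2.trans' (prob_nonneg _))
  exact (key T hπ).2

open Classical in
/-- The patterns modulo `n` avoiding the first `k` positions. -/
noncomputable def famFrom (k n r : ℕ) : Finset (ℕ × ℕ × ℕ) :=
  (fam n r).filter fun α => Disjoint (Finset.range k) (patSupp r α)

lemma dependsOn_exists_famFrom (k : ℕ) {n : ℕ} (hn : 0 < n) (r : ℕ) :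
    DependsOn (fun x => ∃ α ∈ famFrom k n r, Pat r α x) (Finset.Ico k n : Set ℕ) := by
  classical
  intro x y hxy
  refine propext (exists_congr fun α => and_congr_right fun hα => ?_)
  obtain ⟨hα1, hα2⟩ := Finset.mem_filter.1 hα
  refine iff_of_eq ((isLocalFamily_pat r).dependsOn α fun i hi => hxy i ?_)
  obtain ⟨m, a, s⟩ := α
  obtain ⟨rfl, -⟩ := mem_fam.1 hα1
  have h1 : i < m := by
    obtain ⟨j, -, rfl⟩ := Finset.mem_image.1 (Finset.mem_coe.1 hi)
    exact Nat.mod_lt _ hn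
  have h2 : ¬ i < k := fun h =>
    Finset.disjoint_left.1 hα2 (Finset.mem_range.2 h) (Finset.mem_coe.1 hi)
  exact Finset.mem_coe.2 (Finset.mem_Ico.2 ⟨not_lt.1 h2, h1⟩)

/-- At most `(r + 1) k n ≤ n ^ 2 / 8` progressions touch the first `k` positions, and steps of small
order cost no more than a comparable amount. A fixed proportion of all progressions remains. -/
lemma sq_le_card_famFrom {k n r : ℕ} (hn : 0 < n) (hk : 8 * ((r + 1) * k) ≤ n)
    (hr : 8 * r ^ 2 ≤ n) : n * n ≤ 4 * (famFrom k n r).card := by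
  classical
  have h1 := le_card_filter_fam hn r ∅
  simp only [Finset.notMem_empty, not_false_eq_true, Finset.filter_true, Finset.card_empty,
    add_zero] at h1
  have h2 := card_filter_touch_le n r (Finset.range k)
  rw [Finset.card_range] at h2
  have h3 := Finset.card_filter_add_card_filter_not (s := fam n r)
    (fun α => Disjoint (Finset.range k) (patSupp r α))
  have h4 : (famFrom k n r).card =
    ((fam n r).filter fun α => Disjoint (Finset.range k) (patSupp r α)).card := rfl
  have h5 : 8 * ((r + 1) * k * n) ≤ n * n := by
    calc 8 * ((r + 1) * k * n) = 8 * ((r + 1) * k) * n := by ring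
      _ ≤ n * n := Nat.mul_le_mul_right n hk
  have h6 : 8 * (n * r ^ 2) ≤ n * n := by
    calc 8 * (n * r ^ 2) = 8 * r ^ 2 * n := by ring
      _ ≤ n * n := Nat.mul_le_mul_right n hr
  have h7 : 2 * n * r ^ 2 = 2 * (n * r ^ 2) := by ring
  omega

lemma IsCoin.le_prob_exists_famFrom (hη : IsCoin P p η) (hp : 0 < p) {k n r : ℕ} (hn : 0 < n)
    (hr1 : 1 ≤ r) (hk : 8 * ((r + 1) * k) ≤ n) {L : ℝ} (hL : 1 ≤ L) (hrL : (r : ℝ) + 1 ≤ L)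
    (hpL : (n : ℝ) ^ 2 * p ^ r ≤ 1) (hLn : L ^ 7 ≤ n) (hLn2 : 8 * L ^ 2 ≤ n) :
    (1 - p) * ((n : ℝ) ^ 2 * p ^ r) / 8 - 21 / p * (L ^ 7 / n) ≤
      prob P η (fun x => ∃ α ∈ famFrom k n r, Pat r α x) := by
  classical
  have hn0 : (0 : ℝ) < n := by exact_mod_cast hn
  have hp1 := hη.le_one
  have hsub : famFrom k n r ⊆ fam n r := Finset.filter_subset _ _
  have hr2 : 8 * r ^ 2 ≤ n := by
    have : 8 * (r : ℝ) ^ 2 ≤ n := by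
      refine le_trans ?_ hLn2
      have : (r : ℝ) ≤ L := by linarith
      gcongr
    exact_mod_cast this
  have hcard := sq_le_card_famFrom hn hk hr2
  have hρ : L ^ 3 / n ≤ 1 := by
    rw [div_le_one hn0]
    exact (pow_le_pow_right₀ hL (by norm_num)).trans hLn
  have hb := hη.dep_same_le hp hn hr1 hsub hL hrL (hpL.trans hL)
  have hb0 : 0 ≤ 7 / p * L ^ 7 / n := by positivity
  have hmain := (abs_le.1 (hη.abs_prob_none_sub_exp_le (isLocalFamily_pat r) (F := famFrom k n r)
    (ρ := L ^ 3 / n) (by positivity)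
    (fun α _ => hη.sum_adj_prob_le_of_log hp hn hsub hL hrL (hpL.trans hL) α) hb hb0)).2
  have herr : 7 / p * L ^ 7 / n * (1 + 2 * (L ^ 3 / n)) ≤ 21 / p * (L ^ 7 / n) := by
    have e : 21 / p * (L ^ 7 / n) = 7 / p * L ^ 7 / n * 3 := by ring
    rw [e]
    exact mul_le_mul_of_nonneg_left (by linarith) hb0
  rw [hη.sum_prob_pat hsub] at hmain
  have hnot : prob P η (fun x => ∀ α ∈ famFrom k n r, ¬ Pat r α x) =
      1 - prob P η (fun x => ∃ α ∈ famFrom k n r, Pat r α x) := by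
    rw [← hη.prob_not ⟨_, dependsOn_exists_famFrom k hn r⟩]
    simp only [not_exists, not_and]
  rw [hnot] at hmain
  set y := (1 - p) * ((n : ℝ) ^ 2 * p ^ r) / 4 with hy
  have hy0 : 0 ≤ y := by
    have : 0 ≤ 1 - p := by linarith
    positivity
  have hy1 : y ≤ 1 := by
    have : (1 - p) * ((n : ℝ) ^ 2 * p ^ r) ≤ 1 * 1 :=
      mul_le_mul (by linarith) hpL (by positivity) zero_le_one
    linarith
  have hyc : y ≤ (famFrom k n r).card * ((1 - p) * p ^ r) := by
    have h1 : (n : ℝ) * n ≤ 4 * (famFrom k n r).card := by exact_mod_cast hcard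
    have h2 : 0 ≤ (1 - p) * p ^ r := mul_nonneg (by linarith) (by positivity)
    have h3 := mul_le_mul_of_nonneg_right h1 h2
    rw [hy]
    linarith
  -- The inequality `1 - exp (-y) ≥ y / 2` for `0 ≤ y ≤ 1` turns the Poisson estimate into a lower
  -- bound linear in the intensity.
  have hexp : Real.exp (-((famFrom k n r).card * ((1 - p) * p ^ r))) ≤ 1 - y / 2 := by
    refine (Real.exp_le_exp.2 (neg_le_neg hyc)).trans ?_
    have h1 := Real.add_one_le_exp y
    have h2 : Real.exp (-y) * Real.exp y = 1 := by rw [← Real.exp_add]; simp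
    have h3 := Real.exp_pos (-y)
    have h4 := mul_le_mul_of_nonneg_left h1 h3.le
    refine le_of_mul_le_mul_right ?_ (by linarith : 0 < y + 1)
    nlinarith
  linarith

end Blocks

/-! ### Long progressions for infinitely many powers of two -/

section PowersOfTwo

variable {Ω : Type*} [MeasurableSpace Ω] {P : Measure Ω} [IsProbabilityMeasure P] {p : ℝ}
  {ξ : ℕ → Ω → ℝ} {ε : ℝ}

/-- The length `C log n - (D + ε) log log n`, rounded up. -/
noncomputable def highLevel (p ε : ℝ) (n : ℕ) : ℕ :=
  ⌈C p * Real.log n + (-D p - ε) * Real.log (Real.log n)⌉₊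

/-- At this level the intensity has order `(log n) ^ (s - 1)` with `s = -ε log p > 0`, far above the
approximation error of order `log n ^ 7 / n`. Taking `ε ≤ -D` keeps the level at or above `C log n`,
so the intensity is at most 1. -/
lemma eventually_le_prob_highLevel {η : ℕ → Ω → Bool} (hη : IsCoin P p η) (hp0 : 0 < p)
    (hp1 : p < 1) (hε : 0 < ε) (hε' : ε ≤ -D p) : ∀ᶠ n : ℕ in atTop,
      1 ≤ highLevel p ε n ∧ (highLevel p ε n : ℝ) + 1 ≤ (C p - D p + 2) * Real.log n ∧
      ∀ k, 8 * ((highLevel p ε n + 1) * k) ≤ n →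
        (1 - p) * p / 16 * Real.log n ^ (-ε * Real.log p - 1) ≤
          prob P η (fun x => ∃ α ∈ famFrom k n (highLevel p ε n), Pat (highLevel p ε n) α x) := by
  have hl := Real.log_neg hp0 hp1
  have hC := C_pos hp0 hp1
  have hD := D_neg hp0 hp1
  have hq : 0 < 1 - p := by linarith
  set κ := C p - D p + 2 with hκ
  have hκ1 : 1 ≤ κ := by linarith
  set s := -ε * Real.log p with hs
  have hs0 : 0 < s := by nlinarith
  have hDl : D p * Real.log p = 1 := by rw [D, one_div_mul_cancel hl.ne]
  have hs1 : s ≤ 1 := by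
    have := mul_le_mul_of_nonneg_right hε' (by linarith : 0 ≤ -Real.log p)
    linarith
  have t7 := tendsto_log_pow_div_mul_rpow κ 7 (by norm_num : (0 : ℝ) < 1)
  have t2 := (tendsto_log_pow_div_mul_rpow κ 2 (by norm_num : (0 : ℝ) < 1)).const_mul 8
  rw [mul_zero] at t2
  have t8 := (tendsto_log_pow_div_nat 8).const_mul (21 / p * κ ^ 7)
  rw [mul_zero] at t8
  filter_upwards [t7.eventually (eventually_le_nhds one_pos),
    t2.eventually (eventually_le_nhds one_pos),
    t8.eventually (eventually_le_nhds (by positivity : 0 < (1 - p) * p / 16)),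
    tendsto_log_nat.eventually_ge_atTop 1, eventually_gt_atTop 0] with n h1 h2 h3 h4 h5
  have hn : (0 : ℝ) < n := by exact_mod_cast h5
  rw [Real.rpow_zero, mul_one, div_le_one hn] at h1
  rw [Real.rpow_zero, mul_one, ← mul_div_assoc, div_le_one hn] at h2
  set y := Real.log n with hy
  have hy0 : 0 < y := by linarith
  have hly0 : 0 ≤ Real.log y := Real.log_nonneg h4
  have hly : Real.log y ≤ y := (Real.log_le_sub_one_of_pos hy0).trans (by linarith)
  set x := (-D p - ε) * Real.log y with hx
  have hx0 : 0 ≤ x := mul_nonneg (by linarith) hly0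
  have hxy : x ≤ -D p * y := by
    calc x ≤ -D p * Real.log y := mul_le_mul_of_nonneg_right (by linarith) hly0
      _ ≤ -D p * y := mul_le_mul_of_nonneg_left hly (by linarith)
  have hCy : 0 < C p * y := by positivity
  set r := highLevel p ε n with hr
  have hr1 : 1 ≤ r := Nat.one_le_iff_ne_zero.2 (Nat.ceil_pos.2 (by linarith)).ne'
  have hrlow : C p * y + x ≤ r := Nat.le_ceil _
  have hrup : (r : ℝ) < C p * y + x + 1 := Nat.ceil_lt_add_one (by linarith)
  have hrL : (r : ℝ) + 1 ≤ κ * y := by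
    have : κ * y = C p * y + -D p * y + 2 * y := by rw [hκ]; ring
    linarith
  refine ⟨hr1, hrL, fun k hk => ?_⟩
  have hL : 1 ≤ κ * y := by
    calc (1 : ℝ) = 1 * 1 := by ring
      _ ≤ κ * y := by gcongr
  have hpx : p ^ x = y ^ (s - 1) := by
    rw [hx, rpow_mul_log hp0 _ hy0]
    congr 1
    rw [hs]
    linarith
  have hlow : p * y ^ (s - 1) ≤ (n : ℝ) ^ 2 * p ^ r := by
    rw [sq_mul_pow_eq_rpow hp0 hp1 h5, ← hpx]
    have : p * p ^ x = p ^ (1 + x) := by rw [Real.rpow_add hp0, Real.rpow_one]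
    rw [this]
    exact Real.rpow_le_rpow_of_exponent_ge hp0 hp1.le (by linarith)
  have hup : (n : ℝ) ^ 2 * p ^ r ≤ 1 := by
    rw [sq_mul_pow_eq_rpow hp0 hp1 h5]
    exact Real.rpow_le_one hp0.le hp1.le (by linarith)
  have hmain := hη.le_prob_exists_famFrom hp0 h5 hr1 hk hL hrL hup h1 h2
  refine le_trans ?_ hmain
  have hys : y ^ (s - 1) = y ^ s / y := Real.rpow_sub_one hy0.ne' s
  have hys1 : 1 ≤ y ^ s := Real.one_le_rpow h4 hs0.le
  have herr : 21 / p * ((κ * y) ^ 7 / n) ≤ (1 - p) * p / 16 * y ^ (s - 1) := by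
    have h6 : 21 / p * ((κ * y) ^ 7 / n) * y ≤ (1 - p) * p / 16 := by
      refine le_trans (le_of_eq ?_) h3
      ring
    rw [hys, ← mul_div_assoc ((1 - p) * p / 16), le_div_iff₀ hy0]
    exact h6.trans (le_mul_of_one_le_right (by positivity) hys1)
  have h7 := mul_le_mul_of_nonneg_left hlow hq.le
  linarith

/-- About `2 ^ J / (4 J)` independent trials with success probability of order `2 ^ (J (s - 1))`
give an exponent of order `2 ^ (J s) / J`, which diverges. -/
lemma tendsto_block_bound {c s : ℝ} (hc : 0 < c) (hs : 0 < s) :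
    Tendsto (fun J : ℕ => Real.exp (-(c * ((2 : ℝ) * 2 ^ J) ^ (s - 1) * ((2 ^ J / (4 * J) : ℕ) : ℝ))))
      atTop (𝓝 0) := by
  have hl2 : 0 < Real.log 2 := Real.log_pos (by norm_num)
  have hsl : 0 < s * Real.log 2 := by positivity
  have h1 : Tendsto (fun J : ℕ => c / 16 * (s * Real.log 2) *
      (Real.exp (s * Real.log 2 * J) / (s * Real.log 2 * J) ^ 1)) atTop atTop :=
    ((Real.tendsto_exp_div_pow_atTop 1).comp
      (tendsto_natCast_atTop_atTop.const_mul_atTop hsl)).const_mul_atTop (by positivity)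
  refine Real.tendsto_exp_neg_atTop_nhds_zero.comp (tendsto_atTop_mono' _ ?_ h1)
  filter_upwards [eventually_ge_atTop 4] with J hJ
  have hJ0 : (0 : ℝ) < J := by exact_mod_cast (by omega : 0 < J)
  have h4J : 4 * J ≤ 2 ^ J := by
    induction J, hJ using Nat.le_induction with
    | base => norm_num
    | succ J hJ ih =>
      have := ih (by exact_mod_cast (by omega : 0 < J))
      rw [pow_succ]; omega
  have hT1 : 1 ≤ 2 ^ J / (4 * J) := (Nat.one_le_div_iff (by omega)).2 h4J
  have hT : (2 : ℝ) ^ J ≤ 8 * J * ((2 ^ J / (4 * J) : ℕ) : ℝ) := by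
    have h2 := Nat.lt_div_mul_add (a := 2 ^ J) (b := 4 * J) (by omega)
    have h3 : 4 * J ≤ 2 ^ J / (4 * J) * (4 * J) := Nat.le_mul_of_pos_left _ hT1
    have h4 : 8 * J * (2 ^ J / (4 * J)) = 2 ^ J / (4 * J) * (4 * J) + 2 ^ J / (4 * J) * (4 * J) := by
      ring
    have h5 : 2 ^ J ≤ 8 * J * (2 ^ J / (4 * J)) := by omega
    exact_mod_cast h5
  have h2J : (0 : ℝ) < 2 ^ J := by positivity
  have e1 : Real.exp (s * Real.log 2 * J) = ((2 : ℝ) ^ J) ^ s := by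
    rw [Real.rpow_def_of_pos h2J, Real.log_pow]
    ring_nf
  have h6 : ((2 : ℝ) ^ J) ^ s ≤ (2 * 2 ^ J) ^ s :=
    Real.rpow_le_rpow h2J.le (by linarith) hs.le
  have h7 : ((2 : ℝ) * 2 ^ J) ^ (s - 1) = (2 * 2 ^ J) ^ s / (2 * 2 ^ J) :=
    Real.rpow_sub_one (by positivity) s
  have h8 : 0 ≤ c * ((2 * (2 : ℝ) ^ J) ^ s / (2 * 2 ^ J)) / (8 * J) := by positivity
  have h9 := mul_le_mul_of_nonneg_left hT h8
  rw [e1, h7, pow_one]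
  calc c / 16 * (s * Real.log 2) * (((2 : ℝ) ^ J) ^ s / (s * Real.log 2 * J))
      = c / 16 * ((2 : ℝ) ^ J) ^ s / J := by field_simp
    _ ≤ c / 16 * (2 * (2 : ℝ) ^ J) ^ s / J := by gcongr
    _ = c * ((2 * (2 : ℝ) ^ J) ^ s / (2 * 2 ^ J)) / (8 * J) * 2 ^ J := by
        field_simp; norm_num
    _ ≤ c * ((2 * (2 : ℝ) ^ J) ^ s / (2 * 2 ^ J)) / (8 * J) *
          (8 * J * ((2 ^ J / (4 * J) : ℕ) : ℝ)) := h9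
    _ = _ := by field_simp

lemma ae_frequently_le_normW_two_pow (hp0 : 0 < p) (hp1 : p < 1) (hη : IsCoin P p (bit ξ))
    (hε : 0 < ε) (hε' : ε ≤ -D p) :
    ∀ᵐ ω ∂P, ∃ᶠ k : ℕ in atTop, -D p - ε ≤ normW ξ p (2 ^ k) ω := by
  have hl := Real.log_neg hp0 hp1
  have hC := C_pos hp0 hp1
  have hD := D_neg hp0 hp1
  have hq : 0 < 1 - p := by linarith
  have hl2 : 0 < Real.log 2 := Real.log_pos (by norm_num)
  have hl2' : Real.log 2 ≤ 1 := (Real.log_le_sub_one_of_pos (by norm_num)).trans (by norm_num)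
  set s := -ε * Real.log p with hs
  have hs0 : 0 < s := by nlinarith
  have hs1 : s ≤ 1 := by
    have := mul_le_mul_of_nonneg_right hε' (by linarith : 0 ≤ -Real.log p)
    have hDl : D p * Real.log p = 1 := by rw [D, one_div_mul_cancel hl.ne]
    linarith
  set κ := C p - D p + 2 with hκ
  have hκ0 : 0 < κ := by linarith
  set c := (1 - p) * p / 16 with hc
  have hc0 : 0 < c := by positivity
  obtain ⟨n₀, hn₀⟩ := eventually_atTop.1 ((eventually_le_prob_highLevel hη hp0 hp1 hε hε').and
    (tendsto_log_log_nat.eventually_gt_atTop 0))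
  have hpow : Tendsto (fun J : ℕ => (2 : ℝ) ^ J) atTop atTop :=
    tendsto_pow_atTop_atTop_of_one_lt (by norm_num)
  refine ae_frequently_mem (A := fun k => {ω | -D p - ε ≤ normW ξ p (2 ^ k) ω})
    (T := fun J => {k | ∃ t < 2 ^ J / (4 * J), k = 2 ^ J + 4 * J * (t + 1)}) ?_
    (tendsto_block_bound hc0 hs0) ?_
  · intro N
    filter_upwards [eventually_ge_atTop N] with J hJ k hk
    obtain ⟨t, -, rfl⟩ := hk
    have := Nat.lt_two_pow_self (n := J)
    omega
  filter_upwards [eventually_ge_atTop n₀, hpow.eventually_ge_atTop (16 * κ), eventually_ge_atTop 1]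
    with J hJ hκJ hJ1
  -- The spacing `4 J` makes consecutive moduli differ by the factor `(2 ^ J) ^ 4`. This dominates
  -- the length `O(2 ^ J)`, so most progressions mod `b (t + 1)` avoid the first `b t` positions.
  -- The exponents that are used stay below `2 * 2 ^ J`, which keeps the success probabilities
  -- comparable.
  set b : ℕ → ℕ := fun t => 2 ^ (2 ^ J + 4 * J * t) with hb
  have hbm : Monotone b := fun t t' h => Nat.pow_le_pow_right (by norm_num) (by gcongr)
  have hb0 : ∀ t, 0 < b t := fun t => by positivity
  have hbn : ∀ t, n₀ ≤ b t := by
    intro t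
    have h1 := Nat.lt_two_pow_self (n := J)
    have h2 : 2 ^ J + 4 * J * t < b t := Nat.lt_two_pow_self
    omega
  set A : ℕ → (ℕ → Bool) → Prop := fun t x => ∃ α ∈ famFrom (b t) (b (t + 1))
    (highLevel p ε (b (t + 1))), Pat (highLevel p ε (b (t + 1))) α x with hA
  have hprob : ∀ t < 2 ^ J / (4 * J), c * ((2 : ℝ) * 2 ^ J) ^ (s - 1) ≤ prob P (bit ξ) (A t) := by
    intro t ht
    obtain ⟨⟨h1, h2, h3⟩, h4⟩ := hn₀ (b (t + 1)) (hbn _)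
    have hlog : Real.log (b (t + 1) : ℕ) = ((2 ^ J + 4 * J * (t + 1) : ℕ) : ℝ) * Real.log 2 := by
      rw [hb]
      push_cast
      rw [Real.log_pow]
      push_cast
      ring
    have hk : 2 ^ J + 4 * J * (t + 1) ≤ 2 * 2 ^ J := by
      have h5 : (t + 1) * (4 * J) ≤ 2 ^ J := (Nat.mul_le_mul_right _ ht).trans (Nat.div_mul_le_self _ _)
      linarith
    have hk' : ((2 ^ J + 4 * J * (t + 1) : ℕ) : ℝ) ≤ 2 * 2 ^ J := by exact_mod_cast hk
    have hlogle : Real.log (b (t + 1) : ℕ) ≤ 2 * 2 ^ J := by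
      rw [hlog]
      calc _ ≤ (2 * 2 ^ J : ℝ) * 1 := by gcongr
        _ = _ := mul_one _
    have hlog0 : 0 < Real.log (b (t + 1) : ℕ) := by
      rw [hlog]
      have : (0 : ℝ) < ((2 ^ J + 4 * J * (t + 1) : ℕ) : ℝ) := by
        exact_mod_cast (by positivity : 0 < 2 ^ J + 4 * J * (t + 1))
      positivity
    have hgap : 8 * ((highLevel p ε (b (t + 1)) + 1) * b t) ≤ b (t + 1) := by
      have h5 : 8 * ((highLevel p ε (b (t + 1)) : ℝ) + 1) ≤ ((2 : ℝ) ^ J) ^ 4 := by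
        have h6 : (1 : ℝ) ≤ 2 ^ J := one_le_pow₀ (by norm_num)
        calc 8 * ((highLevel p ε (b (t + 1)) : ℝ) + 1) ≤ 8 * (κ * (2 * 2 ^ J)) := by
              have := mul_le_mul_of_nonneg_left hlogle hκ0.le
              linarith
          _ = 16 * κ * 2 ^ J := by ring
          _ ≤ 2 ^ J * 2 ^ J := by gcongr
          _ = ((2 : ℝ) ^ J) ^ 2 := by ring
          _ ≤ ((2 : ℝ) ^ J) ^ 4 := pow_le_pow_right₀ h6 (by norm_num)
      have h7 : 8 * (highLevel p ε (b (t + 1)) + 1) ≤ (2 ^ J) ^ 4 := by exact_mod_cast h5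
      calc 8 * ((highLevel p ε (b (t + 1)) + 1) * b t)
          = 8 * (highLevel p ε (b (t + 1)) + 1) * b t := by ring
        _ ≤ (2 ^ J) ^ 4 * b t := Nat.mul_le_mul_right _ h7
        _ = b (t + 1) := by
            rw [hb]
            simp only
            rw [← pow_mul, ← pow_add]
            congr 1
            ring
    refine le_trans ?_ (h3 (b t) hgap)
    refine mul_le_mul_of_nonneg_left ?_ hc0.le
    exact Real.rpow_le_rpow_of_nonpos hlog0 hlogle (by linarith)
  have hmain := hη.prob_forall_not_le_pow hbm
    (fun t => dependsOn_exists_famFrom (b t) (hb0 (t + 1)) (highLevel p ε (b (t + 1)))) hprob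
  have hsub : P.real {ω | ∀ k ∈ {k | ∃ t < 2 ^ J / (4 * J), k = 2 ^ J + 4 * J * (t + 1)},
      ω ∉ {ω | -D p - ε ≤ normW ξ p (2 ^ k) ω}} ≤
      prob P (bit ξ) (fun x => ∀ t < 2 ^ J / (4 * J), ¬ A t x) := by
    refine measureReal_mono ?_
    intro ω hω t ht hAt
    refine hω _ ⟨t, ht, rfl⟩ ?_
    obtain ⟨α, hα, hPat⟩ := hAt
    obtain ⟨⟨h1, -, -⟩, h4⟩ := hn₀ (b (t + 1)) (hbn _)
    have hAP := hasAP_of_pat (Finset.filter_subset _ _ hα) h1 hPat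
    have hW := (le_W_iff (hb0 (t + 1)) h1 ω).2 hAP
    change -D p - ε ≤ normW ξ p (b (t + 1)) ω
    rw [le_normW_iff h4]
    exact (Nat.le_ceil _).trans (by exact_mod_cast hW)
  refine hsub.trans (hmain.trans ?_)
  rcases Nat.eq_zero_or_pos (2 ^ J / (4 * J)) with h0 | h0
  · rw [h0]; simp
  have hπ1 : c * ((2 : ℝ) * 2 ^ J) ^ (s - 1) ≤ 1 := (hprob 0 h0).trans (prob_le_one _)
  calc _ ≤ Real.exp (-(c * ((2 : ℝ) * 2 ^ J) ^ (s - 1))) ^ (2 ^ J / (4 * J)) := by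
        refine pow_le_pow_left₀ (by linarith) ?_ _
        have := Real.add_one_le_exp (-(c * ((2 : ℝ) * 2 ^ J) ^ (s - 1)))
        linarith
    _ = _ := by
        rw [← Real.exp_nat_mul]
        congr 1
        ring

end PowersOfTwo

/-! ### Upper and lower limits along powers of two -/

section PowersOfTwoLimits

variable {Ω : Type*} [MeasurableSpace Ω] {P : Measure Ω} [IsProbabilityMeasure P] {p : ℝ}
  {ξ : ℕ → Ω → ℝ} {ε : ℝ}

lemma log_two_pow (k : ℕ) : Real.log ((2 ^ k : ℕ) : ℝ) = k * Real.log 2 := by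
  push_cast
  rw [Real.log_pow]

lemma tendsto_two_pow : Tendsto (fun k : ℕ => 2 ^ k) atTop atTop :=
  tendsto_pow_atTop_atTop_of_one_lt one_lt_two

lemma eventually_real_le_normW_two_pow_le (hp0 : 0 < p) (hp1 : p < 1) (hη : IsCoin P p (bit ξ))
    (c : ℝ) : ∀ᶠ k : ℕ in atTop, P.real {ω | c ≤ normW ξ p (2 ^ k) ω} ≤
      Real.log 2 ^ (c * Real.log p) * (k : ℝ) ^ (c * Real.log p) := by
  filter_upwards [tendsto_two_pow.eventually (real_le_normW_le hp0 hp1 hη c)] with k hk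
  refine hk.trans (le_of_eq ?_)
  rw [log_two_pow, Real.mul_rpow (Nat.cast_nonneg k) (Real.log_nonneg (by norm_num)), mul_comm]

lemma tendsto_exp_neg_rpow_mul_sq {a σ : ℝ} (ha : 0 < a) (hσ : 0 < σ) :
    Tendsto (fun x : ℝ => Real.exp (-(a * x ^ σ)) * x ^ 2) atTop (𝓝 0) := by
  have h := ((isLittleO_exp_neg_mul_rpow_atTop ha (-(2 / σ))).tendsto_div_nhds_zero).comp
    (tendsto_rpow_atTop hσ)
  refine h.congr' ?_
  filter_upwards [eventually_gt_atTop 0] with x hx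
  simp only [Function.comp]
  rw [← Real.rpow_mul hx.le, mul_neg, mul_div_cancel₀ _ hσ.ne', Real.rpow_neg hx.le, div_inv_eq_mul,
    neg_mul, ← Real.rpow_natCast x 2]
  norm_num

lemma summable_lower_tail_two_pow (hp0 : 0 < p) (hp1 : p < 1) {K : ℝ} (hK : 0 ≤ K) (hε : 0 < ε) :
    Summable fun k : ℕ => Real.exp (-((1 - p) * p / 2 *
        Real.log ((2 ^ k : ℕ) : ℝ) ^ (-ε * Real.log p)))
      + K * (Real.log ((2 ^ k : ℕ) : ℝ) ^ 7 / ((2 ^ k : ℕ) : ℝ)) := by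
  have h1 : 0 < -ε * Real.log p := by nlinarith [Real.log_neg hp0 hp1]
  have h2 : 0 < (1 - p) * p / 2 := by
    have : 0 < 1 - p := by linarith
    positivity
  have hl2 : 0 < Real.log 2 := Real.log_pos (by norm_num)
  have t1 := (tendsto_exp_neg_rpow_mul_sq h2 h1).comp tendsto_log_nat
  have t2 := (tendsto_log_pow_div_nat 9).const_mul K
  have t3 := ((t1.add t2).comp tendsto_two_pow).mul_const ((Real.log 2 ^ 2)⁻¹)
  rw [mul_zero, add_zero, zero_mul] at t3
  refine summable_of_tendsto_mul_rpow (s := 2) one_lt_two ?_ (t3.congr fun k => ?_)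
  · filter_upwards with k
    have := Real.log_natCast_nonneg (2 ^ k)
    positivity
  · simp only [Function.comp]
    have e : (k : ℝ) ^ (2 : ℝ) = Real.log ((2 ^ k : ℕ) : ℝ) ^ 2 * (Real.log 2 ^ 2)⁻¹ := by
      rw [log_two_pow, mul_pow, mul_assoc, mul_inv_cancel₀ (by positivity), mul_one]
      exact_mod_cast Real.rpow_natCast (k : ℝ) 2
    rw [e]
    ring

/-- The tail is a multiple of `k` to the power `(-D + ε) log p = -1 + ε log p < -1`, so it is
summable. -/
lemma ae_eventually_normW_two_pow_le (hp0 : 0 < p) (hp1 : p < 1) (hη : IsCoin P p (bit ξ))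
    (hε : 0 < ε) : ∀ᵐ ω ∂P, ∀ᶠ k : ℕ in atTop, normW ξ p (2 ^ k) ω ≤ -D p + ε := by
  have hl := Real.log_neg hp0 hp1
  have hsum : Summable fun k : ℕ =>
      Real.log 2 ^ ((-D p + ε) * Real.log p) * (k : ℝ) ^ ((-D p + ε) * Real.log p) := by
    refine Summable.mul_left _ (Real.summable_nat_rpow.2 ?_)
    have hDl : D p * Real.log p = 1 := by rw [D, one_div_mul_cancel hl.ne]
    nlinarith
  filter_upwards [ae_eventually_notMem_of_real_le hsum
    (eventually_real_le_normW_two_pow_le hp0 hp1 hη _)] with ω hω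
  filter_upwards [hω] with k hk
  exact (not_le.1 hk).le

lemma ae_eventually_le_normW_two_pow (hp0 : 0 < p) (hp1 : p < 1) (hη : IsCoin P p (bit ξ))
    (hε : 0 < ε) : ∀ᵐ ω ∂P, ∀ᶠ k : ℕ in atTop, 0 - ε ≤ normW ξ p (2 ^ k) ω := by
  obtain ⟨K, hK0, hK⟩ := exists_real_normW_le_le hp0 hp1
  filter_upwards [ae_eventually_notMem_of_real_le (summable_lower_tail_two_pow hp0 hp1 hK0 hε)
    (tendsto_two_pow.eventually (hK Ω P ξ hη ε hε))] with ω hω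
  filter_upwards [hω] with k hk
  rw [zero_sub]
  exact (not_le.1 hk).le

/-- Vanishing of the upper tail suffices here: one-point windows in `ae_frequently_mem` already give
infinitely many `k`. -/
lemma ae_frequently_normW_two_pow_le (hp0 : 0 < p) (hp1 : p < 1) (hη : IsCoin P p (bit ξ))
    (hε : 0 < ε) : ∀ᵐ ω ∂P, ∃ᶠ k : ℕ in atTop, normW ξ p (2 ^ k) ω ≤ 0 + ε := by
  have hl := Real.log_neg hp0 hp1
  have he := ((tendsto_rpow_neg_atTop (by nlinarith : 0 < -(ε * Real.log p))).comp
    tendsto_natCast_atTop_atTop).const_mul (Real.log 2 ^ (ε * Real.log p))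
  rw [neg_neg, mul_zero] at he
  refine ae_frequently_mem (A := fun k => {ω | normW ξ p (2 ^ k) ω ≤ 0 + ε})
    (T := fun J => {J}) ?_ he ?_
  · intro N
    filter_upwards [eventually_ge_atTop N] with J hJ n hn
    rw [Set.mem_singleton_iff.1 hn]
    exact hJ
  · filter_upwards [eventually_real_le_normW_two_pow_le hp0 hp1 hη ε] with J hJ
    refine (measureReal_mono ?_).trans hJ
    intro ω hω
    have h := hω J (Set.mem_singleton J)
    have h' : ¬ (normW ξ p (2 ^ J) ω ≤ 0 + ε) := h
    rw [zero_add] at h'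
    exact (not_le.1 h').le

/-- The almost sure upper and lower limits along the powers of two. -/
theorem ae_liminf_limsup_normW_two_pow (hp0 : 0 < p) (hp1 : p < 1) (hη : IsCoin P p (bit ξ)) :
    ∀ᵐ ω ∂P,
      liminf (fun n : ℕ => ((normW ξ p (2 ^ n) ω : ℝ) : EReal)) atTop = 0 ∧
      liminf (fun n : ℕ => ((normW ξ p (2 ^ n) ω : ℝ) : EReal)) atTop
        < limsup (fun n : ℕ => ((normW ξ p (2 ^ n) ω : ℝ) : EReal)) atTop ∧
      limsup (fun n : ℕ => ((normW ξ p (2 ^ n) ω : ℝ) : EReal)) atTop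
        = ((-D p : ℝ) : EReal) := by
  have hD := D_neg hp0 hp1
  filter_upwards [ae_liminf_coe_eq (u := fun k ω => normW ξ p (2 ^ k) ω) (c := 0)
      (fun ε hε => ae_eventually_le_normW_two_pow hp0 hp1 hη hε)
      (fun ε hε => ae_frequently_normW_two_pow_le hp0 hp1 hη hε),
    ae_limsup_coe_eq (u := fun k ω => normW ξ p (2 ^ k) ω) (c := -D p)
      (fun ε hε => ae_eventually_normW_two_pow_le hp0 hp1 hη hε)
      (fun ε hε => by
        filter_upwards [ae_frequently_le_normW_two_pow hp0 hp1 hη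
          (lt_min hε (neg_pos.2 hD)) (min_le_right ε (-D p))] with ω hω
        exact hω.mono fun n hn => le_trans (by linarith [min_le_left ε (-D p)]) hn)]
    with ω h1 h2
  refine ⟨h1, ?_, h2⟩
  rw [h1, h2]
  exact EReal.coe_lt_coe_iff.2 (by linarith)

end PowersOfTwoLimits

/-! ### Averages and sets of density zero -/

section Cesaro

/-- This is a form of Kronecker's lemma by dominated convergence: each term `f k / n` with `k ≤ n`
tends to 0 and is dominated by `f k / k`. -/
lemma tendsto_mean_of_summable_div {f : ℕ → ℝ} (hf : ∀ k, 0 ≤ f k)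
    (h : Summable fun k : ℕ => f k / k) :
    Tendsto (fun n : ℕ => (∑ k ∈ Finset.Icc 1 n, f k) / n) atTop (𝓝 0) := by
  have h1 := tendsto_tsum_of_dominated_convergence (𝓕 := atTop)
    (f := fun n k => if k ∈ Finset.Icc 1 n then f k / n else 0) (g := fun _ => (0 : ℝ)) h ?_ ?_
  · rw [tsum_zero] at h1
    refine h1.congr fun n => ?_
    rw [tsum_eq_sum (s := Finset.Icc 1 n) fun k hk => if_neg hk, Finset.sum_div]
    exact Finset.sum_congr rfl fun k hk => if_pos hk
  · intro k
    refine squeeze_zero (fun n => ?_) (fun n => ?_)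
      (tendsto_natCast_atTop_atTop.const_div_atTop (f k))
    · split_ifs
      · exact div_nonneg (hf k) (Nat.cast_nonneg n)
      · exact le_rfl
    · split_ifs
      · exact le_rfl
      · exact div_nonneg (hf k) (Nat.cast_nonneg n)
  · refine Eventually.of_forall fun n k => ?_
    split_ifs with hk
    · rw [Finset.mem_Icc] at hk
      have hk0 : (0 : ℝ) < k := by exact_mod_cast hk.1
      rw [Real.norm_of_nonneg (div_nonneg (hf k) (Nat.cast_nonneg n))]
      exact div_le_div_of_nonneg_left (hf k) hk0 (by exact_mod_cast hk.2)
    · rw [norm_zero]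
      exact div_nonneg (hf k) (Nat.cast_nonneg k)

-- Indices with `|v k| < ε / 2` contribute less than `ε / 2` to the mean. The others have density
-- zero and their values are bounded.
open Classical in
lemma tendsto_mean_abs {v : ℕ → ℝ} {B : ℝ} (hB : ∀ᶠ k in atTop, |v k| ≤ B)
    (h : ∀ ε > 0, Tendsto (fun n : ℕ => (∑ k ∈ Finset.Icc 1 n, if ε ≤ |v k| then (1 : ℝ) else 0) / n)
      atTop (𝓝 0)) :
    Tendsto (fun n : ℕ => (∑ k ∈ Finset.Icc 1 n, |v k|) / n) atTop (𝓝 0) := by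
  obtain ⟨N, hN⟩ := eventually_atTop.1 hB
  set M := |B| + ∑ k ∈ Finset.range N, |v k| with hM
  have hM0 : 0 ≤ M := add_nonneg (abs_nonneg B) (Finset.sum_nonneg fun _ _ => abs_nonneg _)
  have hvM : ∀ k, |v k| ≤ M := by
    intro k
    rcases lt_or_ge k N with hk | hk
    · have := Finset.single_le_sum (f := fun k => |v k|) (fun _ _ => abs_nonneg _)
        (Finset.mem_range.2 hk)
      linarith [abs_nonneg B]
    · have h1 : 0 ≤ ∑ k ∈ Finset.range N, |v k| := Finset.sum_nonneg fun _ _ => abs_nonneg _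
      linarith [hN k hk, le_abs_self B]
  have hnn : ∀ n : ℕ, 0 ≤ (∑ k ∈ Finset.Icc 1 n, |v k|) / n := fun n =>
    div_nonneg (Finset.sum_nonneg fun _ _ => abs_nonneg _) (Nat.cast_nonneg n)
  refine (nhds_basis_zero_abs_lt ℝ).tendsto_right_iff.2 fun ε hε => ?_
  have h1 := (h (ε / 2) (half_pos hε)).const_mul M
  rw [mul_zero] at h1
  filter_upwards [h1.eventually (gt_mem_nhds (half_pos hε)), eventually_gt_atTop 0] with n h2 h3
  have hn : (0 : ℝ) < n := by exact_mod_cast h3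
  change |_| < ε
  rw [abs_of_nonneg (hnn n), div_lt_iff₀ hn]
  rw [← mul_div_assoc, div_lt_iff₀ hn] at h2
  have h4 : ∑ k ∈ Finset.Icc 1 n, |v k| ≤
      ∑ k ∈ Finset.Icc 1 n, (ε / 2 + M * if ε / 2 ≤ |v k| then (1 : ℝ) else 0) := by
    refine Finset.sum_le_sum fun k _ => ?_
    split_ifs with hk
    · linarith [hvM k]
    · linarith
  rw [Finset.sum_add_distrib, Finset.sum_const, Nat.card_Icc, Nat.add_sub_cancel, nsmul_eq_mul,
    ← Finset.mul_sum] at h4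
  linarith

variable {Ω : Type*} [MeasurableSpace Ω] {P : Measure Ω} [IsProbabilityMeasure P]

/-- The expected value of the sum is finite, so the sum is finite almost surely, whatever the
dependence between the events. -/
lemma ae_summable_indicator {s : ℕ → Set Ω} (hs : ∀ k, MeasurableSet (s k)) {w : ℕ → ℝ}
    (hw : ∀ k, 0 ≤ w k) (h : Summable fun k => w k * P.real (s k)) :
    ∀ᵐ ω ∂P, Summable fun k => (s k).indicator (fun _ => w k) ω := by
  have h1 : ∫⁻ ω, ∑' k, (s k).indicator (fun _ => ENNReal.ofReal (w k)) ω ∂P ≠ ⊤ := by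
    rw [lintegral_tsum fun k => (measurable_const.indicator (hs k)).aemeasurable]
    have e : ∀ k, ∫⁻ ω, (s k).indicator (fun _ => ENNReal.ofReal (w k)) ω ∂P =
        ENNReal.ofReal (w k * P.real (s k)) := by
      intro k
      rw [lintegral_indicator_const (hs k), ENNReal.ofReal_mul (hw k), ofReal_measureReal]
    simp only [e]
    exact h.tsum_ofReal_ne_top
  have h2 := ae_lt_top (Measurable.tsum fun k => measurable_const.indicator (hs k)) h1
  filter_upwards [h2] with ω hω
  refine (ENNReal.summable_toReal hω.ne).congr fun k => ?_
  by_cases hk : ω ∈ s k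
  · rw [Set.indicator_of_mem hk, Set.indicator_of_mem hk, ENNReal.toReal_ofReal (hw k)]
  · rw [Set.indicator_of_notMem hk, Set.indicator_of_notMem hk, ENNReal.toReal_zero]

end Cesaro

/-! ### Sums of the longest lengths along powers of two -/

section MeanLengths

variable {Ω : Type*} [MeasurableSpace Ω] {P : Measure Ω} [IsProbabilityMeasure P] {p : ℝ}
  {ξ : ℕ → Ω → ℝ} {ε : ℝ}

-- The upper tail is of order `k ^ (ε log p)`, which need not be summable for small `ε`. Dividing by
-- `k` makes it summable, which is enough for density zero.
open Classical in
lemma ae_tendsto_freq_normW_two_pow (hp0 : 0 < p) (hp1 : p < 1) (hη : IsCoin P p (bit ξ))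
    (hε : 0 < ε) : ∀ᵐ ω ∂P, Tendsto (fun n : ℕ =>
      (∑ k ∈ Finset.Icc 1 n, if ε ≤ |normW ξ p (2 ^ k) ω| then (1 : ℝ) else 0) / n) atTop (𝓝 0) := by
  obtain ⟨K, hK0, hK⟩ := exists_real_normW_le_le hp0 hp1
  have hl := Real.log_neg hp0 hp1
  have hεl : ε * Real.log p < 0 := by nlinarith
  set s : ℕ → Set Ω := fun k => {ω | ε ≤ |normW ξ p (2 ^ k) ω|} with hs
  have hmeas : ∀ k, MeasurableSet (s k) := by
    intro k
    have h1 : Measurable (fun ω => (W ξ (2 ^ k) ω : ℝ)) :=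
      measurable_from_nat.comp (measurable_W hη (by positivity))
    have h2 : Measurable (normW ξ p (2 ^ k)) := (h1.sub_const _).div_const _
    exact measurableSet_le measurable_const h2.abs
  have h1 : Summable fun k : ℕ => Real.log 2 ^ (ε * Real.log p) *
      (k : ℝ) ^ (ε * Real.log p - 1) :=
    (Real.summable_nat_rpow.2 (by linarith)).mul_left _
  have hsum : Summable fun k : ℕ => 1 / (k : ℝ) * P.real (s k) := by
    refine Summable.of_norm_bounded_eventually_nat
      (h1.add (summable_lower_tail_two_pow hp0 hp1 hK0 hε)) ?_
    filter_upwards [eventually_real_le_normW_two_pow_le hp0 hp1 hη ε,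
      tendsto_two_pow.eventually (hK Ω P ξ hη ε hε), eventually_ge_atTop 1] with k h2 h3 h4
    have hk0 : (0 : ℝ) < k := by exact_mod_cast h4
    have hk1 : 1 / (k : ℝ) ≤ 1 := by
      rw [div_le_one hk0]
      exact_mod_cast h4
    have hsub : s k ⊆ {ω | ε ≤ normW ξ p (2 ^ k) ω} ∪ {ω | normW ξ p (2 ^ k) ω ≤ -ε} := by
      intro ω hω
      rcases le_abs.1 (show ε ≤ |normW ξ p (2 ^ k) ω| from hω) with h | h
      · exact Or.inl h
      · exact Or.inr (show normW ξ p (2 ^ k) ω ≤ -ε by linarith)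
    have h5 := (measureReal_mono (μ := P) hsub).trans (measureReal_union_le _ _)
    have h6 : (0 : ℝ) ≤ P.real {ω | normW ξ p (2 ^ k) ω ≤ -ε} := measureReal_nonneg
    rw [Real.norm_of_nonneg (mul_nonneg (by positivity) measureReal_nonneg),
      Real.rpow_sub_one hk0.ne']
    calc 1 / (k : ℝ) * P.real (s k)
        ≤ 1 / (k : ℝ) * (P.real {ω | ε ≤ normW ξ p (2 ^ k) ω}
            + P.real {ω | normW ξ p (2 ^ k) ω ≤ -ε}) := by gcongr
      _ = 1 / (k : ℝ) * P.real {ω | ε ≤ normW ξ p (2 ^ k) ω}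
            + 1 / (k : ℝ) * P.real {ω | normW ξ p (2 ^ k) ω ≤ -ε} := by ring
      _ ≤ 1 / (k : ℝ) * (Real.log 2 ^ (ε * Real.log p) * (k : ℝ) ^ (ε * Real.log p))
            + 1 * P.real {ω | normW ξ p (2 ^ k) ω ≤ -ε} := by gcongr
      _ ≤ _ := by
        rw [one_mul]
        refine add_le_add (le_of_eq ?_) h3
        ring
  filter_upwards [ae_summable_indicator hmeas (fun k => by positivity) hsum] with ω hω
  refine tendsto_mean_of_summable_div (fun k => by split_ifs <;> norm_num) (hω.congr fun k => ?_)
  by_cases hk : ε ≤ |normW ξ p (2 ^ k) ω|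
  · rw [if_pos hk, Set.indicator_of_mem (show ω ∈ s k from hk)]
  · rw [if_neg hk, Set.indicator_of_notMem (show ω ∉ s k from hk), zero_div]

lemma ae_tendsto_mean_abs_normW_two_pow (hp0 : 0 < p) (hp1 : p < 1) (hη : IsCoin P p (bit ξ)) :
    ∀ᵐ ω ∂P, Tendsto (fun n : ℕ => (∑ k ∈ Finset.Icc 1 n, |normW ξ p (2 ^ k) ω|) / n)
      atTop (𝓝 0) := by
  classical
  have hD := D_neg hp0 hp1
  have h := ae_all_iff.2 fun j : ℕ => ae_tendsto_freq_normW_two_pow hp0 hp1 hη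
    (ε := 1 / ((j : ℝ) + 1)) (by positivity)
  filter_upwards [h, ae_eventually_normW_two_pow_le hp0 hp1 hη one_pos,
    ae_eventually_le_normW_two_pow hp0 hp1 hη one_pos] with ω h1 h2 h3
  refine tendsto_mean_abs (B := -D p + 1) ?_ fun ε hε => ?_
  · filter_upwards [h2, h3] with k h4 h5
    exact abs_le.2 ⟨by linarith, h4⟩
  · obtain ⟨j, hj⟩ := exists_nat_one_div_lt hε
    refine squeeze_zero (fun n => ?_) (fun n => ?_) (h1 j)
    · exact div_nonneg (Finset.sum_nonneg fun k _ => by split_ifs <;> norm_num) (Nat.cast_nonneg n)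
    · refine div_le_div_of_nonneg_right (Finset.sum_le_sum fun k _ => ?_) (Nat.cast_nonneg n)
      split_ifs with h4 h5
      · exact le_rfl
      · exact absurd (hj.le.trans h4) h5
      · norm_num
      · exact le_rfl

/-- The nonvanishing part includes `k = 1`, where the iterated logarithm is negative. It allows `W`
to be recovered from `normW` for every `k ≥ 1`. -/
lemma abs_log_log_two_pow_le {k n : ℕ} (hk : 1 ≤ k) (hkn : k ≤ n) :
    |Real.log (Real.log ((2 ^ k : ℕ) : ℝ))| ≤ Real.log n + 1 ∧
      Real.log (Real.log ((2 ^ k : ℕ) : ℝ)) ≠ 0 := by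
  have hl2 : 0 < Real.log 2 := Real.log_pos (by norm_num)
  have hl2a := Real.log_two_gt_d9
  have hl2b := Real.log_two_lt_d9
  have hk0 : (0 : ℝ) < k := by exact_mod_cast hk
  have hk1 : (1 : ℝ) ≤ k := by exact_mod_cast hk
  have hlk : Real.log k ≤ Real.log n := Real.log_le_log hk0 (by exact_mod_cast hkn)
  have hlk0 : 0 ≤ Real.log k := Real.log_nonneg hk1
  have h1 : Real.log (Real.log 2) ≤ 0 := Real.log_nonpos hl2.le (by linarith)
  have h2 : -1 ≤ Real.log (Real.log 2) := by
    have := Real.one_sub_inv_le_log_of_pos hl2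
    have h3 : (Real.log 2)⁻¹ ≤ 2 := by
      rw [inv_le_comm₀ hl2 two_pos]
      linarith
    linarith
  rw [log_two_pow]
  constructor
  · rw [Real.log_mul hk0.ne' hl2.ne', abs_le]
    constructor <;> linarith
  · refine Real.log_ne_zero_of_pos_of_ne_one (by positivity) ?_
    rcases Nat.lt_or_ge k 2 with h | h
    · obtain rfl : k = 1 := by omega
      rw [Nat.cast_one, one_mul]
      linarith
    · have : (2 : ℝ) ≤ k := by exact_mod_cast h
      nlinarith

/-- The centring terms add up to `C log 2 * n (n + 1) / 2`. As `C = -2 / log p`, their quadratic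
part cancels and only a linear term remains, negligible against `n log n`. -/
lemma sum_W_two_pow (n : ℕ) (ω : Ω) :
    (∑ k ∈ Finset.Icc 1 n, (W ξ (2 ^ k) ω : ℝ)) + Real.log 2 / Real.log p * (n : ℝ) ^ 2 =
      (∑ k ∈ Finset.Icc 1 n, normW ξ p (2 ^ k) ω * Real.log (Real.log ((2 ^ k : ℕ) : ℝ)))
        - Real.log 2 / Real.log p * n := by
  have hterm : ∀ k ∈ Finset.Icc 1 n, (W ξ (2 ^ k) ω : ℝ) =
      normW ξ p (2 ^ k) ω * Real.log (Real.log ((2 ^ k : ℕ) : ℝ)) + C p * Real.log 2 * k := by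
    intro k hk
    rw [Finset.mem_Icc] at hk
    rw [normW, div_mul_cancel₀ _ (abs_log_log_two_pow_le hk.1 hk.2).2, log_two_pow]
    ring
  have hsum : ∀ n : ℕ, ∑ k ∈ Finset.Icc 1 n, (k : ℝ) = n * (n + 1) / 2 := by
    intro n
    induction n with
    | zero => simp
    | succ n ih =>
      rw [Finset.sum_Icc_succ_top (by omega), ih]
      push_cast
      ring
  rw [Finset.sum_congr rfl hterm, Finset.sum_add_distrib, ← Finset.mul_sum, hsum, C]
  ring

/-- The almost sure behaviour of the sums of the longest lengths along the powers of two. -/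
theorem ae_tendsto_sum_W_two_pow (hp0 : 0 < p) (hp1 : p < 1) (hη : IsCoin P p (bit ξ)) :
    ∀ᵐ ω ∂P, Tendsto (fun n : ℕ => 1 / ((n : ℝ) * Real.log n) *
      ((∑ k ∈ Finset.Icc 1 n, (W ξ (2 ^ k) ω : ℝ)) + Real.log 2 / Real.log p * (n : ℝ) ^ 2))
      atTop (𝓝 0) := by
  filter_upwards [ae_tendsto_mean_abs_normW_two_pow hp0 hp1 hη] with ω hω
  have hinv := tendsto_log_nat.const_div_atTop 1
  have hlim := (hω.mul (hinv.const_add 1)).add (hinv.const_mul |Real.log 2 / Real.log p|)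
  rw [zero_mul, mul_zero, add_zero] at hlim
  refine squeeze_zero_norm' ?_ hlim
  filter_upwards [tendsto_log_nat.eventually_gt_atTop 0, eventually_gt_atTop 0] with n h1 h2
  have hn : (0 : ℝ) < n := by exact_mod_cast h2
  rw [sum_W_two_pow, Real.norm_eq_abs, abs_mul, abs_of_pos (by positivity : 0 < 1 / (n * Real.log n))]
  have h3 : |∑ k ∈ Finset.Icc 1 n, normW ξ p (2 ^ k) ω * Real.log (Real.log ((2 ^ k : ℕ) : ℝ))| ≤
      (∑ k ∈ Finset.Icc 1 n, |normW ξ p (2 ^ k) ω|) * (Real.log n + 1) := by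
    rw [Finset.sum_mul]
    refine (Finset.abs_sum_le_sum_abs _ _).trans (Finset.sum_le_sum fun k hk => ?_)
    rw [Finset.mem_Icc] at hk
    rw [abs_mul]
    exact mul_le_mul_of_nonneg_left (abs_log_log_two_pow_le hk.1 hk.2).1 (abs_nonneg _)
  have h4 := abs_sub (∑ k ∈ Finset.Icc 1 n, normW ξ p (2 ^ k) ω *
    Real.log (Real.log ((2 ^ k : ℕ) : ℝ))) (Real.log 2 / Real.log p * n)
  rw [abs_mul (Real.log 2 / Real.log p), abs_of_pos hn] at h4
  calc _ ≤ 1 / (n * Real.log n) * ((∑ k ∈ Finset.Icc 1 n, |normW ξ p (2 ^ k) ω|)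
          * (Real.log n + 1) + |Real.log 2 / Real.log p| * n) :=
        mul_le_mul_of_nonneg_left (by linarith) (by positivity)
    _ = _ := by field_simp

end MeanLengths

end LongestAP

/-! ### The theorem -/

open LongestAP in
theorem theorem1p2 (p : ℝ) (hp0 : 0 < p) (hp1 : p < 1) :
    ∃ (K : ℝ) (K' : ℝ → ℝ),
      ∀ (Ω : Type*) [MeasurableSpace Ω] (P : Measure Ω) [IsProbabilityMeasure P]
        (ξ : ℕ → Ω → ℝ), IsBernoulliSequence P p ξ →
        -- (1) error bound, uniform in `1 < r ≤ n`
        (∀ n r : ℕ, 1 < r → r ≤ n →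
          |P.real {ω | W ξ n ω < r} - Real.exp (-((1 - p) * (n : ℝ) ^ 2 * p ^ r / 2))|
            ≤ K * (Real.log n ^ 7 / n)) ∧
        -- (2) relative error bound around `C ln n`, for each real `a`
        (∀ (a : ℝ) (n : ℕ), 2 ≤ n → ∀ x : ℝ,
          D p * Real.log (Real.log n) + a ≤ x →
          (∃ z : ℤ, C p * Real.log n + x = z) →
          |Real.exp ((1 - p) / 2 * p ^ x) *
              P.real {ω | (W ξ n ω : ℝ) < C p * Real.log n + x} - 1|
            ≤ K' a * (Real.log n ^ 7 / (n : ℝ) ^ (1 - (1 - p) * p ^ a / 2))) ∧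
        -- (3) convergence in probability
        TendstoInMeasure P (normW ξ p) atTop (fun _ => (0 : ℝ)) ∧
        -- (4) almost sure upper and lower limits
        (∀ᵐ ω ∂P,
          limsup (fun n : ℕ => (((W ξ n ω : ℝ) / (C p * Real.log n) : ℝ) : EReal)) atTop
            = ((3 / 2 : ℝ) : EReal)) ∧
        (∀ᵐ ω ∂P,
          liminf (fun n : ℕ => ((normW ξ p n ω : ℝ) : EReal)) atTop = ((D p : ℝ) : EReal)) ∧
        -- (5) almost sure behaviour along the powers of two
        (∀ᵐ ω ∂P,
          liminf (fun n : ℕ => ((normW ξ p (2 ^ n) ω : ℝ) : EReal)) atTop = 0 ∧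
          liminf (fun n : ℕ => ((normW ξ p (2 ^ n) ω : ℝ) : EReal)) atTop
            < limsup (fun n : ℕ => ((normW ξ p (2 ^ n) ω : ℝ) : EReal)) atTop ∧
          limsup (fun n : ℕ => ((normW ξ p (2 ^ n) ω : ℝ) : EReal)) atTop
            = ((-D p : ℝ) : EReal)) ∧
        (∀ᵐ ω ∂P,
          Tendsto (fun n : ℕ => 1 / ((n : ℝ) * Real.log n) *
            ((∑ k ∈ Finset.Icc 1 n, (W ξ (2 ^ k) ω : ℝ)) + Real.log 2 / Real.log p * (n : ℝ) ^ 2))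
            atTop (𝓝 0)) := by
  obtain ⟨K, hK0, hK⟩ := exists_poisson_error_bound hp0 hp1
  choose K' hK' using fun a => exists_relative_error_bound hp0 hp1 hK0 a
  refine ⟨K, K', fun Ω _ P _ ξ hξ => ?_⟩
  have hη := hξ.isCoin hp0.le
  refine ⟨fun n r hr hrn => ?_, fun a n hn x hx hz => ?_, tendstoInMeasure_normW hp0 hp1 hη,
    ae_limsup_ratio hp0 hp1 hη, ae_liminf_normW hp0 hp1 hη,
    ae_liminf_limsup_normW_two_pow hp0 hp1 hη, ae_tendsto_sum_W_two_pow hp0 hp1 hη⟩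
  · rw [real_W_lt (by omega) (by omega)]
    exact hK n r (by omega) hr Ω P (bit ξ) hη
  · exact hK' a Ω P ξ hη (fun n r hn hr => hK n r hn hr Ω P (bit ξ) hη) n hn x hx hz
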